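/- All Hilbert spaces are finite dimensional, $\log=\log_2$, $\|X\|_1=\mathrm{tr}\sqrt{X^\dagger X}$, and $\nu(X)$ is the number of distinct eigenvalues of $X$. Negative powers of positive operators are taken on the support. For a state $\rho$ put $H^a(\rho)=-\frac1a\log\mathrm{tr}\,\rho^{1+a}$. For a cq state $\rho_{XB}=\sum_xP_X(x)|x\rangle\langle x|\otimes\rho_B^x$ ($X$ finite) put $$I^{\mathsf h}_a(X;B)_\rho=-\tfrac1a\log\mathrm{tr}\big(\rho_{XB}(\rho_X\otimes\rho_B)^{a/2}\rho_{XB}^{-a}(\rho_X\otimes\rho_B)^{a/2}\big),\qquad I^{\mathsf r}_a(X;B)_\rho=-\tfrac1a\log\sum_xP_X(x)\,\mathrm{tr}\big((\rho_B^x)^{1-a}\rho_B^a\big).$$ An $(M,\epsilon)^{\mathrm{CC}}$ code for a channel $\Phi:A^n\to B^n$ is an encoder $f:\{1,\dots,M\}\to\mathcal D(\mathcal H_A^{\otimes n})$ and a POVM $\{\Lambda^w\}_{w=1}^M$ on $\mathcal H_B^{\otimes n}$ with $\frac1M\sum_w\mathrm{tr}(\Lambda^w\Phi(f(w)))\ge1-\epsilon$.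 Its induced output state is $\frac1M\sum_w\Phi(f(w))$. A code with a shared key of size $K$ is a family of $K$ such pairs (encoder, POVM) indexed by the key; its success probability and its induced output state are averaged also over the uniformly distributed key. **Theorem.** Let $\mathcal N_{A\to B}$ and $\mathcal M_{A\to A}$ be quantum channels and $M\ge1$. Let $(f,\Lambda)$ be an $(M,\epsilon)^{\mathrm{CC}}$ code (the cover code) for $\mathcal N^{\otimes n}\circ\mathcal M^{\otimes n}$ with induced output state $\rho^c_{B^n}$. Write $\rho^w_{B^n}=\mathcal N^{\otimes n}\circ\mathcal M^{\otimes n}(f(w))$. 1. *Noiseless true channel.* Suppose $\mathcal H_A=\mathcal H_B$ and $\mathcal N=\mathrm{id}_A$. Let $\zeta>0$, and let $\overline M\ge1$ be an integer with $$\log\overline M\le\min_w\sup_{a\in(0,1)}\Big[H^a(\rho^w_{B^n})-\tfrac4a\log\tfrac2\zeta\Big].$$ Then there is an $(M\overline M,\ \zeta+2\sqrt{\zeta+\epsilon})^{\mathrm{CC}}$ code for $\mathcal N^{\otimes n}$, without a key, whose induced output state $\rho^s_{B^n}$ satisfies $\|\rho^s_{B^n}-\rho^c_{B^n}\|_1\le\zeta$.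 2. *Noisy true channel.* Let $\mathcal N$ be arbitrary. Let $\sigma^1_{XA^n},\dots,\sigma^M_{XA^n}$ be cq states such that $\sigma^w_{XB^n}=(\mathrm{id}_X\otimes\mathcal N^{\otimes n})(\sigma^w_{XA^n})$ satisfies $\mathrm{tr}_X\,\sigma^w_{XB^n}=\rho^w_{B^n}$ for all $w$. Let $\zeta,\xi\in(0,1)$ and define the real numbers $\overline M_w>0$ by $$\log\overline M_w=\sup_{a\in(0,1)}\Big[I^{\mathsf h}_a(X;B^n)_{\sigma^w}-\tfrac1a\log\nu(\sigma^w_X\otimes\sigma^w_{B^n})-\tfrac4a\log\tfrac{12}\zeta\Big].$$ Let $\overline M,\overline K\ge1$ be integers with $\log\overline M\le\min_w\log\overline M_w$ and $$\log\overline K\ge\max_w\Big\{\inf_{a<0}\Big[I^{\mathsf r}_a(X;B^n)_{\sigma^w}+\log\nu(\rho^w_{B^n})+\big(2-\tfrac2a\big)\log\tfrac{12}\xi\Big]-\log\overline M_w+1\Big\}.$$ Then there is an $(M\overline M,\ \zeta+2\sqrt{\xi+\epsilon})^{\mathrm{CC}}$ code for $\mathcal N^{\otimes n}$ with a shared key of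 size $\overline K$, whose induced output state $\rho^s_{B^n}$ satisfies $\|\rho^s_{B^n}-\rho^c_{B^n}\|_1\le\xi$. -/

import Mathlib

open scoped Kronecker ComplexOrder

namespace QStego

noncomputable section

/-- Real powers of a Hermitian matrix through its spectral decomposition. As `0 ^ r = 0` for
`r ≠ 0` in `ℝ`, negative powers are taken on the support of the matrix. -/
def mpow {d : Type*} [Fintype d] [DecidableEq d] (A : Matrix d d ℂ) (r : ℝ) : Matrix d d ℂ :=
  cfc (fun x : ℝ => x ^ r) A

/-- Trace norm `‖X‖₁ = tr √(Xᴴ X)`. -/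
def traceNorm {d : Type*} [Fintype d] [DecidableEq d] (X : Matrix d d ℂ) : ℝ :=
  (cfc Real.sqrt (X.conjTranspose * X)).trace.re

/-- Number of distinct eigenvalues. -/
def numEigenvalues {d : Type*} [Fintype d] [DecidableEq d] (X : Matrix d d ℂ) : ℕ :=
  (spectrum ℂ X).ncard

/-- Density operators. -/
def IsDensity {d : Type*} [Fintype d] (ρ : Matrix d d ℂ) : Prop :=
  ρ.PosSemidef ∧ ρ.trace = 1

/-- POVMs with outcomes in `ι`. -/
def IsPOVM {ι d : Type*} [Fintype ι] [Fintype d] [DecidableEq d]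
    (Λ : ι → Matrix d d ℂ) : Prop :=
  (∀ i, (Λ i).PosSemidef) ∧ ∑ i, Λ i = 1

/-- `id_k ⊗ Φ`: apply `Φ` to every `d × d` block of a `k × k` block matrix. -/
def ampl {d e : Type*} (k : ℕ) (Φ : Matrix d d ℂ →ₗ[ℂ] Matrix e e ℂ)
    (X : Matrix (Fin k × d) (Fin k × d) ℂ) : Matrix (Fin k × e) (Fin k × e) ℂ :=
  Matrix.of fun i j => Φ (Matrix.of fun p q => X (i.1, p) (j.1, q)) i.2 j.2

/-- Quantum channels: completely positive trace-preserving linear maps. -/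
def IsChannel {d e : Type*} [Fintype d] [Fintype e]
    (Φ : Matrix d d ℂ →ₗ[ℂ] Matrix e e ℂ) : Prop :=
  (∀ (k : ℕ) (X : Matrix (Fin k × d) (Fin k × d) ℂ), X.PosSemidef → (ampl k Φ X).PosSemidef) ∧
  ∀ X, (Φ X).trace = X.trace

/-- The tensor power `Φ^{⊗n}`. The space `H_d^{⊗n}` has the product basis indexed by `Fin n → d`,
and `|k₁⋯kₙ⟩⟨l₁⋯lₙ|` is sent to `Φ(|k₁⟩⟨l₁|) ⊗ ⋯ ⊗ Φ(|kₙ⟩⟨lₙ|)`. -/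
def tensorPow {d e : Type*} [Fintype d] [DecidableEq d] (n : ℕ)
    (Φ : Matrix d d ℂ →ₗ[ℂ] Matrix e e ℂ) :
    Matrix (Fin n → d) (Fin n → d) ℂ →ₗ[ℂ] Matrix (Fin n → e) (Fin n → e) ℂ where
  toFun X := Matrix.of fun i j =>
    ∑ k : Fin n → d, ∑ l : Fin n → d,
      X k l * ∏ m, Φ (Matrix.single (k m) (l m) 1) (i m) (j m)
  map_add' X Y := by
    ext i j
    simp [add_mul, Finset.sum_add_distrib]
  map_smul' c X := by
    ext i j
    simp [Finset.mul_sum, mul_assoc]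

/-- A classical code with `M` messages for a channel from `d` to `e`: encoder and POVM decoder. -/
structure CCCode (M : ℕ) (d e : Type*) [Fintype d] [Fintype e] [DecidableEq e] where
  enc : Fin M → Matrix d d ℂ
  enc_density : ∀ w, IsDensity (enc w)
  dec : Fin M → Matrix e e ℂ
  dec_povm : IsPOVM dec

/-- Success probability for a uniform message. -/
def CCCode.success {M : ℕ} {d e : Type*} [Fintype d] [Fintype e] [DecidableEq e]
    (C : CCCode M d e) (Φ : Matrix d d ℂ →ₗ[ℂ] Matrix e e ℂ) : ℝ :=
  (1 / (M : ℝ)) * ∑ w, (C.dec w * Φ (C.enc w)).trace.re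

/-- Induced output state for a uniform message. -/
def CCCode.output {M : ℕ} {d e : Type*} [Fintype d] [Fintype e] [DecidableEq e]
    (C : CCCode M d e) (Φ : Matrix d d ℂ →ₗ[ℂ] Matrix e e ℂ) : Matrix e e ℂ :=
  (1 / (M : ℂ)) • ∑ w, Φ (C.enc w)

/-- `C` is an `(M, ε)` classical-communication code for the channel `Φ`. -/
def CCCode.IsCC {M : ℕ} {d e : Type*} [Fintype d] [Fintype e] [DecidableEq e]
    (C : CCCode M d e) (Φ : Matrix d d ℂ →ₗ[ℂ] Matrix e e ℂ) (ε : ℝ) : Prop :=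
  1 - ε ≤ C.success Φ

/-- A family of codes `C s` selected by a shared key `s`, uniform over `K` values, is an `(M, ε)`
classical-communication code for the channel `Φ`. -/
def IsKeyedCC {K M : ℕ} {d e : Type*} [Fintype d] [Fintype e] [DecidableEq e]
    (C : Fin K → CCCode M d e) (Φ : Matrix d d ℂ →ₗ[ℂ] Matrix e e ℂ) (ε : ℝ) : Prop :=
  1 - ε ≤ (1 / (K : ℝ)) * ∑ s, (C s).success Φ

/-- Induced output state of a keyed code, averaged over the uniform key and message. -/
def keyedOutput {K M : ℕ} {d e : Type*} [Fintype d] [Fintype e] [DecidableEq e]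
    (C : Fin K → CCCode M d e) (Φ : Matrix d d ℂ →ₗ[ℂ] Matrix e e ℂ) : Matrix e e ℂ :=
  (1 / (K : ℂ)) • ∑ s, (C s).output Φ

/-- Rényi entropy `H^a(ρ) = -(1/a) log₂ tr ρ^{a+1}`. -/
def renyiEntropy {d : Type*} [Fintype d] [DecidableEq d] (a : ℝ) (ρ : Matrix d d ℂ) : ℝ :=
  -(1 / a) * Real.logb 2 (mpow ρ (a + 1)).trace.re

/-- The data `P_X`, `ρ^x` of an operator `∑ₓ P_X(x) |x⟩⟨x| ⊗ ρ^x`. -/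
structure CQ (X d : Type*) where
  P : X → ℝ
  st : X → Matrix d d ℂ

/-- The data define a classical-quantum state. -/
def CQ.IsState {X d : Type*} [Fintype X] [Fintype d] (σ : CQ X d) : Prop :=
  (∀ x, 0 ≤ σ.P x) ∧ ∑ x, σ.P x = 1 ∧ ∀ x, IsDensity (σ.st x)

/-- The joint operator `∑ₓ P_X(x) |x⟩⟨x| ⊗ ρ^x`. -/
def CQ.joint {X d : Type*} [Fintype X] [DecidableEq X] (σ : CQ X d) :
    Matrix (X × d) (X × d) ℂ :=
  ∑ x, (σ.P x : ℂ) • (Matrix.single x x (1 : ℂ) ⊗ₖ σ.st x)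

/-- The marginal on the classical system. -/
def CQ.margX {X d : Type*} [DecidableEq X] (σ : CQ X d) : Matrix X X ℂ :=
  Matrix.diagonal fun x => (σ.P x : ℂ)

/-- The marginal on the quantum system, `∑ₓ P_X(x) ρ^x`. -/
def CQ.margQ {X d : Type*} [Fintype X] (σ : CQ X d) : Matrix d d ℂ :=
  ∑ x, (σ.P x : ℂ) • σ.st x

/-- `(id_X ⊗ Φ)(σ)`. -/
def CQ.map {X d e : Type*} (Φ : Matrix d d ℂ →ₗ[ℂ] Matrix e e ℂ) (σ : CQ X d) : CQ X e where
  P := σ.P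
  st x := Φ (σ.st x)

/-- `-(1/a) log₂ tr (ρ_XB (ρ_X ⊗ ρ_B)^{a/2} ρ_XB^{-a} (ρ_X ⊗ ρ_B)^{a/2})`. -/
def mutualInfoH {X d : Type*} [Fintype X] [DecidableEq X] [Fintype d] [DecidableEq d]
    (a : ℝ) (σ : CQ X d) : ℝ :=
  -(1 / a) * Real.logb 2
    (σ.joint * mpow (σ.margX ⊗ₖ σ.margQ) (a / 2) * mpow σ.joint (-a) *
      mpow (σ.margX ⊗ₖ σ.margQ) (a / 2)).trace.re

/-- `-(1/a) log₂ ∑ₓ P_X(x) tr ((ρ^x)^{1-a} ρ_B^a)`. -/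
def mutualInfoR {X d : Type*} [Fintype X] [Fintype d] [DecidableEq d]
    (a : ℝ) (σ : CQ X d) : ℝ :=
  -(1 / a) * Real.logb 2
    (∑ x, σ.P x * (mpow (σ.st x) (1 - a) * mpow σ.margQ a).trace.re)

/-- The noiseless rate term `sup_{a ∈ (0,1)} (H^a(ρ) - (4/a) log₂ (2/ζ))`. -/
def noiselessRate {d : Type*} [Fintype d] [DecidableEq d] (ζ : ℝ) (ρ : Matrix d d ℂ) : EReal :=
  ⨆ a ∈ Set.Ioo (0 : ℝ) 1,
    ((renyiEntropy a ρ - 4 / a * Real.logb 2 (2 / ζ) : ℝ) : EReal)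

/-- The noisy rate term (one-shot coding bound). -/
def noisyRate {X d : Type*} [Fintype X] [DecidableEq X] [Fintype d] [DecidableEq d]
    (ζ : ℝ) (σ : CQ X d) : EReal :=
  ⨆ a ∈ Set.Ioo (0 : ℝ) 1,
    ((mutualInfoH a σ - 1 / a * Real.logb 2 (numEigenvalues (σ.margX ⊗ₖ σ.margQ) : ℝ)
      - 4 / a * Real.logb 2 (12 / ζ) : ℝ) : EReal)

/-- The one-shot resolvability bound. -/
def resolvabilityRate {X d : Type*} [Fintype X] [Fintype d] [DecidableEq d]
    (ξ : ℝ) (σ : CQ X d) : EReal :=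
  ⨅ a ∈ Set.Iio (0 : ℝ),
    ((mutualInfoR a σ + Real.logb 2 (numEigenvalues σ.margQ : ℝ)
      + (2 - 2 / a) * Real.logb 2 (12 / ξ) : ℝ) : EReal)

end

end QStego

open QStego

/-! In both parts every cover output `ρ^w` is replaced by a family of channel outputs, indexed by
the inner message (and the key), whose average is `ρ^w` exactly or approximately. The receiver
applies the cover measurement `Λ` and then an inner measurement `D w`, so the effects of the joint
decoder are `Λ_w^{1/2} D_{w,m} Λ_w^{1/2}`. If `Λ` has average error at most `δ` on the new outputs
and `D` has average error at most `ζ`, gentle measurement (`norm_trace_mul_sub_conj_le`) and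
concavity of the square root bound the total error by `ζ + 2√δ`. This is `exists_keyed_code`.

Noiseless channel. The scaled eigenvalues `N p_i` of `ρ^w` are laid end to end on `[0, N]`, which is
cut into `N` unit intervals. Each interval yields a state diagonal in the eigenbasis of `ρ^w`, and
the average of these states is exactly `ρ^w`. An eigenvector inside one interval reveals the
message; at most `N` eigenvectors straddle a cut, and the Rényi entropy bound forces those with `N
p_i > ζ/2` to have small total weight. This is `exists_distinguishable_decomposition`. The output is
reproduced exactly, so `δ = ε` and no key is needed.

Noisy channel. Codewords are drawn independently from `P_X`, one for each key, message and filler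
index. Two properties hold on average. Decoding: the Chernoff-type test of `P(x) ρ^x` against `N
P(x) ρ_B` (`exists_test`), a Cauchy–Schwarz comparison with the overlap in `I^h_a`, and a sequential
decoder controlled by `quantum_union_bound`. Resolvability: each `ρ^x` is truncated to a part
dominated by `ρ_B` after pinching, and a second moment computation bounds the distance of the
empirical mean from `ρ_B` (`CQ.IsState.resolvability`). A Markov argument finds one codebook good
for both (`CQ.IsState.exists_codebook`).

The filler indices keep the key short: for a finite coding bound, `exists_multiplicity` fills the
codebook of each key up to within a factor 2 of it, and that factor is the `+ 1` in the condition on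
the key. Fillers are merged by mixing inputs and adding effects. As `Λ` now acts on states within
`ξ` of `ρ^w`, here `δ = ξ + ε`. -/

namespace QStego
open Matrix

set_option linter.unusedSectionVars false

/-! ### Spectral calculus for Hermitian matrices -/

section

variable {d m : Type*} [Fintype d] [DecidableEq d] [Fintype m]

lemma norm_trace_conjTranspose_mul_le (V W : Matrix m d ℂ) :
    ‖(Vᴴ * W).trace‖ ≤ √((Vᴴ * V).trace.re) * √((Wᴴ * W).trace.re) := by
  let toE : Matrix m d ℂ → EuclideanSpace ℂ (d × m) := fun X => WithLp.toLp 2 fun p => X p.2 p.1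
  have key (X Y : Matrix m d ℂ) : (Xᴴ * Y).trace = inner ℂ (toE X) (toE Y) := by
    simp [toE, PiLp.inner_apply, Matrix.trace, Matrix.mul_apply, Fintype.sum_prod_type, mul_comm]
  have hn (X : Matrix m d ℂ) : √((Xᴴ * X).trace.re) = ‖toE X‖ := by
    rw [key, inner_self_eq_norm_sq_to_K]
    norm_cast
    exact Real.sqrt_sq (norm_nonneg _)
  rw [hn, hn, key]
  exact norm_inner_le_norm _ _

/-- Spectral decomposition with a unitary matrix. -/
lemma exists_diagonalization {A : Matrix d d ℂ} (hA : A.IsHermitian) :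
    ∃ (U : Matrix d d ℂ) (l : d → ℝ), Uᴴ * U = 1 ∧ U * Uᴴ = 1 ∧
      A = U * diagonal (fun i => (l i : ℂ)) * Uᴴ := by
  refine ⟨hA.eigenvectorUnitary, hA.eigenvalues, ?_, ?_, ?_⟩
  · exact Unitary.coe_star_mul_self hA.eigenvectorUnitary
  · exact Unitary.coe_mul_star_self hA.eigenvectorUnitary
  · conv_lhs => rw [hA.spectral_theorem]
    rfl

lemma isHermitian_conj_diagonal (U : Matrix d d ℂ) (l : d → ℝ) :
    (U * diagonal (fun i => (l i : ℂ)) * Uᴴ).IsHermitian := by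
  apply Matrix.isHermitian_mul_mul_conjTranspose
  rw [Matrix.IsHermitian, Matrix.diagonal_conjTranspose]
  congr 1; ext i; simp

lemma posSemidef_conj_diagonal (U : Matrix d d ℂ) {l : d → ℝ} (hl : ∀ i, 0 ≤ l i) :
    (U * diagonal (fun i => (l i : ℂ)) * Uᴴ).PosSemidef := by
  apply PosSemidef.mul_mul_conjTranspose_same
  exact PosSemidef.diagonal (fun i => by simpa using hl i)

lemma conj_diagonal_nonneg {U : Matrix d d ℂ} {l : d → ℝ} (hU : Uᴴ * U = 1)
    (h : (U * diagonal (fun i => (l i : ℂ)) * Uᴴ).PosSemidef) (i : d) : 0 ≤ l i := by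
  have h1 := h.conjTranspose_mul_mul_same U
  have h2 : Uᴴ * (U * diagonal (fun i => (l i : ℂ)) * Uᴴ) * U
      = diagonal (fun i => (l i : ℂ)) := by
    simp only [Matrix.mul_assoc, hU, Matrix.mul_one]
    rw [← Matrix.mul_assoc, hU, Matrix.one_mul]
  rw [h2, posSemidef_diagonal_iff] at h1
  simpa using h1 i

lemma conj_diagonal_mul {U : Matrix d d ℂ} (hU : Uᴴ * U = 1) (f g : d → ℂ) :
    U * diagonal f * Uᴴ * (U * diagonal g * Uᴴ) = U * diagonal (fun i => f i * g i) * Uᴴ := by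
  rw [← Matrix.diagonal_mul_diagonal]
  simp only [Matrix.mul_assoc]
  rw [← Matrix.mul_assoc Uᴴ U, hU, Matrix.one_mul]

lemma trace_conj_diagonal {U : Matrix d d ℂ} (hU : Uᴴ * U = 1) (f : d → ℂ) :
    (U * diagonal f * Uᴴ).trace = ∑ i, f i := by
  rw [Matrix.trace_mul_comm, ← Matrix.mul_assoc, hU, Matrix.one_mul, Matrix.trace_diagonal]

/-- Makes the functional calculus computable in any eigenbasis. If `U` and `V` diagonalize the same
matrix, `Uᴴ V` intertwines the two diagonal matrices; its entry `(i, j)` can be nonzero only when `l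
i = e j`, so it also intertwines the diagonals after `g` is applied. -/
lemma cfc_conj_diagonal {U : Matrix d d ℂ} {l : d → ℝ} (hU : Uᴴ * U = 1) (hU' : U * Uᴴ = 1)
    (g : ℝ → ℝ) :
    cfc g (U * diagonal (fun i => (l i : ℂ)) * Uᴴ)
      = U * diagonal (fun i => (g (l i) : ℂ)) * Uᴴ := by
  have hA := isHermitian_conj_diagonal U l
  rw [hA.cfc_eq]
  set V : Matrix d d ℂ := (hA.eigenvectorUnitary : Matrix d d ℂ) with hVdef
  set e := hA.eigenvalues
  have hV : Vᴴ * V = 1 := Unitary.coe_star_mul_self hA.eigenvectorUnitary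
  have hV' : V * Vᴴ = 1 := Unitary.coe_mul_star_self hA.eigenvectorUnitary
  have hs : U * diagonal (fun i => (l i : ℂ)) * Uᴴ = V * diagonal (fun i => (e i : ℂ)) * Vᴴ :=
    hA.spectral_theorem
  change V * diagonal (fun i => (g (e i) : ℂ)) * Vᴴ = _
  have hW : diagonal (fun i => (l i : ℂ)) * (Uᴴ * V)
      = (Uᴴ * V) * diagonal (fun i => (e i : ℂ)) := by
    calc _ = Uᴴ * (U * diagonal (fun i => (l i : ℂ)) * Uᴴ) * V := by
          simp only [← Matrix.mul_assoc, hU, Matrix.one_mul]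
      _ = _ := by rw [hs]; simp only [Matrix.mul_assoc, hV, Matrix.mul_one]
  have hW' : diagonal (fun i => (g (l i) : ℂ)) * (Uᴴ * V)
      = (Uᴴ * V) * diagonal (fun i => (g (e i) : ℂ)) := by
    ext i j
    have := congrFun (congrFun hW i) j
    rw [Matrix.diagonal_mul, Matrix.mul_diagonal] at this ⊢
    by_cases h0 : (Uᴴ * V) i j = 0
    · simp [h0]
    · rw [mul_comm] at this
      have := mul_left_cancel₀ h0 this
      rw [Complex.ofReal_inj] at this
      rw [this, mul_comm]
  calc V * diagonal (fun i => (g (e i) : ℂ)) * Vᴴ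
      = U * ((Uᴴ * V) * diagonal (fun i => (g (e i) : ℂ))) * Vᴴ := by
        simp only [← Matrix.mul_assoc, hU', Matrix.one_mul]
    _ = _ := by rw [← hW']; simp only [Matrix.mul_assoc, hV', Matrix.mul_one]

lemma mpow_conj_diagonal {U : Matrix d d ℂ} {l : d → ℝ} (hU : Uᴴ * U = 1) (hU' : U * Uᴴ = 1)
    (r : ℝ) :
    mpow (U * diagonal (fun i => (l i : ℂ)) * Uᴴ) r
      = U * diagonal (fun i => ((l i ^ r : ℝ) : ℂ)) * Uᴴ :=
  cfc_conj_diagonal hU hU' _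

lemma mpow_posSemidef {A : Matrix d d ℂ} (hA : A.PosSemidef) (r : ℝ) :
    (mpow A r).PosSemidef := by
  obtain ⟨U, l, hU, hU', rfl⟩ := exists_diagonalization hA.isHermitian
  rw [mpow_conj_diagonal hU hU']
  exact posSemidef_conj_diagonal U fun i => Real.rpow_nonneg (conj_diagonal_nonneg hU hA i) _

/-- The signs matter: since `0 ^ 0 = 1` while negative powers of `0` vanish, exponents of opposite
sign can break the law on the kernel of `A`. -/
lemma mpow_mul_mpow {A : Matrix d d ℂ} (hA : A.PosSemidef) {r s : ℝ} (hr : 0 ≤ r) (hs : 0 ≤ s) :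
    mpow A r * mpow A s = mpow A (r + s) := by
  obtain ⟨U, l, hU, hU', rfl⟩ := exists_diagonalization hA.isHermitian
  have hl := conj_diagonal_nonneg hU hA
  rw [mpow_conj_diagonal hU hU', mpow_conj_diagonal hU hU', mpow_conj_diagonal hU hU',
    conj_diagonal_mul hU]
  congr 3
  ext i
  rw [Real.rpow_add_of_nonneg (hl i) hr hs, Complex.ofReal_mul]

lemma mpow_one {A : Matrix d d ℂ} (hA : A.IsHermitian) : mpow A 1 = A := by
  obtain ⟨U, l, hU, hU', rfl⟩ := exists_diagonalization hA
  rw [mpow_conj_diagonal hU hU']; simp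

lemma mpow_smul {A : Matrix d d ℂ} (hA : A.PosSemidef) {c : ℝ} (hc : 0 ≤ c) (r : ℝ) :
    mpow ((c : ℂ) • A) r = ((c ^ r : ℝ) : ℂ) • mpow A r := by
  obtain ⟨U, l, hU, hU', rfl⟩ := exists_diagonalization hA.isHermitian
  have hl := conj_diagonal_nonneg hU hA
  have key (c : ℂ) (f : d → ℂ) : c • (U * diagonal f * Uᴴ)
      = U * diagonal (fun i => c * f i) * Uᴴ := by
    rw [show (fun i => c * f i) = c • f from rfl, Matrix.diagonal_smul]; simp
  have e : (fun i => (c : ℂ) * (l i : ℂ)) = fun i => ((c * l i : ℝ) : ℂ) := by ext i; simp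
  rw [key, e, mpow_conj_diagonal hU hU', mpow_conj_diagonal hU hU', key]
  congr 3
  ext i
  rw [Real.mul_rpow hc (hl i), Complex.ofReal_mul]

lemma exists_eq_mul_conjTranspose {A : Matrix d d ℂ} (hA : A.PosSemidef) :
    ∃ V : Matrix d d ℂ, A = V * Vᴴ := by
  refine ⟨mpow A (1 / 2), ?_⟩
  rw [(mpow_posSemidef hA _).isHermitian.eq, mpow_mul_mpow hA (by norm_num) (by norm_num)]
  norm_num [mpow_one hA.isHermitian]

lemma re_trace_mul_nonneg {A B : Matrix d d ℂ} (hA : A.PosSemidef) (hB : B.PosSemidef) :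
    0 ≤ (A * B).trace.re := by
  obtain ⟨V, rfl⟩ := exists_eq_mul_conjTranspose hB
  rw [← Matrix.mul_assoc, Matrix.trace_mul_comm, ← Matrix.mul_assoc]
  exact (Complex.nonneg_iff.1 (hA.conjTranspose_mul_mul_same V).trace_nonneg).1

lemma re_trace_mul_mono {A B C : Matrix d d ℂ} (hAB : (B - A).PosSemidef) (hC : C.PosSemidef) :
    (A * C).trace.re ≤ (B * C).trace.re := by
  have := re_trace_mul_nonneg hAB hC
  rw [Matrix.sub_mul, Matrix.trace_sub, Complex.sub_re] at this
  linarith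

lemma re_trace_le_of_contraction {A C : Matrix d d ℂ} (hA : (1 - A).PosSemidef)
    (hC : C.PosSemidef) : (A * C).trace.re ≤ C.trace.re := by
  simpa using re_trace_mul_mono hA hC

end

/-! ### Gentle measurement and the trace norm -/

section

variable {d : Type*} [Fintype d] [DecidableEq d]

lemma one_eq_conj_diagonal {U : Matrix d d ℂ} (hU' : U * Uᴴ = 1) :
    (1 : Matrix d d ℂ) = U * diagonal (fun _ => ((1 : ℝ) : ℂ)) * Uᴴ := by
  simp [hU']

lemma conj_diagonal_sub (U : Matrix d d ℂ) (f g : d → ℝ) :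
    U * diagonal (fun i => (f i : ℂ)) * Uᴴ - U * diagonal (fun i => (g i : ℂ)) * Uᴴ
      = U * diagonal (fun i => ((f i - g i : ℝ) : ℂ)) * Uᴴ := by
  rw [← Matrix.sub_mul, ← Matrix.mul_sub, Matrix.diagonal_sub]
  simp

lemma conj_diagonal_le_one {U : Matrix d d ℂ} {l : d → ℝ} (hU : Uᴴ * U = 1) (hU' : U * Uᴴ = 1)
    (h : (1 - U * diagonal (fun i => (l i : ℂ)) * Uᴴ).PosSemidef) (i : d) : l i ≤ 1 := by
  rw [one_eq_conj_diagonal hU', conj_diagonal_sub] at h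
  linarith [conj_diagonal_nonneg hU h i]

lemma one_sub_conj_diagonal_posSemidef {U : Matrix d d ℂ} {l : d → ℝ} (hU' : U * Uᴴ = 1)
    (h : ∀ i, l i ≤ 1) : (1 - U * diagonal (fun i => (l i : ℂ)) * Uᴴ).PosSemidef := by
  rw [one_eq_conj_diagonal hU', conj_diagonal_sub]
  exact posSemidef_conj_diagonal U fun i => by linarith [h i]

lemma sub_mul_self_posSemidef {K : Matrix d d ℂ} (hK : K.PosSemidef) (hK1 : (1 - K).PosSemidef) :
    (K - K * K).PosSemidef := by
  obtain ⟨U, l, hU, hU', rfl⟩ := exists_diagonalization hK.isHermitian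
  have h0 := conj_diagonal_nonneg hU hK
  have h1 := conj_diagonal_le_one hU hU' hK1
  rw [conj_diagonal_mul hU]
  have := conj_diagonal_sub U l (fun i => l i * l i)
  push_cast at this
  rw [this]
  have := posSemidef_conj_diagonal U (l := fun i => l i - l i * l i)
    fun i => by nlinarith [h0 i, h1 i]
  simpa using this

lemma one_sub_mul_self_posSemidef {K : Matrix d d ℂ} (hK : K.PosSemidef)
    (hK1 : (1 - K).PosSemidef) : (1 - K * K).PosSemidef := by
  have := hK1.add (sub_mul_self_posSemidef hK hK1)
  simpa using this

lemma mpow_half_mul_self {A : Matrix d d ℂ} (hA : A.PosSemidef) :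
    mpow A (1 / 2) * mpow A (1 / 2) = A := by
  rw [mpow_mul_mpow hA (by norm_num) (by norm_num)]
  norm_num [mpow_one hA.isHermitian]

lemma one_sub_mpow_half_posSemidef {A : Matrix d d ℂ} (hA : A.PosSemidef)
    (hA1 : (1 - A).PosSemidef) : (1 - mpow A (1 / 2)).PosSemidef := by
  obtain ⟨U, l, hU, hU', rfl⟩ := exists_diagonalization hA.isHermitian
  have h0 := conj_diagonal_nonneg hU hA
  have h1 := conj_diagonal_le_one hU hU' hA1
  rw [mpow_conj_diagonal hU hU']
  exact one_sub_conj_diagonal_posSemidef hU' fun i =>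
    Real.rpow_le_one (h0 i) (h1 i) (by norm_num)

/-- Gentle measurement, in weak form. -/
lemma norm_trace_mul_sub_conj_le {ρ H K : Matrix d d ℂ} (hρ : IsDensity ρ) (hH : H.IsHermitian)
    (hH1 : (1 - H * H).PosSemidef) (hK : K.PosSemidef) (hK1 : (1 - K).PosSemidef) :
    ‖(H * (ρ - K * ρ * K)).trace‖ ≤ 2 * √(1 - (K * K * ρ).trace.re) := by
  obtain ⟨hρ0, hρ1⟩ := hρ
  obtain ⟨V, hV⟩ := exists_eq_mul_conjTranspose hρ0
  have hKh := hK.isHermitian.eq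
  have hHh := hH.eq
  have h1Kh : (1 - K)ᴴ = 1 - K := hK1.isHermitian.eq
  have hHV : √(((H * V)ᴴ * (H * V)).trace.re) ≤ 1 := by
    rw [Real.sqrt_le_left (by norm_num), one_pow]
    have : ((H * V)ᴴ * (H * V)).trace = (H * H * ρ).trace := by
      rw [hV, Matrix.trace_mul_comm, conjTranspose_mul, hHh, ← Matrix.mul_assoc,
        Matrix.trace_mul_comm, Matrix.mul_assoc H V, ← Matrix.mul_assoc H H]
    rw [this]
    have := re_trace_le_of_contraction hH1 hρ0
    rwa [hρ1, Complex.one_re] at this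
  have hKV : √((((1 - K) * V)ᴴ * ((1 - K) * V)).trace.re) ≤ √(1 - (K * K * ρ).trace.re) := by
    apply Real.sqrt_le_sqrt
    have : (((1 - K) * V)ᴴ * ((1 - K) * V)).trace = ((1 - K) * (1 - K) * ρ).trace := by
      rw [hV, Matrix.trace_mul_comm, conjTranspose_mul, h1Kh, ← Matrix.mul_assoc,
        Matrix.trace_mul_comm, Matrix.mul_assoc (1 - K) V, ← Matrix.mul_assoc (1 - K) (1 - K)]
    rw [this]
    -- The difference equals `2 (K - K²)`, which is positive because `0 ≤ K ≤ 1`.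
    have h2 : (1 - K * K - (1 - K) * (1 - K)).PosSemidef := by
      have h3 := sub_mul_self_posSemidef hK hK1
      have := h3.add h3
      convert this using 1
      noncomm_ring
    have := re_trace_mul_mono h2 hρ0
    rw [Matrix.sub_mul 1 (K * K), Matrix.one_mul, Matrix.trace_sub, hρ1] at this
    simpa using this
  have hHKV : √(((H * K * V)ᴴ * (H * K * V)).trace.re) ≤ 1 := by
    rw [Real.sqrt_le_left (by norm_num), one_pow]
    have : ((H * K * V)ᴴ * (H * K * V)).trace = (H * H * (K * ρ * K)).trace := by
      rw [hV, Matrix.trace_mul_comm, conjTranspose_mul, conjTranspose_mul, hHh, hKh]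
      have := Matrix.trace_mul_comm (H * K * V * Vᴴ * K) H
      simpa only [Matrix.mul_assoc] using this
    rw [this]
    have h1 := re_trace_le_of_contraction hH1 (by simpa [hKh] using hρ0.mul_mul_conjTranspose_same K :
      (K * ρ * K).PosSemidef)
    have h2 := re_trace_le_of_contraction (one_sub_mul_self_posSemidef hK hK1) hρ0
    rw [hρ1, Complex.one_re] at h2
    have h3 : (K * ρ * K).trace = (K * K * ρ).trace := by
      rw [Matrix.trace_mul_comm, ← Matrix.mul_assoc]
    rw [h3] at h1
    exact h1.trans h2
  -- `ρ - KρK = (1 - K)ρ + Kρ(1 - K)`. With `ρ = V Vᴴ`, each term is a Hilbert–Schmidt inner product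
  -- containing one factor `(1 - K) V`, whose norm is the root in the conclusion.
  have hsplit : (H * (ρ - K * ρ * K)).trace
      = ((H * V)ᴴ * ((1 - K) * V)).trace + (((1 - K) * V)ᴴ * (H * K * V)).trace := by
    have e1 : ((H * V)ᴴ * ((1 - K) * V)).trace = (H * (1 - K) * ρ).trace := by
      rw [hV, Matrix.trace_mul_comm, conjTranspose_mul, hHh]
      rw [← Matrix.mul_assoc, Matrix.trace_mul_comm]
      simp only [Matrix.mul_assoc]
    have e2 : (((1 - K) * V)ᴴ * (H * K * V)).trace = (H * K * ρ * (1 - K)).trace := by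
      rw [hV, Matrix.trace_mul_comm, conjTranspose_mul, h1Kh]
      simp only [Matrix.mul_assoc]
    rw [e1, e2, ← Matrix.trace_add]
    congr 1
    noncomm_ring
  rw [hsplit]
  have c1 := norm_trace_conjTranspose_mul_le (H * V) ((1 - K) * V)
  have c2 := norm_trace_conjTranspose_mul_le ((1 - K) * V) (H * K * V)
  have s1 := mul_le_mul hHV hKV (Real.sqrt_nonneg _) zero_le_one
  have s2 := mul_le_mul hKV hHKV (Real.sqrt_nonneg _) (Real.sqrt_nonneg _)
  calc _ ≤ _ := norm_add_le _ _
    _ ≤ _ := by linarith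

lemma traceNorm_conj_diagonal {U : Matrix d d ℂ} {l : d → ℝ} (hU : Uᴴ * U = 1)
    (hU' : U * Uᴴ = 1) :
    traceNorm (U * diagonal (fun i => (l i : ℂ)) * Uᴴ) = ∑ i, |l i| := by
  rw [traceNorm, (isHermitian_conj_diagonal U l).eq, conj_diagonal_mul hU]
  have := cfc_conj_diagonal hU hU' (l := fun i => l i * l i) Real.sqrt
  push_cast at this
  rw [this, trace_conj_diagonal hU]
  simp [Real.sqrt_mul_self_eq_abs]

/-- Variational formula for the trace norm of a Hermitian matrix. -/
lemma exists_traceNorm_eq {Z : Matrix d d ℂ} (hZ : Z.IsHermitian) :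
    ∃ S : Matrix d d ℂ, S.IsHermitian ∧ S * S = 1 ∧ traceNorm Z = (S * Z).trace.re := by
  obtain ⟨U, l, hU, hU', rfl⟩ := exists_diagonalization hZ
  refine ⟨U * diagonal (fun i => ((if 0 ≤ l i then 1 else -1 : ℝ) : ℂ)) * Uᴴ,
    isHermitian_conj_diagonal U _, ?_, ?_⟩
  · rw [conj_diagonal_mul hU, one_eq_conj_diagonal hU']
    congr 3
    ext i
    split_ifs <;> simp
  · rw [traceNorm_conj_diagonal hU hU', conj_diagonal_mul hU, trace_conj_diagonal hU]
    rw [Complex.re_sum]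
    refine Finset.sum_congr rfl fun i _ => ?_
    rw [← Complex.ofReal_mul, Complex.ofReal_re]
    split_ifs with h
    · rw [abs_of_nonneg h, one_mul]
    · rw [abs_of_neg (not_le.1 h)]; ring

/-- `Z` is split into its positive and negative parts; `S ≤ 1` is used on the first and `-S ≤ 1` on
the second. -/
lemma re_trace_mul_le_traceNorm {Z S : Matrix d d ℂ} (hZ : Z.IsHermitian)
    (h1 : (1 - S).PosSemidef) (h2 : (1 + S).PosSemidef) :
    (S * Z).trace.re ≤ traceNorm Z := by
  obtain ⟨U, l, hU, hU', rfl⟩ := exists_diagonalization hZ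
  rw [traceNorm_conj_diagonal hU hU']
  have hsub := conj_diagonal_sub U (fun i => max (l i) 0) (fun i => max (-l i) 0)
  have e : (fun i => ((max (l i) 0 - max (-l i) 0 : ℝ) : ℂ)) = fun i => (l i : ℂ) := by
    ext i
    congr 1
    rcases le_total 0 (l i) with h | h
    · rw [max_eq_left h, max_eq_right (by linarith)]; ring
    · rw [max_eq_right h, max_eq_left (by linarith)]; ring
  rw [e] at hsub
  rw [← hsub, Matrix.mul_sub, Matrix.trace_sub, Complex.sub_re]
  have p1 := re_trace_le_of_contraction h1
    (posSemidef_conj_diagonal U (l := fun i => max (l i) 0) fun i => le_max_right _ _)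
  have p2 := re_trace_le_of_contraction (A := -S) (by simpa using h2)
    (posSemidef_conj_diagonal U (l := fun i => max (-l i) 0) fun i => le_max_right _ _)
  rw [trace_conj_diagonal hU, Complex.re_sum] at p1 p2
  simp only [Complex.ofReal_re, Matrix.neg_mul, Matrix.trace_neg, Complex.neg_re] at p1 p2
  have : ∑ i, |l i| = ∑ i, max (l i) 0 + ∑ i, max (-l i) 0 := by
    rw [← Finset.sum_add_distrib]
    refine Finset.sum_congr rfl fun i _ => ?_
    rcases le_total 0 (l i) with h | h
    · rw [max_eq_left h, max_eq_right (by linarith), abs_of_nonneg h]; ring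
    · rw [max_eq_right h, max_eq_left (by linarith), abs_of_nonpos h]; ring
  linarith

/-- `1 - S` is half the square of the Hermitian matrix `1 - S`. -/
lemma one_sub_posSemidef_of_involution {S : Matrix d d ℂ} (hS : S.IsHermitian)
    (hS1 : S * S = 1) : (1 - S).PosSemidef := by
  have h := (posSemidef_conjTranspose_mul_self (1 - S)).smul (a := (1 / 2 : ℝ)) (by norm_num)
  convert h using 1
  rw [conjTranspose_sub, conjTranspose_one, hS.eq,
    show (1 - S) * (1 - S) = (2 : ℝ) • (1 - S) by
      rw [Matrix.sub_mul, Matrix.mul_sub, Matrix.mul_sub, hS1, two_smul]; simp; abel]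
  rw [smul_smul]; norm_num

lemma re_trace_involution_le_traceNorm {Z S : Matrix d d ℂ} (hZ : Z.IsHermitian)
    (hS : S.IsHermitian) (hS1 : S * S = 1) : (S * Z).trace.re ≤ traceNorm Z := by
  refine re_trace_mul_le_traceNorm hZ (one_sub_posSemidef_of_involution hS hS1) ?_
  have := one_sub_posSemidef_of_involution (S := -S) hS.neg (by simpa using hS1)
  simpa using this

end

/-! ### Binary hypothesis testing -/

section

variable {d : Type*} [Fintype d] [DecidableEq d]

section
open scoped MatrixOrder Matrix.Norms.L2Operator

/-- Operator monotonicity of `x ↦ x ^ r` for `0 ≤ r ≤ 1`. -/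
lemma mpow_sub_mpow_posSemidef {A B : Matrix d d ℂ} (hA : A.PosSemidef)
    (hAB : (B - A).PosSemidef) {r : ℝ} (h0 : 0 ≤ r) (h1 : r ≤ 1) :
    (mpow B r - mpow A r).PosSemidef := by
  have hB : B.PosSemidef := by simpa using hAB.add hA
  have hA' : (0 : Matrix d d ℂ) ≤ A := Matrix.nonneg_iff_posSemidef.2 hA
  have hB' : (0 : Matrix d d ℂ) ≤ B := Matrix.nonneg_iff_posSemidef.2 hB
  have h := CFC.rpow_le_rpow (p := r) ⟨h0, h1⟩ (Matrix.le_iff.2 hAB)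
  rw [CFC.rpow_eq_cfc_real hA', CFC.rpow_eq_cfc_real hB'] at h
  exact Matrix.le_iff.1 h

end

/-- Binary hypothesis testing: the test `{A ≥ B}` obeys the quantum Chernoff bound. -/
lemma exists_test {A B : Matrix d d ℂ} (hA : A.PosSemidef) (hB : B.PosSemidef) {s : ℝ}
    (h0 : 0 ≤ s) (h1 : s ≤ 1) :
    ∃ T : Matrix d d ℂ, T.IsHermitian ∧ T * T = T ∧
      ((1 - T) * A).trace.re + (T * B).trace.re ≤ (mpow A (1 - s) * mpow B s).trace.re := by
  obtain ⟨U, l, hU, hU', hl⟩ := exists_diagonalization (hA.isHermitian.sub hB.isHermitian)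
  set T := U * diagonal (fun i => ((if 0 ≤ l i then 1 else 0 : ℝ) : ℂ)) * Uᴴ with hT
  set P := U * diagonal (fun i => ((max (l i) 0 : ℝ) : ℂ)) * Uᴴ with hP
  have hTP : T * (A - B) = P := by
    rw [hl, hT, hP, conj_diagonal_mul hU]
    congr 3
    ext i
    split_ifs with h
    · rw [max_eq_left h]; simp
    · rw [max_eq_right (by linarith)]; simp
  have hP0 : P.PosSemidef := posSemidef_conj_diagonal U fun i => le_max_right _ _
  have hCA : (B + P - A).PosSemidef := by
    have e : B + P - A = P - (A - B) := by abel
    rw [e, hl, hP, conj_diagonal_sub]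
    exact posSemidef_conj_diagonal U fun i => by linarith [le_max_left (l i) 0]
  have hC := hB.add hP0
  refine ⟨T, isHermitian_conj_diagonal U _, ?_, ?_⟩
  · rw [hT, conj_diagonal_mul hU]
    congr 3
    ext i
    split_ifs <;> simp
  set C := B + P with hCdef
  have hs1 : 0 ≤ 1 - s := by linarith
  have split {X : Matrix d d ℂ} (hX : X.PosSemidef) :
      X.trace.re = (mpow X (1 - s) * mpow X s).trace.re := by
    rw [mpow_mul_mpow hX hs1 h0, sub_add_cancel, mpow_one hX.isHermitian]
  have hCs := mpow_sub_mpow_posSemidef hA hCA h0 h1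
  have hCBs := mpow_sub_mpow_posSemidef (B := C) hB (by simpa [hCdef] using hP0) h0 h1
  have hCA' := mpow_sub_mpow_posSemidef hA hCA hs1 (by linarith : 1 - s ≤ 1)
  have hCB' := mpow_sub_mpow_posSemidef (B := C) hB (by simpa [hCdef] using hP0) hs1
    (by linarith : 1 - s ≤ 1)
  -- `C = B + (A - B)₊` dominates both `A` and `B`. By operator monotonicity, `tr A^{1-s}(A^s - B^s)
  -- ≤ tr A^{1-s}(C^s - B^s) ≤ tr C^{1-s}(C^s - B^s) ≤ tr C - tr B = tr (A - B)₊`; `k1`, `k2`, `k3`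
  -- are the three inequalities.
  have k1 := re_trace_mul_nonneg (mpow_posSemidef hA (1 - s)) hCs
  have k2 := re_trace_mul_nonneg hCA' hCBs
  have k3 := re_trace_mul_nonneg hCB' (mpow_posSemidef hB s)
  have eA := split hA
  have eB := split hB
  have eC := split hC
  simp only [Matrix.mul_sub, Matrix.sub_mul, Matrix.trace_sub, Complex.sub_re] at k1 k2 k3
  have eCP : C.trace.re = B.trace.re + P.trace.re := by simp [hCdef]
  have e : ((1 - T) * A).trace.re + (T * B).trace.re = A.trace.re - P.trace.re := by
    rw [← hTP]
    simp [Matrix.mul_sub, Matrix.sub_mul]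
    ring
  rw [e]
  linarith

end

/-! ### Block-diagonal matrices and one-shot tests -/

section

variable {d X : Type*} [Fintype d] [DecidableEq d] [Fintype X] [DecidableEq X]

/-- The block-diagonal matrix `∑ₓ |x⟩⟨x| ⊗ F x`. -/
def block (F : X → Matrix d d ℂ) : Matrix (X × d) (X × d) ℂ :=
  Matrix.of fun p q => if p.1 = q.1 then F p.1 p.2 q.2 else 0

lemma block_mul (F G : X → Matrix d d ℂ) : block F * block G = block fun x => F x * G x := by
  ext ⟨x, i⟩ ⟨y, j⟩
  simp only [block, Matrix.mul_apply, Matrix.of_apply, Fintype.sum_prod_type]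
  rw [Finset.sum_eq_single x (by intro z _ hz; simp [hz.symm]) (by simp)]
  by_cases h : x = y <;> simp [h]

lemma block_conjTranspose (F : X → Matrix d d ℂ) : (block F)ᴴ = block fun x => (F x)ᴴ := by
  ext ⟨x, i⟩ ⟨y, j⟩
  by_cases h : x = y
  · subst h; simp [block]
  · simp [block, h, Ne.symm h]

lemma block_one : block (fun _ : X => (1 : Matrix d d ℂ)) = 1 := by
  ext ⟨x, i⟩ ⟨y, j⟩
  by_cases h : x = y <;> by_cases h' : i = j <;> simp [block, Matrix.one_apply, h, h']

lemma block_diagonal (f : X → d → ℂ) :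
    block (fun x => diagonal (f x)) = diagonal fun p => f p.1 p.2 := by
  ext ⟨x, i⟩ ⟨y, j⟩
  by_cases h : x = y <;> by_cases h' : i = j <;> simp [block, Matrix.diagonal_apply, h, h']

lemma trace_block (F : X → Matrix d d ℂ) : (block F).trace = ∑ x, (F x).trace := by
  simp [block, Matrix.trace, Fintype.sum_prod_type]

/-- Blockwise diagonalizing unitaries form one block unitary. The operators in `I^h_a` are block
diagonal over `X`, so its trace becomes a sum of traces, one for each letter. -/
lemma mpow_block {F : X → Matrix d d ℂ} (hF : ∀ x, (F x).IsHermitian) (r : ℝ) :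
    mpow (block F) r = block fun x => mpow (F x) r := by
  choose U l hU hU' hl using fun x => exists_diagonalization (hF x)
  have e (f : X → d → ℝ) : (block fun x => U x * diagonal (fun i => (f x i : ℂ)) * (U x)ᴴ)
      = block U * diagonal (fun p : X × d => (f p.1 p.2 : ℂ)) * (block U)ᴴ := by
    rw [← block_diagonal (fun x i => (f x i : ℂ)), block_conjTranspose, block_mul, block_mul]
  have e0 : F = fun x => U x * diagonal (fun i => (l x i : ℂ)) * (U x)ᴴ := funext hl
  have e1 : (fun x => mpow (F x) r)
      = fun x => U x * diagonal (fun i => ((l x i ^ r : ℝ) : ℂ)) * (U x)ᴴ := by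
    funext x
    rw [hl x, mpow_conj_diagonal (hU x) (hU' x)]
  have u1 : (block U)ᴴ * block U = 1 := by
    rw [block_conjTranspose, block_mul, ← block_one]; congr 1; exact funext hU
  have u2 : block U * (block U)ᴴ = 1 := by
    rw [block_conjTranspose, block_mul, ← block_one]; congr 1; exact funext hU'
  rw [e1, e (fun x i => l x i ^ r)]
  conv_lhs => rw [e0, e l]
  rw [mpow_conj_diagonal u1 u2 (l := fun p : X × d => l p.1 p.2)]

lemma CQ.joint_eq_block (σ : CQ X d) : σ.joint = block fun x => (σ.P x : ℂ) • σ.st x := by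
  ext ⟨x, i⟩ ⟨y, j⟩
  simp only [CQ.joint, block, Matrix.sum_apply, Matrix.smul_apply, Matrix.kroneckerMap_apply,
    Matrix.of_apply, Matrix.single_apply]
  by_cases h : x = y
  · subst h
    rw [Finset.sum_eq_single x (by intro z _ hz; simp [hz]) (by simp)]
    simp
  · rw [if_neg h]
    refine Finset.sum_eq_zero fun z _ => ?_
    have : ¬ (z = x ∧ z = y) := fun ⟨h1, h2⟩ => h (h1.symm.trans h2)
    simp [this]

lemma CQ.marg_kronecker_eq_block (σ : CQ X d) :
    σ.margX ⊗ₖ σ.margQ = block fun x => (σ.P x : ℂ) • σ.margQ := by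
  ext ⟨x, i⟩ ⟨y, j⟩
  by_cases h : x = y
  · subst h; simp [CQ.margX, block]
  · simp [CQ.margX, block, h]

/-- A Jensen-type comparison of the two Rényi overlaps. -/
lemma re_trace_mpow_mul_mpow_le {A B : Matrix d d ℂ} (hA : A.PosSemidef) (hB : B.PosSemidef)
    {a : ℝ} (h0 : 0 < a) (h1 : a < 1) :
    0 ≤ (A * mpow B (a / 2) * mpow A (-a) * mpow B (a / 2)).trace.re ∧
    (mpow A (1 - a / 2) * mpow B (a / 2)).trace.re ≤
      √(A.trace.re) * √((A * mpow B (a / 2) * mpow A (-a) * mpow B (a / 2)).trace.re) := by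
  have hBb := mpow_posSemidef hB (a / 2)
  obtain ⟨U, l, hU, hU', rfl⟩ := exists_diagonalization hA.isHermitian
  have hl := conj_diagonal_nonneg hU hA
  rw [mpow_conj_diagonal hU hU', mpow_conj_diagonal hU hU', trace_conj_diagonal hU]
  set G := Uᴴ * mpow B (a / 2) * U with hG
  have hGp : G.PosSemidef := hBb.conjTranspose_mul_mul_same U
  have e1 : (U * diagonal (fun i => ((l i ^ (1 - a / 2) : ℝ) : ℂ)) * Uᴴ * mpow B (a / 2)).trace
      = (diagonal (fun i => ((l i ^ (1 - a / 2) : ℝ) : ℂ)) * G).trace := by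
    rw [hG]
    simp only [Matrix.mul_assoc]
    rw [Matrix.trace_mul_comm]
    simp only [Matrix.mul_assoc]
  have e2 : (U * diagonal (fun i => (l i : ℂ)) * Uᴴ * mpow B (a / 2)
        * (U * diagonal (fun i => ((l i ^ (-a) : ℝ) : ℂ)) * Uᴴ) * mpow B (a / 2)).trace
      = (diagonal (fun i => (l i : ℂ)) * G * (diagonal (fun i => ((l i ^ (-a) : ℝ) : ℂ)) * G)).trace
      := by
    rw [hG]
    simp only [Matrix.mul_assoc]
    rw [Matrix.trace_mul_comm]
    simp only [Matrix.mul_assoc]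
  rw [e1, e2]
  have t1 : (diagonal (fun i => ((l i ^ (1 - a / 2) : ℝ) : ℂ)) * G).trace.re
      = ∑ i, l i ^ (1 - a / 2) * (G i i).re := by
    simp [Matrix.trace, Matrix.diagonal_mul]
  have t2 : (diagonal (fun i => (l i : ℂ)) * G
        * (diagonal (fun i => ((l i ^ (-a) : ℝ) : ℂ)) * G)).trace.re
      = ∑ i, ∑ j, l i * l j ^ (-a) * ‖G i j‖ ^ 2 := by
    simp only [Matrix.trace, Matrix.diag_apply, Matrix.mul_apply (M := diagonal _ * G),
      Matrix.diagonal_mul, Complex.re_sum]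
    refine Finset.sum_congr rfl fun i _ => Finset.sum_congr rfl fun j _ => ?_
    have hji : G j i = star (G i j) := (hGp.isHermitian.apply j i).symm
    have : (l i : ℂ) * G i j * (((l j ^ (-a) : ℝ) : ℂ) * G j i)
        = ((l i * l j ^ (-a) * ‖G i j‖ ^ 2 : ℝ) : ℂ) := by
      rw [hji]
      have := Complex.mul_conj' (G i j)
      rw [show star (G i j) = (starRingEnd ℂ) (G i j) from rfl]
      push_cast
      rw [← this]
      ring
    rw [this, Complex.ofReal_re]
  rw [t1, t2]
  have hterm (i j : d) : 0 ≤ l i * l j ^ (-a) * ‖G i j‖ ^ 2 :=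
    mul_nonneg (mul_nonneg (hl i) (Real.rpow_nonneg (hl j) _)) (sq_nonneg _)
  refine ⟨Finset.sum_nonneg fun i _ => Finset.sum_nonneg fun j _ => hterm i j, ?_⟩
  -- In the eigenbasis of `A` the left-hand overlap sees only the diagonal of `G`. The off-diagonal
  -- terms on the right are nonnegative and are dropped; Cauchy–Schwarz with `l^{1-a/2} = √l ·
  -- √(l^{1-a})` does the rest.
  have hd : ∑ i, l i * l i ^ (-a) * ‖G i i‖ ^ 2 ≤ ∑ i, ∑ j, l i * l j ^ (-a) * ‖G i j‖ ^ 2 :=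
    Finset.sum_le_sum fun i _ => Finset.single_le_sum (fun j _ => hterm i j) (Finset.mem_univ i)
  have hc := Real.sum_sqrt_mul_sqrt_le Finset.univ (f := l)
    (g := fun i => l i * l i ^ (-a) * ‖G i i‖ ^ 2) hl (fun i => hterm i i)
  have hsum : (∑ i, (l i : ℂ)).re = ∑ i, l i := by simp
  rw [hsum]
  calc _ ≤ ∑ i, √(l i) * √(l i * l i ^ (-a) * ‖G i i‖ ^ 2) := by
        refine Finset.sum_le_sum fun i _ => ?_
        rw [← Real.sqrt_mul (hl i)]
        apply Real.le_sqrt_of_sq_le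
        have hn : (G i i).re ^ 2 ≤ ‖G i i‖ ^ 2 := by
          rw [← sq_abs]
          exact pow_le_pow_left₀ (abs_nonneg _) (Complex.abs_re_le_norm _) 2
        have hp : (l i ^ (1 - a / 2)) ^ 2 = l i * (l i * l i ^ (-a)) := by
          rcases (hl i).eq_or_lt with h | h
          · rw [← h, Real.zero_rpow (by linarith)]; simp
          · rw [← Real.rpow_natCast, ← Real.rpow_mul h.le]
            rw [show (1 - a / 2) * ((2 : ℕ) : ℝ) = 1 + (1 + -a) by push_cast; ring,
              Real.rpow_add h, Real.rpow_add h, Real.rpow_one]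
        rw [mul_pow, hp, ← mul_assoc (l i) (l i * l i ^ (-a))]
        exact mul_le_mul_of_nonneg_left hn
          (mul_nonneg (hl i) (mul_nonneg (hl i) (Real.rpow_nonneg (hl i) _)))
    _ ≤ _ := hc
    _ ≤ _ := mul_le_mul_of_nonneg_left (Real.sqrt_le_sqrt hd) (Real.sqrt_nonneg _)

lemma IsDensity.trace_re {ρ : Matrix d d ℂ} (h : IsDensity ρ) : ρ.trace.re = 1 := by simp [h.2]

lemma posSemidef_ofReal_smul {A : Matrix d d ℂ} (hA : A.PosSemidef) {c : ℝ} (hc : 0 ≤ c) :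
    ((c : ℂ) • A).PosSemidef :=
  hA.smul (by exact_mod_cast hc)

lemma CQ.IsState.margQ_density {σ : CQ X d} (h : σ.IsState) : IsDensity σ.margQ := by
  obtain ⟨h0, h1, h2⟩ := h
  refine ⟨posSemidef_sum _ fun x _ => posSemidef_ofReal_smul (h2 x).1 (h0 x), ?_⟩
  simp only [CQ.margQ, Matrix.trace_sum, Matrix.trace_smul, (h2 _).2, smul_eq_mul, mul_one]
  exact_mod_cast h1

/-- Projective tests whose error against the product of the marginals is governed by `I^h_a`. -/
lemma CQ.IsState.exists_tests {σ : CQ X d} (h : σ.IsState) {a : ℝ} (ha0 : 0 < a) (ha1 : a < 1)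
    {N : ℝ} (hN : 0 ≤ N) :
    ∃ T : X → Matrix d d ℂ, (∀ x, (T x).IsHermitian) ∧ (∀ x, T x * T x = T x) ∧
      ∑ x, σ.P x * (((1 - T x) * σ.st x).trace.re + N * (T x * σ.margQ).trace.re) ≤
        √(N ^ a * (σ.joint * mpow (σ.margX ⊗ₖ σ.margQ) (a / 2) * mpow σ.joint (-a) *
          mpow (σ.margX ⊗ₖ σ.margQ) (a / 2)).trace.re) := by
  have hQ := h.margQ_density
  obtain ⟨h0, h1, h2⟩ := h
  set A : X → Matrix d d ℂ := fun x => (σ.P x : ℂ) • σ.st x with hA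
  set B : X → Matrix d d ℂ := fun x => (σ.P x : ℂ) • σ.margQ with hB
  have hAp x : (A x).PosSemidef := posSemidef_ofReal_smul (h2 x).1 (h0 x)
  have hBp x : (B x).PosSemidef := posSemidef_ofReal_smul hQ.1 (h0 x)
  have hNB x : ((N : ℂ) • B x).PosSemidef := posSemidef_ofReal_smul (hBp x) hN
  -- The exponent is `a / 2` because `re_trace_mpow_mul_mpow_le` bounds `tr A^{1-a/2} B^{a/2}` by a
  -- root of the `I^h_a` overlap; the factor `N^{a/2}` becomes `√(N^a)` inside that root.
  choose T hT hTT hle using fun x =>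
    exists_test (hAp x) (hNB x) (s := a / 2) (by linarith) (by linarith)
  refine ⟨T, hT, hTT, ?_⟩
  rw [σ.joint_eq_block, σ.marg_kronecker_eq_block, mpow_block (fun x => (hAp x).isHermitian),
    mpow_block (fun x => (hBp x).isHermitian), block_mul, block_mul, block_mul, trace_block,
    Complex.re_sum]
  set q : X → ℝ := fun x => (A x * mpow (B x) (a / 2) * mpow (A x) (-a)
    * mpow (B x) (a / 2)).trace.re with hq
  have hq0 x : 0 ≤ q x := (re_trace_mpow_mul_mpow_le (hAp x) (hBp x) ha0 ha1).1
  have hqle x := (re_trace_mpow_mul_mpow_le (hAp x) (hBp x) ha0 ha1).2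
  have hAtr x : (A x).trace.re = σ.P x := by
    simp [hA, Matrix.trace_smul, (h2 x).2]
  have hcs := Real.sum_sqrt_mul_sqrt_le Finset.univ (f := fun x => (A x).trace.re) (g := q)
    (fun x => by rw [hAtr]; exact h0 x) hq0
  have hA1 : ∑ x, (A x).trace.re = 1 := by simp only [hAtr, h1]
  rw [hA1, Real.sqrt_one, one_mul] at hcs
  have hNa : √(N ^ a) = N ^ (a / 2) := by
    rw [Real.sqrt_eq_rpow, ← Real.rpow_mul hN]; congr 1; ring
  rw [Real.sqrt_mul (Real.rpow_nonneg hN _), hNa]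
  calc _ = ∑ x, (((1 - T x) * A x).trace.re + (T x * ((N : ℂ) • B x)).trace.re) := by
        refine Finset.sum_congr rfl fun x _ => ?_
        simp only [hA, hB, Matrix.mul_smul, Matrix.trace_smul, smul_eq_mul,
          Complex.re_ofReal_mul]
        ring
    _ ≤ ∑ x, (mpow (A x) (1 - a / 2) * mpow ((N : ℂ) • B x) (a / 2)).trace.re :=
        Finset.sum_le_sum fun x _ => hle x
    _ = N ^ (a / 2) * ∑ x, (mpow (A x) (1 - a / 2) * mpow (B x) (a / 2)).trace.re := by
        rw [Finset.mul_sum]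
        refine Finset.sum_congr rfl fun x _ => ?_
        rw [mpow_smul (hBp x) hN, Matrix.mul_smul, Matrix.trace_smul, smul_eq_mul,
          Complex.re_ofReal_mul]
    _ ≤ _ := by
        refine mul_le_mul_of_nonneg_left ?_ (Real.rpow_nonneg hN _)
        exact (Finset.sum_le_sum fun x _ => hqle x).trans hcs

/-- One-shot coding bound, for tests: `log₂ N ≤ noisyRate ζ σ` forces small test errors. -/
lemma CQ.IsState.exists_tests_of_le_noisyRate {σ : CQ X d} (h : σ.IsState) {ζ : ℝ}
    (hζ : 0 < ζ) {N : ℝ} (hN : 0 < N)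
    (hle : ((Real.logb 2 N : ℝ) : EReal) ≤ noisyRate ζ σ) :
    ∃ T : X → Matrix d d ℂ, (∀ x, (T x).IsHermitian) ∧ (∀ x, T x * T x = T x) ∧
      ∑ x, σ.P x * (((1 - T x) * σ.st x).trace.re + N * (T x * σ.margQ).trace.re) ≤
        2 * (ζ / 12) ^ 2 := by
  -- The supremum need not be attained. Giving up one bit yields an actual `a`, at the price of a
  -- factor `2^a ≤ 2` in the bound on `N^a Q`.
  have hlt : ((Real.logb 2 N - 1 : ℝ) : EReal) < noisyRate ζ σ :=
    lt_of_lt_of_le (by exact_mod_cast (by linarith)) hle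
  rw [noisyRate] at hlt
  simp only [lt_iSup_iff] at hlt
  obtain ⟨a, ⟨ha0, ha1⟩, hlt⟩ := hlt
  rw [EReal.coe_lt_coe_iff] at hlt
  obtain ⟨T, hT, hTT, hsum⟩ := h.exists_tests ha0 ha1 hN.le
  refine ⟨T, hT, hTT, hsum.trans ?_⟩
  rw [mutualInfoH] at hlt
  set Q := (σ.joint * mpow (σ.margX ⊗ₖ σ.margQ) (a / 2) * mpow σ.joint (-a) *
    mpow (σ.margX ⊗ₖ σ.margQ) (a / 2)).trace.re
  have hν : 0 ≤ Real.logb 2 (numEigenvalues (σ.margX ⊗ₖ σ.margQ) : ℝ) := by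
    rw [Real.logb]
    exact div_nonneg (Real.log_natCast_nonneg _) (Real.log_nonneg (by norm_num))
  have hz : 0 < ζ / 12 := by positivity
  -- The rate gives `2 (ζ/12)^4`; the bound `4 (ζ/12)^4` used here is a perfect square. The
  -- eigenvalue term of the rate has a nonnegative logarithm, so it can be discarded.
  have key : N ^ a * Q ≤ (2 * (ζ / 12) ^ 2) ^ 2 := by
    rcases le_or_gt Q 0 with hQ | hQ
    · exact (mul_nonpos_of_nonneg_of_nonpos (Real.rpow_nonneg hN.le _) hQ).trans (sq_nonneg _)
    have hlog : Real.logb 2 (N ^ a * Q) ≤ Real.logb 2 (2 * (ζ / 12) ^ 4) := by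
      have h12 : Real.logb 2 (12 / ζ) = - Real.logb 2 (ζ / 12) := by
        rw [← Real.logb_inv, inv_div]
      rw [Real.logb_mul (by positivity) hQ.ne', Real.logb_rpow_eq_mul_logb_of_pos hN,
        Real.logb_mul (by norm_num) (by positivity), Real.logb_pow, Real.logb_self_eq_one
        (by norm_num)]
      rw [h12] at hlt
      have hm := mul_lt_mul_of_pos_left hlt ha0
      have e : a * (-(1 / a) * Real.logb 2 Q
          - 1 / a * Real.logb 2 (numEigenvalues (σ.margX ⊗ₖ σ.margQ) : ℝ)
          - 4 / a * -Real.logb 2 (ζ / 12))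
          = - Real.logb 2 Q - Real.logb 2 (numEigenvalues (σ.margX ⊗ₖ σ.margQ) : ℝ)
            + 4 * Real.logb 2 (ζ / 12) := by
        field_simp
        ring
      rw [e] at hm
      push_cast
      linarith
    rw [Real.logb_le_logb (by norm_num) (by positivity) (by positivity)] at hlog
    nlinarith [pow_pos hz 4]
  calc _ ≤ √((2 * (ζ / 12) ^ 2) ^ 2) := Real.sqrt_le_sqrt key
    _ = _ := Real.sqrt_sq (by positivity)

end

/-! ### Quantum union bound and sequential decoding -/

section

variable {d : Type*} [Fintype d] [DecidableEq d]

/-- The product `P (n-1) * ⋯ * P 1 * P 0`. -/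
def seqProd (P : ℕ → Matrix d d ℂ) : ℕ → Matrix d d ℂ
  | 0 => 1
  | n + 1 => P n * seqProd P n

lemma seqProd_congr {P Q : ℕ → Matrix d d ℂ} {n : ℕ} (h : ∀ i < n, P i = Q i) :
    seqProd P n = seqProd Q n := by
  induction n with
  | zero => rfl
  | succ n ih =>
    rw [seqProd, seqProd, h n (by omega), ih fun i hi => h i (by omega)]

lemma isHermitian_one_sub {P : Matrix d d ℂ} (hP : P.IsHermitian) : (1 - P).IsHermitian :=
  Matrix.isHermitian_one.sub hP

lemma one_sub_mul_one_sub {P : Matrix d d ℂ} (hP : P * P = P) : (1 - P) * (1 - P) = 1 - P := by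
  rw [Matrix.sub_mul, Matrix.mul_sub, Matrix.mul_sub, hP]; simp

lemma posSemidef_of_projection {P : Matrix d d ℂ} (h : P.IsHermitian) (hP : P * P = P) :
    P.PosSemidef := by
  have := posSemidef_conjTranspose_mul_self P
  rwa [h.eq, hP] at this

/-- Quantum union bound for a sequence of projective measurements. -/
lemma quantum_union_bound {ρ : Matrix d d ℂ} (hρ : IsDensity ρ) {P : ℕ → Matrix d d ℂ}
    (hP : ∀ i, (P i).IsHermitian) (hPP : ∀ i, P i * P i = P i) (n : ℕ) :
    1 - ((seqProd P n)ᴴ * seqProd P n * ρ).trace.re ≤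
      4 * ∑ i ∈ Finset.range n, ((1 - P i) * ρ).trace.re := by
  obtain ⟨V, hV⟩ := exists_eq_mul_conjTranspose hρ.1
  -- `W i` is the unnormalized purification after `i` tests and `x` is the final norm. Two
  -- telescoping sums are compared: the squared norms of `(1 - P i) W i` add up to `1 - x²`, and
  -- their inner products with `(1 - P i) V` add up to `1 - Re ⟨V, W n⟩`, which is at least `1 - x`.
  set W : ℕ → Matrix d d ℂ := fun i => seqProd P i * V with hW
  have hWs (i : ℕ) : W (i + 1) = P i * W i := by simp [hW, seqProd, Matrix.mul_assoc]
  have hW0 : W 0 = V := by simp [hW, seqProd]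
  have hnorm (Y : Matrix d d ℂ) : (Yᴴ * Y * ρ).trace = ((Y * V)ᴴ * (Y * V)).trace := by
    rw [hV, conjTranspose_mul, ← Matrix.mul_assoc, Matrix.trace_mul_comm]
    simp only [Matrix.mul_assoc]
  have hproj (i : ℕ) (Y Z : Matrix d d ℂ) :
      ((1 - P i) * Y)ᴴ * ((1 - P i) * Z) = Yᴴ * Z - Yᴴ * (P i * Z) := by
    rw [conjTranspose_mul, (isHermitian_one_sub (hP i)).eq, Matrix.mul_assoc,
      ← Matrix.mul_assoc (1 - P i), one_sub_mul_one_sub (hPP i), Matrix.sub_mul, Matrix.mul_sub,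
      Matrix.one_mul]
  set L := ∑ i ∈ Finset.range n, ((1 - P i) * ρ).trace.re with hL
  set x := √(((W n)ᴴ * W n).trace.re) with hx
  have hWn0 : 0 ≤ ((W n)ᴴ * W n).trace.re :=
    (Complex.nonneg_iff.1 (posSemidef_conjTranspose_mul_self _).trace_nonneg).1
  have hx2 : x ^ 2 = ((W n)ᴴ * W n).trace.re := Real.sq_sqrt hWn0
  have hVV : (Vᴴ * V).trace.re = 1 := by
    rw [Matrix.trace_mul_comm, ← hV, hρ.trace_re]
  have ha (i : ℕ) : (((1 - P i) * V)ᴴ * ((1 - P i) * V)).trace.re = ((1 - P i) * ρ).trace.re := by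
    rw [← hnorm, (isHermitian_one_sub (hP i)).eq, one_sub_mul_one_sub (hPP i)]
  have hb (i : ℕ) : (((1 - P i) * W i)ᴴ * ((1 - P i) * W i)).trace.re
      = ((W i)ᴴ * W i).trace.re - ((W (i + 1))ᴴ * W (i + 1)).trace.re := by
    rw [hproj, hWs, conjTranspose_mul (P i) (W i), (hP i).eq, Matrix.mul_assoc _ (P i) (P i * _),
      ← Matrix.mul_assoc (P i) (P i), hPP, Matrix.trace_sub, Complex.sub_re]
  have hbs : ∑ i ∈ Finset.range n, (((1 - P i) * W i)ᴴ * ((1 - P i) * W i)).trace.re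
      = 1 - x ^ 2 := by
    simp only [hb]
    rw [Finset.sum_range_sub', hW0, hVV, hx2]
  have hx1 : x ^ 2 ≤ 1 := by
    have : 0 ≤ ∑ i ∈ Finset.range n, (((1 - P i) * W i)ᴴ * ((1 - P i) * W i)).trace.re :=
      Finset.sum_nonneg fun i _ =>
        (Complex.nonneg_iff.1 (posSemidef_conjTranspose_mul_self _).trace_nonneg).1
    linarith
  have hL0 : 0 ≤ L := Finset.sum_nonneg fun i _ =>
    re_trace_mul_nonneg (posSemidef_of_projection (isHermitian_one_sub (hP i))
      (one_sub_mul_one_sub (hPP i))) hρ.1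
  have hsum : (Vᴴ * V).trace.re - (Vᴴ * W n).trace.re
      = ∑ i ∈ Finset.range n, (((1 - P i) * V)ᴴ * ((1 - P i) * W i)).trace.re := by
    have (i : ℕ) : (((1 - P i) * V)ᴴ * ((1 - P i) * W i)).trace.re
        = (Vᴴ * W i).trace.re - (Vᴴ * W (i + 1)).trace.re := by
      rw [hproj, hWs, Matrix.trace_sub, Complex.sub_re]
    simp only [this]
    rw [Finset.sum_range_sub', hW0]
  have h1 : (Vᴴ * W n).trace.re ≤ x := by
    have := norm_trace_conjTranspose_mul_le V (W n)
    rw [hVV, Real.sqrt_one, one_mul] at this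
    exact (Complex.re_le_norm _).trans this
  have h2 : ∑ i ∈ Finset.range n, (((1 - P i) * V)ᴴ * ((1 - P i) * W i)).trace.re
      ≤ √L * √(1 - x ^ 2) := by
    rw [← hbs, hL]
    simp only [← ha]
    refine le_trans (Finset.sum_le_sum fun i _ => (Complex.re_le_norm _).trans
      (norm_trace_conjTranspose_mul_le _ _)) ?_
    exact Real.sum_sqrt_mul_sqrt_le _
      (fun i => (Complex.nonneg_iff.1 (posSemidef_conjTranspose_mul_self _).trace_nonneg).1)
      (fun i => (Complex.nonneg_iff.1 (posSemidef_conjTranspose_mul_self _).trace_nonneg).1)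
  -- For `x < 1`, cancelling `1 - x` gives `1 - x ≤ L (1 + x)`, so `1 - x² ≤ L (1 + x)² ≤ 4 L`; this
  -- is the origin of the constant 4.
  have hfin : (1 - x) ^ 2 ≤ L * (1 - x ^ 2) := by
    have hx0 : 0 ≤ x := Real.sqrt_nonneg _
    have h3 : 1 - x ≤ √L * √(1 - x ^ 2) := by linarith
    have h4 : 0 ≤ 1 - x := by nlinarith
    calc (1 - x) ^ 2 ≤ (√L * √(1 - x ^ 2)) ^ 2 := pow_le_pow_left₀ h4 h3 2
      _ = _ := by rw [mul_pow, Real.sq_sqrt hL0, Real.sq_sqrt (by linarith)]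
  rw [hnorm, ← hx2]
  have hx0 : 0 ≤ x := Real.sqrt_nonneg _
  rcases eq_or_lt_of_le (show x ≤ 1 by nlinarith) with h | h
  · rw [h]; linarith
  · have h5 : 1 - x ≤ L * (1 + x) := by
      have : (1 - x) * (1 - x) ≤ (L * (1 + x)) * (1 - x) := by linarith
      exact le_of_mul_le_mul_right this (by linarith)
    nlinarith

/-- The `i`-th summand is the effect "test `i` is the first to accept" and the last term is "no test
accepts"; each further test splits the latter in two. -/
lemma seqProd_telescope {T : ℕ → Matrix d d ℂ} (hT : ∀ i, (T i).IsHermitian)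
    (hTT : ∀ i, T i * T i = T i) (n : ℕ) :
    ∑ i ∈ Finset.range n, (seqProd (fun j => 1 - T j) i)ᴴ * T i * seqProd (fun j => 1 - T j) i
      + (seqProd (fun j => 1 - T j) n)ᴴ * seqProd (fun j => 1 - T j) n = 1 := by
  induction n with
  | zero => simp [seqProd]
  | succ n ih =>
    rw [Finset.sum_range_succ]
    have hs : seqProd (fun j => 1 - T j) (n + 1) = (1 - T n) * seqProd (fun j => 1 - T j) n := rfl
    rw [hs, conjTranspose_mul, (isHermitian_one_sub (hT n)).eq, Matrix.mul_assoc _ (1 - T n),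
      ← Matrix.mul_assoc (1 - T n), one_sub_mul_one_sub (hTT n)]
    conv_rhs => rw [← ih]
    rw [add_assoc]
    congr 1
    noncomm_ring

/-- Sequential decoder attached to a finite family of projective tests. -/
lemma exists_sequential_povm {ι : Type*} [Fintype ι] [DecidableEq ι] [Nonempty ι]
    {T : ι → Matrix d d ℂ} (hT : ∀ i, (T i).IsHermitian) (hTT : ∀ i, T i * T i = T i) :
    ∃ D : ι → Matrix d d ℂ, IsPOVM D ∧ ∀ ρ, IsDensity ρ → ∀ i,
      1 - (D i * ρ).trace.re ≤
        4 * (((1 - T i) * ρ).trace.re + ∑ j ∈ Finset.univ.erase i, (T j * ρ).trace.re) := by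
  let e := Fintype.equivFin ι
  let n := Fintype.card ι
  let S : ℕ → Matrix d d ℂ := fun k => if h : k < n then T (e.symm ⟨k, h⟩) else 0
  have hS k : (S k).IsHermitian := by
    by_cases h : k < n
    · simp only [S, h, dite_true]; exact hT _
    · simp only [S, h, dite_false]; exact Matrix.isHermitian_zero
  have hSS k : S k * S k = S k := by
    by_cases h : k < n
    · simp only [S, h, dite_true]; exact hTT _
    · simp [S, h]
  have hSe (i : ι) : S (e i) = T i := by simp [S, n, (e i).2]
  let R := seqProd fun j => 1 - S j
  let i₀ : ι := Classical.arbitrary ι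
  let E : ι → Matrix d d ℂ := fun i => (R (e i))ᴴ * T i * R (e i)
  have hE i : (E i).PosSemidef :=
    (posSemidef_of_projection (hT i) (hTT i)).conjTranspose_mul_mul_same _
  have hrem : ((R n)ᴴ * R n).PosSemidef := posSemidef_conjTranspose_mul_self _
  have hif i : (if i = i₀ then (R n)ᴴ * R n else 0).PosSemidef := by
    split_ifs
    · exact hrem
    · exact PosSemidef.zero
  -- The outcome in which no test accepts is given to an arbitrary message `i₀`; this completes the
  -- POVM and can only increase the success probabilities.
  refine ⟨fun i => E i + if i = i₀ then (R n)ᴴ * R n else 0,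
    ⟨fun i => (hE i).add (hif i), ?_⟩, ?_⟩
  · rw [Finset.sum_add_distrib, Finset.sum_ite_eq' Finset.univ i₀, if_pos (Finset.mem_univ _)]
    rw [← seqProd_telescope hS hSS n]
    congr 1
    rw [← Fin.sum_univ_eq_sum_range
      (fun i => (seqProd (fun j => 1 - S j) i)ᴴ * S i * seqProd (fun j => 1 - S j) i),
      ← Equiv.sum_comp e]
    refine Finset.sum_congr rfl fun i _ => ?_
    simp only [E, R, hSe]
  · intro ρ hρ i
    -- Message `i` is found when all earlier tests reject and its own accepts. The union bound uses
    -- only the first `e i + 1` of these projections, so the values beyond do not matter.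
    let P : ℕ → Matrix d d ℂ := fun k => if k < e i then 1 - S k else S k
    have hP k : (P k).IsHermitian := by
      simp only [P]; split_ifs
      · exact isHermitian_one_sub (hS k)
      · exact hS k
    have hPP k : P k * P k = P k := by
      simp only [P]; split_ifs
      · exact one_sub_mul_one_sub (hSS k)
      · exact hSS k
    have hub := quantum_union_bound hρ hP hPP (e i + 1)
    have hprod : seqProd P (e i + 1) = T i * R (e i) := by
      rw [seqProd, show seqProd P (e i) = R (e i) from
        seqProd_congr fun k hk => by simp only [P, if_pos hk]]
      simp only [P, lt_irrefl, if_false, hSe]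
    rw [hprod, conjTranspose_mul, (hT i).eq, Matrix.mul_assoc _ (T i) (T i * _),
      ← Matrix.mul_assoc (T i) (T i), hTT i, ← Matrix.mul_assoc] at hub
    have h1 : (E i * ρ).trace.re ≤ ((E i + if i = i₀ then (R n)ᴴ * R n else 0) * ρ).trace.re := by
      rw [Matrix.add_mul, Matrix.trace_add, Complex.add_re]
      linarith [re_trace_mul_nonneg (hif i) hρ.1]
    have h2 : ∑ k ∈ Finset.range (e i + 1), ((1 - P k) * ρ).trace.re
        ≤ ((1 - T i) * ρ).trace.re + ∑ j ∈ Finset.univ.erase i, (T j * ρ).trace.re := by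
      rw [Finset.sum_range_succ, add_comm]
      have e1 : P (e i) = T i := by simp only [P, lt_irrefl, if_false, hSe]
      rw [e1]
      gcongr
      have hmaps : ∑ k ∈ Finset.range (e i), ((1 - P k) * ρ).trace.re
          = ∑ j ∈ Finset.univ.filter (fun j => (e j : ℕ) < e i), (T j * ρ).trace.re := by
        symm
        refine Finset.sum_bij (fun j _ => (e j : ℕ)) ?_ ?_ ?_ ?_
        · intro j hj; simpa using hj
        · intro j _ j' _ h; exact e.injective (Fin.ext h)
        · intro k hk
          have hk' : k < n := (Finset.mem_range.1 hk).trans (e i).2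
          exact ⟨e.symm ⟨k, hk'⟩, Finset.mem_filter.2 ⟨Finset.mem_univ _, by
            rw [Equiv.apply_symm_apply]; exact Finset.mem_range.1 hk⟩, by simp⟩
        · intro j hj
          have hj' : (e j : ℕ) < e i := by simpa using hj
          simp only [P, if_pos hj', hSe, sub_sub_cancel]
      rw [hmaps]
      refine Finset.sum_le_sum_of_subset_of_nonneg ?_ fun j _ _ =>
        re_trace_mul_nonneg (posSemidef_of_projection (hT j) (hTT j)) hρ.1
      intro j hj
      rw [Finset.mem_filter] at hj
      refine Finset.mem_erase.2 ⟨?_, Finset.mem_univ _⟩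
      rintro rfl
      exact lt_irrefl _ hj.2
    change 1 - ((E i + if i = i₀ then (R n)ᴴ * R n else 0) * ρ).trace.re ≤ _
    have h3 : 1 - (E i * ρ).trace.re ≤ 4 * ∑ k ∈ Finset.range (e i + 1), ((1 - P k) * ρ).trace.re :=
      hub
    linarith

end

/-! ### Random codebooks -/

section

variable {I X : Type*} [Fintype I] [DecidableEq I] [Fintype X] [DecidableEq X]

/-- Probability of a codebook with independent codewords of law `P`. -/
def bookProb (P : X → ℝ) (c : I → X) : ℝ := ∏ i, P (c i)

lemma bookProb_nonneg {P : X → ℝ} (h0 : ∀ x, 0 ≤ P x) (c : I → X) : 0 ≤ bookProb P c :=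
  Finset.prod_nonneg fun _ _ => h0 _

lemma sum_prod_book (f : I → X → ℝ) : ∑ c : I → X, ∏ i, f i (c i) = ∏ i, ∑ x, f i x := by
  rw [Finset.prod_univ_sum]
  simp

lemma sum_bookProb {P : X → ℝ} (h1 : ∑ x, P x = 1) : ∑ c : I → X, bookProb P c = 1 := by
  simp [bookProb, sum_prod_book (fun _ : I => P), h1]

lemma sum_bookProb_mul {P : X → ℝ} (h1 : ∑ x, P x = 1) (i : I) (f : X → ℝ) :
    ∑ c : I → X, bookProb P c * f (c i) = ∑ x, P x * f x := by
  have h := sum_prod_book (fun (k : I) x => P x * if k = i then f x else 1)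
  have e (c : I → X) : ∏ k, (P (c k) * if k = i then f (c k) else 1) = bookProb P c * f (c i) := by
    rw [Finset.prod_mul_distrib, Finset.prod_ite_eq' Finset.univ i, if_pos (Finset.mem_univ i)]
    rfl
  simp only [e] at h
  rw [h, Finset.prod_eq_single i]
  · simp
  · intro k _ hk; simp [hk, h1]
  · simp

lemma sum_bookProb_mul_mul {P : X → ℝ} (h1 : ∑ x, P x = 1) {i j : I} (hij : i ≠ j)
    (f g : X → ℝ) :
    ∑ c : I → X, bookProb P c * (f (c i) * g (c j)) = (∑ x, P x * f x) * ∑ x, P x * g x := by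
  have h := sum_prod_book (fun (k : I) x => P x * ((if k = i then f x else 1) *
    if k = j then g x else 1))
  have e (c : I → X) : ∏ k, (P (c k) * ((if k = i then f (c k) else 1) *
      if k = j then g (c k) else 1)) = bookProb P c * (f (c i) * g (c j)) := by
    rw [Finset.prod_mul_distrib, Finset.prod_mul_distrib, Finset.prod_ite_eq' Finset.univ i,
      Finset.prod_ite_eq' Finset.univ j, if_pos (Finset.mem_univ i), if_pos (Finset.mem_univ j)]
    rfl
  simp only [e] at h
  rw [h]
  have hp (k : I) : ∑ x, P x * ((if k = i then f x else 1) * if k = j then g x else 1)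
      = (if k = i then ∑ x, P x * f x else 1) * if k = j then ∑ x, P x * g x else 1 := by
    by_cases hi : k = i
    · subst hi; simp [hij]
    · by_cases hj : k = j
      · subst hj; simp [hi]
      · simp [hi, hj, h1]
  simp only [hp]
  rw [Finset.prod_mul_distrib, Finset.prod_ite_eq' Finset.univ i,
      Finset.prod_ite_eq' Finset.univ j, if_pos (Finset.mem_univ i), if_pos (Finset.mem_univ j)]

/-- Expanding `F` in products of indicators reduces an arbitrary function of two codewords to the
product case, where independence is factorization. -/
lemma sum_bookProb_pair {P : X → ℝ} (h1 : ∑ x, P x = 1) {i j : I} (hij : i ≠ j)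
    (F : X → X → ℝ) :
    ∑ c : I → X, bookProb P c * F (c i) (c j) = ∑ x, ∑ y, P x * P y * F x y := by
  have e (c : I → X) : bookProb P c * F (c i) (c j)
      = ∑ x, ∑ y, F x y * (bookProb P c * ((if c i = x then 1 else 0) *
          if c j = y then 1 else 0)) := by
    rw [Finset.sum_eq_single (c i) (by intro x _ hx; simp [hx.symm]) (by simp),
      Finset.sum_eq_single (c j) (by intro x _ hx; simp [hx.symm]) (by simp)]
    simp [mul_comm]
  simp only [e]
  rw [Finset.sum_comm]
  refine Finset.sum_congr rfl fun x _ => ?_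
  rw [Finset.sum_comm]
  refine Finset.sum_congr rfl fun y _ => ?_
  rw [← Finset.mul_sum, sum_bookProb_mul_mul h1 hij (fun z => if z = x then 1 else 0)
    (fun z => if z = y then 1 else 0)]
  simp [mul_comm]

/-- Second moment of a centred empirical average of a quadratic form. -/
lemma sum_bookProb_quadratic {P : X → ℝ} (h1 : ∑ x, P x = 1)
    (F : X → X → ℝ) (hF : ∑ x, ∑ y, P x * P y * F x y = 0) :
    ∑ c : I → X, bookProb P c * ∑ i, ∑ j, F (c i) (c j)
      = (Fintype.card I : ℝ) * ∑ x, P x * F x x := by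
  have e (c : I → X) : bookProb P c * ∑ i, ∑ j, F (c i) (c j)
      = ∑ i, ∑ j, bookProb P c * F (c i) (c j) := by
    simp only [Finset.mul_sum]
  simp only [e]
  rw [Finset.sum_comm]
  have hi (i : I) : ∑ c : I → X, ∑ j, bookProb P c * F (c i) (c j) = ∑ x, P x * F x x := by
    rw [Finset.sum_comm, Finset.sum_eq_single i]
    · exact sum_bookProb_mul h1 i fun x => F x x
    · intro j _ hj
      rw [sum_bookProb_pair h1 hj.symm, hF]
    · simp
  simp only [hi]
  simp

/-- Jensen's inequality for the square root. -/
lemma sum_mul_sqrt_le {ι : Type*} [Fintype ι] {w f : ι → ℝ} (hw : ∀ i, 0 ≤ w i)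
    (hw1 : ∑ i, w i = 1) (hf : ∀ i, 0 ≤ f i) :
    ∑ i, w i * √(f i) ≤ √(∑ i, w i * f i) := by
  have h := Real.sum_sqrt_mul_sqrt_le Finset.univ hw (fun i => mul_nonneg (hw i) (hf i))
  rw [hw1, Real.sqrt_one, one_mul] at h
  refine le_trans (Finset.sum_le_sum fun i _ => ?_) h
  rw [Real.sqrt_mul (hw i), ← mul_assoc, Real.mul_self_sqrt (hw i)]

end

/-! ### Pinching -/

section

variable {d : Type*} [Fintype d] [DecidableEq d]

/-- A unitary commuting with `diagonal s` that diagonalizes the blocks of `R` on the level sets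
of `s`. -/
lemma exists_fiberwise_diagonalization (s : d → ℝ) {R : Matrix d d ℂ} (hR : R.IsHermitian) :
    ∃ W : Matrix d d ℂ, Wᴴ * W = 1 ∧
      Wᴴ * diagonal (fun i => (s i : ℂ)) * W = diagonal (fun i => (s i : ℂ)) ∧
      ∀ i j, i ≠ j → s i = s j → (Wᴴ * R * W) i j = 0 := by
  have hRv (v : ℝ) : (R.submatrix (Subtype.val : {i // s i = v} → d) Subtype.val).IsHermitian :=
    hR.submatrix _
  choose U l hU _ hl using fun v => exists_diagonalization (hRv v)
  let W : Matrix d d ℂ := Matrix.of fun i j =>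
    if h : s i = s j then U (s j) ⟨i, h⟩ ⟨j, rfl⟩ else 0
  have hW (v : ℝ) (i j : {k // s k = v}) : W i j = U v i j := by
    obtain ⟨i, hi⟩ := i
    obtain ⟨j, rfl⟩ := j
    simp only [W, Matrix.of_apply, dif_pos hi]
  have hW0 {i j : d} (h : s i ≠ s j) : W i j = 0 := by simp only [W, Matrix.of_apply, dif_neg h]
  have hsum (v : ℝ) (f : d → ℂ) (hf : ∀ k, s k ≠ v → f k = 0) :
      ∑ k, f k = ∑ k : {k // s k = v}, f k := by
    rw [← Finset.sum_subtype (Finset.univ.filter fun k => s k = v) (by simp)]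
    rw [Finset.sum_filter]
    refine Finset.sum_congr rfl fun k _ => ?_
    split_ifs with h
    · rfl
    · exact hf k h
  have hWW : Wᴴ * W = 1 := by
    ext i j
    rw [Matrix.mul_apply]
    by_cases hij : s i = s j
    · rw [hsum (s j) _ fun k hk => by rw [hW0 hk, mul_zero]]
      have := congrFun (congrFun (hU (s j)) ⟨i, hij⟩) ⟨j, rfl⟩
      rw [Matrix.mul_apply] at this
      simp only [conjTranspose_apply] at this ⊢
      have e (k : {k // s k = s j}) : star (W k i) * W k j
          = star (U (s j) k ⟨i, hij⟩) * U (s j) k ⟨j, rfl⟩ := by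
        rw [← hW (s j) k ⟨i, hij⟩, ← hW (s j) k ⟨j, rfl⟩]
      simp only [e, this, Matrix.one_apply, Subtype.mk.injEq]
    · rw [Matrix.one_apply_ne (fun h => hij (by rw [h]))]
      refine Finset.sum_eq_zero fun k _ => ?_
      by_cases hk : s k = s j
      · rw [conjTranspose_apply, hW0 (fun h => hij (h.symm.trans hk)), star_zero, zero_mul]
      · rw [hW0 hk, mul_zero]
  have hcomm : diagonal (fun i => (s i : ℂ)) * W = W * diagonal (fun i => (s i : ℂ)) := by
    ext i j
    rw [Matrix.diagonal_mul, Matrix.mul_diagonal]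
    by_cases h : s i = s j
    · rw [h, mul_comm]
    · rw [hW0 h]; simp
  refine ⟨W, hWW, ?_, ?_⟩
  · rw [Matrix.mul_assoc, hcomm, ← Matrix.mul_assoc, hWW, Matrix.one_mul]
  · intro i j hne hij
    have h1 : (Wᴴ * R * W) i j = ((U (s j))ᴴ * R.submatrix (Subtype.val : {k // s k = s j} → d)
        (Subtype.val : {k // s k = s j} → d) * U (s j)) ⟨i, hij⟩ ⟨j, rfl⟩ := by
      rw [Matrix.mul_apply, hsum (s j) _ fun k hk => by rw [hW0 hk, mul_zero], Matrix.mul_apply]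
      refine Finset.sum_congr rfl fun k _ => ?_
      rw [← hW (s j) k ⟨j, rfl⟩, Matrix.mul_apply, hsum (s j) _ fun k' hk' => by
        rw [conjTranspose_apply, hW0 (fun h => hk' (h.trans hij)), star_zero, zero_mul],
        Matrix.mul_apply]
      congr 1
      refine Finset.sum_congr rfl fun k' _ => ?_
      rw [conjTranspose_apply, conjTranspose_apply, ← hW (s j) k' ⟨i, hij⟩]
      rfl
    rw [h1, hl]
    have h2 : (U (s j))ᴴ * (U (s j) * diagonal (fun i => (l (s j) i : ℂ)) * (U (s j))ᴴ) * U (s j)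
        = diagonal (fun i => (l (s j) i : ℂ)) := by
      simp only [Matrix.mul_assoc, hU, Matrix.mul_one]
      rw [← Matrix.mul_assoc, hU, Matrix.one_mul]
    rw [h2, Matrix.diagonal_apply_ne]
    simpa using hne

/-- Pinching inequality, for a matrix that is diagonal on the level sets of `s`. -/
lemma pinching_posSemidef (s : d → ℝ) {M : Matrix d d ℂ} (hM : M.PosSemidef)
    (h : ∀ i j, i ≠ j → s i = s j → M i j = 0) :
    ((((Finset.univ.image s).card : ℝ) : ℂ) • diagonal (fun i => M i i) - M).PosSemidef := by
  set J := Finset.univ.image s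
  let P : ℝ → Matrix d d ℂ := fun v => diagonal fun i => if s i = v then 1 else 0
  have hPh v : (P v)ᴴ = P v := by
    simp only [P, diagonal_conjTranspose]; congr 1; ext i; simp [apply_ite]
  have hsumP : ∑ v ∈ J, P v = 1 := by
    ext i j
    rw [Matrix.sum_apply]
    by_cases hij : i = j
    · subst hij
      simp [P, J]
    · simp [P, hij]
  have hpin : ∑ v ∈ J, P v * M * P v = diagonal fun i => M i i := by
    ext i j
    simp only [Matrix.sum_apply, P, Matrix.mul_diagonal, Matrix.diagonal_mul]
    by_cases hij : i = j
    · subst hij; simp [J]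
    · rw [Matrix.diagonal_apply_ne _ hij]
      refine Finset.sum_eq_zero fun v _ => ?_
      by_cases h1 : s i = v <;> by_cases h2 : s j = v <;> simp [h1, h2]
      exact h i j hij (h1.trans h2.symm)
  -- Expanding this positive sum gives twice the matrix in the statement: the square terms produce
  -- `|J|` copies of the pinching and, as `∑ P v = 1`, the cross terms produce `M`.
  have hpos : (∑ v ∈ J, ∑ w ∈ J, (P v - P w) * M * (P v - P w)).PosSemidef := by
    refine posSemidef_sum _ fun v _ => posSemidef_sum _ fun w _ => ?_
    have := hM.mul_mul_conjTranspose_same (P v - P w)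
    rwa [conjTranspose_sub, hPh, hPh] at this
  have hexp : ∑ v ∈ J, ∑ w ∈ J, (P v - P w) * M * (P v - P w)
      = (2 : ℝ) • ((((J.card : ℝ) : ℂ)) • diagonal (fun i => M i i) - M) := by
    have e v w : (P v - P w) * M * (P v - P w)
        = P v * M * P v - P v * M * P w - P w * M * P v + P w * M * P w := by noncomm_ring
    have c1 : ∑ v ∈ J, ∑ w ∈ J, P v * M * P w = M := by
      simp only [← Finset.mul_sum, hsumP, Matrix.mul_one]
      simp only [← Finset.sum_mul, hsumP, Matrix.one_mul]
    have c2 : ∑ v ∈ J, ∑ w ∈ J, P w * M * P v = M := by rw [Finset.sum_comm]; exact c1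
    simp only [e, Finset.sum_add_distrib, Finset.sum_sub_distrib, Finset.sum_const, c1, c2, hpin]
    rw [← Finset.smul_sum, hpin, two_smul]
    simp only [← Nat.cast_smul_eq_nsmul ℂ, Complex.ofReal_natCast]
    abel
  rw [hexp] at hpos
  have := hpos.smul (a := (1 / 2 : ℝ)) (by norm_num)
  rw [smul_smul] at this
  norm_num at this
  simpa using this

/-- Identifies the constant of the pinching inequality, a number of level sets, with `ν`. -/
lemma numEigenvalues_conj_diagonal {V : Matrix d d ℂ} {s : d → ℝ} (hV : Vᴴ * V = 1)
    (hV' : V * Vᴴ = 1) :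
    numEigenvalues (V * diagonal (fun i => (s i : ℂ)) * Vᴴ) = (Finset.univ.image s).card := by
  have hu : V ∈ unitary (Matrix d d ℂ) := ⟨hV, hV'⟩
  have h := Unitary.spectrum_star_right_conjugate (R := ℂ)
    (a := diagonal (fun i => (s i : ℂ))) (U := ⟨V, hu⟩)
  have h' : spectrum ℂ (V * diagonal (fun i => (s i : ℂ)) * Vᴴ)
      = (fun x : ℝ => (x : ℂ)) '' (Finset.univ.image s : Finset ℝ) := by
    rw [show spectrum ℂ (V * diagonal (fun i => (s i : ℂ)) * Vᴴ) = _ from h, spectrum_diagonal]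
    ext z; simp
  rw [numEigenvalues, h', Set.ncard_image_of_injective _ Complex.ofReal_injective,
    Set.ncard_coe_finset]

/-- Jensen's inequality for the diagonal of a power of a positive matrix. -/
lemma rpow_diag_le {ρ V : Matrix d d ℂ} (hρ : ρ.PosSemidef) (hV : Vᴴ * V = 1) {p : ℝ}
    (hp : 1 ≤ p) (i : d) :
    ((Vᴴ * ρ * V) i i).re ^ p ≤ ((Vᴴ * mpow ρ p * V) i i).re := by
  obtain ⟨U, r, hU, hU', rfl⟩ := exists_diagonalization hρ.isHermitian
  have hr := conj_diagonal_nonneg hU hρ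
  rw [mpow_conj_diagonal hU hU']
  set w := Uᴴ * V with hw
  have hww : wᴴ * w = 1 := by
    rw [hw, conjTranspose_mul, conjTranspose_conjTranspose, Matrix.mul_assoc,
      ← Matrix.mul_assoc U, hU', Matrix.one_mul, hV]
  have e (f : d → ℝ) : ((Vᴴ * (U * diagonal (fun i => (f i : ℂ)) * Uᴴ) * V) i i).re
      = ∑ k, ‖w k i‖ ^ 2 * f k := by
    have : Vᴴ * (U * diagonal (fun i => (f i : ℂ)) * Uᴴ) * V
        = wᴴ * diagonal (fun i => (f i : ℂ)) * w := by
      rw [hw, conjTranspose_mul, conjTranspose_conjTranspose]; simp only [Matrix.mul_assoc]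
    rw [this, Matrix.mul_apply, Complex.re_sum]
    refine Finset.sum_congr rfl fun k _ => ?_
    rw [Matrix.mul_diagonal, conjTranspose_apply]
    have h1 := Complex.conj_mul' (w k i)
    have h2 : star (w k i) * (f k : ℂ) * w k i = ((‖w k i‖ ^ 2 * f k : ℝ) : ℂ) := by
      push_cast
      rw [← h1, show star (w k i) = (starRingEnd ℂ) (w k i) from rfl]; ring
    rw [h2, Complex.ofReal_re]
  -- Column `i` of `w` is a unit vector, so its squared moduli are the weights for Jensen's
  -- inequality.
  have hw1 : ∑ k, ‖w k i‖ ^ 2 = 1 := by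
    have h1 := e fun _ => 1
    simp only [mul_one] at h1
    rw [← h1, ← one_eq_conj_diagonal hU', Matrix.mul_one, hV]
    simp
  rw [e r, e fun k => r k ^ p]
  exact Real.rpow_arith_mean_le_arith_mean_rpow _ _ _ (fun k _ => sq_nonneg _) hw1
    (fun k _ => hr k) hp

end

/-! ### Truncation -/

section

variable {d : Type*} [Fintype d] [DecidableEq d]

/-- A joint diagonalization of `σ` and of the pinching of `ρ` by `σ`. -/
lemma exists_pinching_basis {σ ρ : Matrix d d ℂ} (hσ : σ.IsHermitian) (hρ : ρ.IsHermitian) :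
    ∃ (V : Matrix d d ℂ) (s : d → ℝ), Vᴴ * V = 1 ∧ V * Vᴴ = 1 ∧
      σ = V * diagonal (fun i => (s i : ℂ)) * Vᴴ ∧
      ∀ i j, i ≠ j → s i = s j → (Vᴴ * ρ * V) i j = 0 := by
  obtain ⟨U, s, hU, hU', rfl⟩ := exists_diagonalization hσ
  have hR : (Uᴴ * ρ * U).IsHermitian := Matrix.isHermitian_conjTranspose_mul_mul _ hρ
  obtain ⟨W, hW, hWs, hW0⟩ := exists_fiberwise_diagonalization s hR
  have hW' : W * Wᴴ = 1 := mul_eq_one_comm.1 hW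
  refine ⟨U * W, s, ?_, ?_, ?_, ?_⟩
  · rw [conjTranspose_mul, Matrix.mul_assoc, ← Matrix.mul_assoc Uᴴ, hU, Matrix.one_mul, hW]
  · rw [conjTranspose_mul, Matrix.mul_assoc, ← Matrix.mul_assoc W, hW', Matrix.one_mul, hU']
  · have : diagonal (fun i => (s i : ℂ)) = W * diagonal (fun i => (s i : ℂ)) * Wᴴ := by
      conv_rhs => rw [← hWs]
      simp only [Matrix.mul_assoc, hW', Matrix.mul_one]
      rw [← Matrix.mul_assoc, hW', Matrix.one_mul]
    conv_lhs => rw [this]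
    rw [conjTranspose_mul]
    simp only [Matrix.mul_assoc]
  · intro i j hij hs
    rw [← hW0 i j hij hs, conjTranspose_mul]
    simp only [Matrix.mul_assoc]

/-- Truncation of `ρ` to the part dominated by `C σ` after pinching. -/
lemma exists_truncation {σ ρ : Matrix d d ℂ} (hσ : σ.PosSemidef) (hρ : IsDensity ρ) {c : ℝ}
    (hc : 0 < c) (h : (σ - (c : ℂ) • ρ).PosSemidef) {s C : ℝ} (hs : 0 < s) (hC : 0 < C) :
    ∃ T : Matrix d d ℂ, T.IsHermitian ∧ T * T = T ∧
      1 - (T * ρ).trace.re ≤ C ^ (-s) * (mpow ρ (1 + s) * mpow σ (-s)).trace.re ∧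
      ((((numEigenvalues σ : ℝ) * C : ℝ) : ℂ) • 1
        - mpow σ (-(1 / 2)) * (T * ρ * T) * mpow σ (-(1 / 2))).PosSemidef ∧
      mpow σ (1 / 4) * mpow σ (-(1 / 4)) * T = T := by
  obtain ⟨V, l, hV, hV', rfl, hoff⟩ := exists_pinching_basis hσ.isHermitian hρ.1.isHermitian
  have hl := conj_diagonal_nonneg hV hσ
  set M := Vᴴ * ρ * V with hM
  have hMp : M.PosSemidef := hρ.1.conjTranspose_mul_mul_same V
  have hρM : ρ = V * M * Vᴴ := by
    rw [hM]
    simp only [Matrix.mul_assoc, hV', Matrix.mul_one]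
    rw [← Matrix.mul_assoc, hV', Matrix.one_mul]
  set t : d → ℝ := fun i => (M i i).re with ht
  have ht0 i : 0 ≤ t i := (Complex.nonneg_iff.1 hMp.diag_nonneg).1
  have hMt i : M i i = (t i : ℂ) := by
    have := (Complex.nonneg_iff.1 (hMp.diag_nonneg (i := i))).2
    apply Complex.ext <;> simp [ht, ← this]
  -- Only one consequence is needed: `ρ` has no mass where `σ` vanishes, so negative powers of `σ`,
  -- which are zero there, miss nothing.
  have htl i : c * t i ≤ l i := by
    have h1 := (h.conjTranspose_mul_mul_same V).diag_nonneg (i := i)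
    have h2 : Vᴴ * (V * diagonal (fun i => (l i : ℂ)) * Vᴴ - (c : ℂ) • ρ) * V
        = diagonal (fun i => (l i : ℂ)) - (c : ℂ) • M := by
      rw [hM, Matrix.mul_sub, Matrix.sub_mul, Matrix.mul_smul, Matrix.smul_mul]
      congr 1
      simp only [Matrix.mul_assoc, hV, Matrix.mul_one]
      rw [← Matrix.mul_assoc, hV, Matrix.one_mul]
    rw [h2] at h1
    simp only [Matrix.sub_apply, Matrix.diagonal_apply_eq, Matrix.smul_apply, hMt,
      smul_eq_mul] at h1
    have := (Complex.nonneg_iff.1 h1).1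
    simp at this
    linarith
  -- `T` keeps the basis vectors on which the likelihood ratio `t / l` is at most `C`. The condition
  -- `0 < l i` places `T` inside the support of `σ`, which gives the last claim.
  let g : d → ℝ := fun i => if 0 < l i ∧ t i ≤ C * l i then 1 else 0
  have hTρ : (V * diagonal (fun i => (g i : ℂ)) * Vᴴ * ρ).trace.re = ∑ i, g i * t i := by
    have : (V * diagonal (fun i => (g i : ℂ)) * Vᴴ * ρ).trace
        = (diagonal (fun i => (g i : ℂ)) * M).trace := by
      rw [hM]
      simp only [Matrix.mul_assoc]
      rw [Matrix.trace_mul_comm]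
      simp only [Matrix.mul_assoc]
    rw [this]
    simp [Matrix.trace, Matrix.diagonal_mul, hMt]
  have ht1 : ∑ i, t i = 1 := by
    have h1 : ρ.trace = M.trace := by
      conv_lhs => rw [hρM]
      rw [Matrix.trace_mul_comm, ← Matrix.mul_assoc, hV, Matrix.one_mul]
    have := hρ.trace_re
    rw [h1] at this
    simpa [Matrix.trace, hMt] using this
  refine ⟨V * diagonal (fun i => (g i : ℂ)) * Vᴴ, isHermitian_conj_diagonal V g, ?_, ?_, ?_, ?_⟩
  · rw [conj_diagonal_mul hV]
    congr 3
    ext i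
    simp only [g]
    split_ifs <;> simp
  · have hsub : 1 - ∑ i, g i * t i = ∑ i, (t i - g i * t i) := by
      rw [Finset.sum_sub_distrib, ht1]
    rw [hTρ, hsub, mpow_conj_diagonal hV hV']
    have h1 : (mpow ρ (1 + s) * (V * diagonal (fun i => ((l i ^ (-s) : ℝ) : ℂ)) * Vᴴ)).trace.re
        = ∑ i, ((Vᴴ * mpow ρ (1 + s) * V) i i).re * l i ^ (-s) := by
      have : (mpow ρ (1 + s) * (V * diagonal (fun i => ((l i ^ (-s) : ℝ) : ℂ)) * Vᴴ)).trace
        = (Vᴴ * mpow ρ (1 + s) * V * diagonal (fun i => ((l i ^ (-s) : ℝ) : ℂ))).trace := by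
        have := Matrix.trace_mul_comm
          (mpow ρ (1 + s) * V * diagonal (fun i => ((l i ^ (-s) : ℝ) : ℂ))) Vᴴ
        simpa only [Matrix.mul_assoc] using this
      rw [this]
      simp [Matrix.trace, Matrix.mul_diagonal]
    rw [h1, Finset.mul_sum]
    refine Finset.sum_le_sum fun i _ => ?_
    have hjen := rpow_diag_le hρ.1 hV (p := 1 + s) (by linarith) i
    have hj0 : 0 ≤ ((Vᴴ * mpow ρ (1 + s) * V) i i).re :=
      (Real.rpow_nonneg (ht0 i) _).trans hjen
    have hR0 : 0 ≤ C ^ (-s) * (((Vᴴ * mpow ρ (1 + s) * V) i i).re * l i ^ (-s)) :=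
      mul_nonneg (Real.rpow_nonneg hC.le _) (mul_nonneg hj0 (Real.rpow_nonneg (hl i) _))
    simp only [g]
    split_ifs with hg
    · simpa using hR0
    · rw [zero_mul, sub_zero]
      rcases (hl i).eq_or_lt with h0 | h0
      · have : t i = 0 := by
          have := htl i
          rw [← h0] at this
          exact le_antisymm (by nlinarith) (ht0 i)
        rw [this]; exact hR0
      · have hgt : C * l i < t i := by
          by_contra hcon
          exact hg ⟨h0, not_lt.1 hcon⟩
        have hCl : 0 < C * l i := mul_pos hC h0
        have htp : 0 < t i := hCl.trans hgt
        -- Markov's inequality for the power `s` of the ratio: on discarded indices `t > C l`, hence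
        -- `t^{-s} ≤ (C l)^{-s}`. Jensen then replaces the diagonal entry `t^{1+s}` by that of
        -- `ρ^{1+s}`.
        calc t i = t i ^ (1 + s) * t i ^ (-s) := by
              rw [← Real.rpow_add htp]; simp
          _ ≤ t i ^ (1 + s) * (C * l i) ^ (-s) := by
              refine mul_le_mul_of_nonneg_left ?_ (Real.rpow_nonneg htp.le _)
              exact Real.rpow_le_rpow_of_nonpos hCl hgt.le (by linarith)
          _ = C ^ (-s) * (t i ^ (1 + s) * l i ^ (-s)) := by
              rw [Real.mul_rpow hC.le h0.le]; ring
          _ ≤ _ := by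
              refine mul_le_mul_of_nonneg_left ?_ (Real.rpow_nonneg hC.le _)
              exact mul_le_mul_of_nonneg_right hjen (Real.rpow_nonneg h0.le _)
  · have hpin := pinching_posSemidef l hMp hoff
    rw [mpow_conj_diagonal hV hV', numEigenvalues_conj_diagonal hV hV']
    set ν : ℝ := ((Finset.univ.image l).card : ℝ) with hν
    have hν0 : 0 ≤ ν := Nat.cast_nonneg _
    let q : d → ℝ := fun i => l i ^ (-(1 / 2) : ℝ) * g i
    have hq : (diagonal (fun i => (q i : ℂ)))ᴴ = diagonal (fun i => (q i : ℂ)) := by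
      rw [diagonal_conjTranspose]; congr 1; ext i; simp
    have e1 : V * diagonal (fun i => ((l i ^ (-(1 / 2) : ℝ) : ℝ) : ℂ)) * Vᴴ
          * (V * diagonal (fun i => (g i : ℂ)) * Vᴴ * ρ * (V * diagonal (fun i => (g i : ℂ)) * Vᴴ))
          * (V * diagonal (fun i => ((l i ^ (-(1 / 2) : ℝ) : ℝ) : ℂ)) * Vᴴ)
        = V * (diagonal (fun i => (q i : ℂ)) * M * diagonal (fun i => (q i : ℂ))) * Vᴴ := by
      have a1 := conj_diagonal_mul hV (fun i => ((l i ^ (-(1 / 2) : ℝ) : ℝ) : ℂ))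
        (fun i => (g i : ℂ))
      have a2 := conj_diagonal_mul hV (fun i => (g i : ℂ))
        (fun i => ((l i ^ (-(1 / 2) : ℝ) : ℝ) : ℂ))
      have e2 : (fun i => ((l i ^ (-(1 / 2) : ℝ) : ℝ) : ℂ) * (g i : ℂ)) = fun i => (q i : ℂ) := by
        ext i; simp [q]
      have e3 : (fun i => (g i : ℂ) * ((l i ^ (-(1 / 2) : ℝ) : ℝ) : ℂ)) = fun i => (q i : ℂ) := by
        ext i; simp [q, mul_comm]
      rw [e2] at a1
      rw [e3] at a2
      calc _ = (V * diagonal (fun i => ((l i ^ (-(1 / 2) : ℝ) : ℝ) : ℂ)) * Vᴴ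
            * (V * diagonal (fun i => (g i : ℂ)) * Vᴴ)) * ρ
            * ((V * diagonal (fun i => (g i : ℂ)) * Vᴴ)
            * (V * diagonal (fun i => ((l i ^ (-(1 / 2) : ℝ) : ℝ) : ℂ)) * Vᴴ)) := by
            simp only [Matrix.mul_assoc]
        _ = _ := by
            rw [a1, a2, hM]; simp only [Matrix.mul_assoc]
    rw [e1]
    have e4 : (((ν * C : ℝ) : ℂ) • 1
        - V * (diagonal (fun i => (q i : ℂ)) * M * diagonal (fun i => (q i : ℂ))) * Vᴴ)
        = V * (((ν * C : ℝ) : ℂ) • 1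
          - diagonal (fun i => (q i : ℂ)) * M * diagonal (fun i => (q i : ℂ))) * Vᴴ := by
      rw [Matrix.mul_sub, Matrix.sub_mul]
      simp [hV']
    rw [e4]
    refine PosSemidef.mul_mul_conjTranspose_same ?_ V
    -- The target is a sum of two positive matrices: the pinching inequality conjugated by `q`, and
    -- the diagonal gap `νC - ν q t q`, nonnegative by the choice of `g`.
    have p1 := hpin.mul_mul_conjTranspose_same (diagonal (fun i => (q i : ℂ)))
    rw [hq] at p1
    have p2 : (diagonal (fun i => ((ν * C - ν * (q i * t i * q i) : ℝ) : ℂ))).PosSemidef := by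
      refine PosSemidef.diagonal fun i => ?_
      have : 0 ≤ ν * C - ν * (q i * t i * q i) := by
        have : q i * t i * q i ≤ C := by
          simp only [q, g]
          split_ifs with hg
          · have h1 : l i ^ (-(1 / 2) : ℝ) * l i ^ (-(1 / 2) : ℝ) = (l i)⁻¹ := by
              rw [← Real.rpow_add hg.1, ← Real.rpow_neg_one]; norm_num
            calc _ = (l i ^ (-(1 / 2) : ℝ) * l i ^ (-(1 / 2) : ℝ)) * t i := by ring
              _ = (l i)⁻¹ * t i := by rw [h1]
              _ ≤ C := by
                rw [inv_mul_le_iff₀ hg.1]; linarith [hg.2]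
          · simpa using hC.le
        nlinarith
      simpa using (by exact_mod_cast this : (0 : ℂ) ≤ ((ν * C - ν * (q i * t i * q i) : ℝ) : ℂ))
    have := p1.add p2
    convert this using 1
    ext i j
    by_cases hij : i = j
    · subst hij
      simp only [Matrix.add_apply, Matrix.sub_apply, Matrix.mul_diagonal, Matrix.diagonal_mul,
        Matrix.smul_apply, Matrix.one_apply_eq, Matrix.diagonal_apply_eq, hMt, smul_eq_mul]
      push_cast
      ring
    · simp only [Matrix.add_apply, Matrix.sub_apply, Matrix.mul_diagonal, Matrix.diagonal_mul,
        Matrix.smul_apply, Matrix.one_apply_ne hij, Matrix.diagonal_apply_ne _ hij, smul_eq_mul]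
      ring
  · rw [mpow_conj_diagonal hV hV', mpow_conj_diagonal hV hV', conj_diagonal_mul hV,
      conj_diagonal_mul hV]
    congr 3
    ext i
    simp only [g]
    split_ifs with hg
    · rw [← Complex.ofReal_mul, ← Real.rpow_add hg.1]; simp
    · simp

end

/-! ### Resolvability -/

section

variable {d X : Type*} [Fintype d] [DecidableEq d] [Fintype X] [DecidableEq X]

lemma re_trace_mul_self_nonneg {A : Matrix d d ℂ} (hA : A.IsHermitian) :
    0 ≤ (A * A).trace.re := by
  have := (Complex.nonneg_iff.1 (posSemidef_conjTranspose_mul_self A).trace_nonneg).1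
  rwa [hA.eq] at this

/-- Holds also on the kernel: the exponents and their sum are nonzero, so both sides vanish there.
-/
lemma mpow_neg_quarter_mul_self {A : Matrix d d ℂ} (hA : A.PosSemidef) :
    mpow A (-(1 / 4)) * mpow A (-(1 / 4)) = mpow A (-(1 / 2)) := by
  obtain ⟨U, l, hU, hU', rfl⟩ := exists_diagonalization hA.isHermitian
  have hl := conj_diagonal_nonneg hU hA
  rw [mpow_conj_diagonal hU hU', mpow_conj_diagonal hU hU', conj_diagonal_mul hU]
  congr 3
  ext i
  rw [← Complex.ofReal_mul, ← Real.rpow_add' (hl i) (by norm_num)]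
  norm_num

/-- A Hölder-type bound for the trace norm of `τ^{1/4} W τ^{1/4}`. -/
lemma re_trace_involution_sandwich_le {τ S W : Matrix d d ℂ} (hτ : IsDensity τ)
    (hS : S.IsHermitian) (hS1 : S * S = 1) (hW : W.IsHermitian) :
    (S * (mpow τ (1 / 4) * W * mpow τ (1 / 4))).trace.re ≤ √((W * W).trace.re) := by
  set q := mpow τ (1 / 4) with hq
  set r := mpow τ (1 / 2) with hr
  have hqh : qᴴ = q := (mpow_posSemidef hτ.1 _).isHermitian.eq
  have hrh : rᴴ = r := (mpow_posSemidef hτ.1 _).isHermitian.eq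
  have hqq : q * q = r := by
    rw [hq, mpow_mul_mpow hτ.1 (by norm_num) (by norm_num)]; norm_num [hr]
  have hrr : r * r = τ := mpow_half_mul_self hτ.1
  have e1 : (S * (q * W * q)).trace = ((q * S * q)ᴴ * W).trace := by
    have := Matrix.trace_mul_comm (S * q * W) q
    rw [conjTranspose_mul, conjTranspose_mul, hqh, hS.eq]
    simpa only [Matrix.mul_assoc] using this
  -- Cauchy–Schwarz is used twice: here against `W`, and in `c2` to bound `‖q S q‖₂² = tr (r S r S)`
  -- by `‖r‖₂ ‖S r S‖₂ = tr τ = 1`.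
  have c1 := norm_trace_conjTranspose_mul_le (q * S * q) W
  have c2 := norm_trace_conjTranspose_mul_le r (S * r * S)
  have e2 : ((q * S * q)ᴴ * (q * S * q)).trace = (rᴴ * (S * r * S)).trace := by
    rw [conjTranspose_mul, conjTranspose_mul, hqh, hS.eq, hrh, ← hqq]
    have h2 := Matrix.trace_mul_comm (q * S * q * q * S) q
    simp only [Matrix.mul_assoc] at h2 ⊢
    rw [h2]
  have e3 : (S * r * S)ᴴ * (S * r * S) = S * τ * S := by
    rw [conjTranspose_mul, conjTranspose_mul, hS.eq, hrh, ← hrr]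
    calc S * (r * S) * (S * r * S) = S * r * (S * S) * r * S := by simp only [Matrix.mul_assoc]
      _ = _ := by rw [hS1]; simp only [Matrix.mul_assoc, Matrix.one_mul]
  have e4 : (S * τ * S).trace = τ.trace := by
    rw [Matrix.trace_mul_comm, ← Matrix.mul_assoc, hS1, Matrix.one_mul]
  rw [e3, e4, hrh, hrr, hτ.trace_re, Real.sqrt_one, one_mul] at c2
  have h1 : √(((q * S * q)ᴴ * (q * S * q)).trace.re) ≤ 1 := by
    rw [Real.sqrt_le_left zero_le_one, one_pow, e2, hrh]
    exact (Complex.re_le_norm _).trans c2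
  rw [hW.eq] at c1
  rw [e1]
  exact (Complex.re_le_norm _).trans (c1.trans (mul_le_of_le_one_left (Real.sqrt_nonneg _) h1))

/-- Supplies the domination required by `exists_truncation`, with constant `c = P x`. -/
lemma CQ.IsState.margQ_sub_posSemidef {σ : CQ X d} (h : σ.IsState) (x : X) :
    (σ.margQ - (σ.P x : ℂ) • σ.st x).PosSemidef := by
  obtain ⟨h0, h1, h2⟩ := h
  rw [CQ.margQ, ← Finset.add_sum_erase _ _ (Finset.mem_univ x), add_sub_cancel_left]
  exact posSemidef_sum _ fun y _ => posSemidef_ofReal_smul (h2 y).1 (h0 y)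

lemma isHermitian_sum {ι : Type*} (s : Finset ι) {f : ι → Matrix d d ℂ}
    (h : ∀ i ∈ s, (f i).IsHermitian) : (∑ i ∈ s, f i).IsHermitian := by
  rw [Matrix.IsHermitian, Matrix.conjTranspose_sum]
  exact Finset.sum_congr rfl fun i hi => h i hi

lemma isHermitian_ofReal_smul {A : Matrix d d ℂ} (hA : A.IsHermitian) (c : ℝ) :
    ((c : ℂ) • A).IsHermitian := by
  rw [Matrix.IsHermitian, Matrix.conjTranspose_smul, hA.eq]
  simp

lemma re_trace_ofReal_smul (A : Matrix d d ℂ) (c : ℝ) :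
    ((c : ℂ) • A).trace.re = c * A.trace.re := by
  rw [Matrix.trace_smul, smul_eq_mul, Complex.re_ofReal_mul]

/-- The mass bound is weighted by `P x` so that letters of probability zero, for which domination
gives no support condition, can be handled with `T = 0`. -/
lemma CQ.IsState.exists_truncations {σ : CQ X d} (h : σ.IsState) {s C : ℝ} (hs : 0 < s)
    (hC : 0 < C) (x : X) :
    ∃ T : Matrix d d ℂ, T.IsHermitian ∧ T * T = T ∧
      σ.P x * (1 - (T * σ.st x).trace.re) ≤
        C ^ (-s) * (σ.P x * (mpow (σ.st x) (1 + s) * mpow σ.margQ (-s)).trace.re) ∧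
      ((((numEigenvalues σ.margQ : ℝ) * C : ℝ) : ℂ) • 1
        - mpow σ.margQ (-(1 / 2)) * (T * σ.st x * T) * mpow σ.margQ (-(1 / 2))).PosSemidef ∧
      mpow σ.margQ (1 / 4) * mpow σ.margQ (-(1 / 4)) * T = T := by
  rcases (h.1 x).eq_or_lt with h0 | h0
  · refine ⟨0, Matrix.isHermitian_zero, by simp, by simp [← h0], ?_, by simp⟩
    simp only [Matrix.zero_mul, Matrix.mul_zero, sub_zero]
    exact posSemidef_ofReal_smul PosSemidef.one (by positivity)
  · obtain ⟨T, hT, hTT, h1, h2, h3⟩ := exists_truncation h.margQ_density.1 (h.2.2 x) h0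
      (h.margQ_sub_posSemidef x) hs hC
    refine ⟨T, hT, hTT, ?_, h2, h3⟩
    have := mul_le_mul_of_nonneg_left h1 h0.le
    linarith

/-- One-shot resolvability with a random codebook. -/
lemma CQ.IsState.resolvability {σ : CQ X d} (h : σ.IsState) {s C : ℝ} (hs : 0 < s) (hC : 0 < C)
    {I : Type*} [Fintype I] [DecidableEq I] [Nonempty I] :
    ∑ c : I → X, bookProb σ.P c *
        traceNorm (((1 / (Fintype.card I : ℝ) : ℝ) : ℂ) • ∑ i, σ.st (c i) - σ.margQ) ≤
      4 * √(C ^ (-s) *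
        ∑ x, σ.P x * (mpow (σ.st x) (1 + s) * mpow σ.margQ (-s)).trace.re)
      + √((numEigenvalues σ.margQ : ℝ) * C / Fintype.card I) := by
  have hτ := h.margQ_density
  choose T hT hTT hmass hdom hsupp using h.exists_truncations hs hC
  obtain ⟨h0, h1, h2⟩ := h
  set τ := σ.margQ with hτdef
  set q := mpow τ (1 / 4) with hq
  set q' := mpow τ (-(1 / 4)) with hq'
  set ν : ℝ := (numEigenvalues τ : ℝ) with hν
  set N : ℝ := (Fintype.card I : ℝ) with hN
  have hN0 : 0 < N := by rw [hN]; exact_mod_cast Fintype.card_pos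
  have hqh : qᴴ = q := (mpow_posSemidef hτ.1 _).isHermitian.eq
  have hq'h : q'ᴴ = q' := (mpow_posSemidef hτ.1 _).isHermitian.eq
  have hqq' : q * q' = q' * q := by
    obtain ⟨U, l, hU, hU', hl⟩ := exists_diagonalization hτ.1.isHermitian
    rw [hq, hq', hl, mpow_conj_diagonal hU hU', mpow_conj_diagonal hU hU', conj_diagonal_mul hU,
      conj_diagonal_mul hU]
    congr 3; ext i; ring
  have hsupp' x : T x * q' * q = T x := by
    have := congrArg conjTranspose (hsupp x)
    rw [conjTranspose_mul, conjTranspose_mul, (hT x).eq, hqh, hq'h] at this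
    rw [Matrix.mul_assoc]; exact this
  let ρ' : X → Matrix d d ℂ := fun x => T x * σ.st x * T x
  -- With `τ^{-1/4}` on each side, the sandwich bound turns the trace norm of a fluctuation into a
  -- Hilbert–Schmidt norm, whose second moment can be computed.
  let W : X → Matrix d d ℂ := fun x => q' * ρ' x * q'
  have hρ'p x : (ρ' x).PosSemidef := by
    have := (h2 x).1.mul_mul_conjTranspose_same (T x)
    rwa [(hT x).eq] at this
  have hWh x : (W x).IsHermitian := by
    have := ((hρ'p x).mul_mul_conjTranspose_same q').isHermitian
    rwa [hq'h] at this
  have hqWq x : q * W x * q = ρ' x := by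
    calc q * W x * q = (q * q' * T x) * σ.st x * (T x * q' * q) := by
          simp only [W, ρ', Matrix.mul_assoc]
      _ = _ := by rw [hsupp, hsupp']
  have hT1 x : (1 - T x).PosSemidef := posSemidef_of_projection (isHermitian_one_sub (hT x))
    (one_sub_mul_one_sub (hTT x))
  have hTp x : (T x).PosSemidef := posSemidef_of_projection (hT x) (hTT x)
  have hTle x : (T x * σ.st x).trace.re ≤ 1 := by
    have := re_trace_le_of_contraction (hT1 x) (h2 x).1
    rwa [(h2 x).trace_re] at this
  -- By cyclicity the trace is `tr (τ^{-1/2} ρ' τ^{-1/2} ρ')`; the first three factors are at most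
  -- `νC`, and `tr ρ' ≤ 1`.
  have hWW x : (W x * W x).trace.re ≤ ν * C := by
    have e : (W x * W x).trace
        = (mpow τ (-(1 / 2)) * ρ' x * mpow τ (-(1 / 2)) * ρ' x).trace := by
      rw [← mpow_neg_quarter_mul_self hτ.1]
      have := Matrix.trace_mul_comm (q' * ρ' x * q' * q' * ρ' x) q'
      simpa only [W, Matrix.mul_assoc] using this
    rw [e]
    refine (re_trace_mul_mono (hdom x) (hρ'p x)).trans ?_
    rw [Matrix.smul_mul, Matrix.one_mul, re_trace_ofReal_smul]
    have : (ρ' x).trace.re ≤ 1 := by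
      have : (ρ' x).trace = (T x * σ.st x).trace := by
        simp only [ρ']
        rw [Matrix.trace_mul_comm, ← Matrix.mul_assoc, hTT]
      rw [this]; exact hTle x
    exact mul_le_of_le_one_right (by positivity) this
  set Wb : Matrix d d ℂ := ∑ x, (σ.P x : ℂ) • W x with hWb
  have hWbh : Wb.IsHermitian := isHermitian_sum _ fun x _ => isHermitian_ofReal_smul (hWh x) _
  let F : X → X → ℝ := fun x y => ((W x - Wb) * (W y - Wb)).trace.re
  have hcent : ∑ x, (σ.P x : ℂ) • (W x - Wb) = 0 := by
    simp only [smul_sub, Finset.sum_sub_distrib, ← Finset.sum_smul, ← hWb]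
    rw [← Complex.ofReal_sum, h1]; simp
  have hF0 : ∑ x, ∑ y, σ.P x * σ.P y * F x y = 0 := by
    have e : ((∑ x, (σ.P x : ℂ) • (W x - Wb)) * ∑ y, (σ.P y : ℂ) • (W y - Wb)).trace.re
        = ∑ x, ∑ y, σ.P x * σ.P y * F x y := by
      simp only [Finset.sum_mul, Finset.mul_sum, Matrix.trace_sum, Complex.re_sum]
      rw [Finset.sum_comm]
      refine Finset.sum_congr rfl fun x _ => Finset.sum_congr rfl fun y _ => ?_
      rw [Matrix.smul_mul, Matrix.mul_smul, re_trace_ofReal_smul, re_trace_ofReal_smul]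
      ring
    rw [← e, hcent]; simp
  have hFd : ∑ x, σ.P x * F x x ≤ ν * C := by
    have e x : σ.P x * F x x = σ.P x * (W x * W x).trace.re - ((((σ.P x : ℂ) • W x) * Wb).trace.re
        + (Wb * ((σ.P x : ℂ) • W x)).trace.re) + σ.P x * (Wb * Wb).trace.re := by
      simp only [F, Matrix.smul_mul, Matrix.mul_smul, re_trace_ofReal_smul, Matrix.sub_mul,
        Matrix.mul_sub, Matrix.trace_sub, Complex.sub_re]
      ring
    simp only [e, Finset.sum_add_distrib, Finset.sum_sub_distrib, ← Finset.sum_mul, h1, one_mul]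
    have e1 : ∑ x, (((σ.P x : ℂ) • W x) * Wb).trace.re = (Wb * Wb).trace.re := by
      rw [← Complex.re_sum, ← Matrix.trace_sum, ← Finset.sum_mul]
    have e2 : ∑ x, (Wb * ((σ.P x : ℂ) • W x)).trace.re = (Wb * Wb).trace.re := by
      rw [← Complex.re_sum, ← Matrix.trace_sum, ← Finset.mul_sum]
    rw [e1, e2]
    have h3 : ∑ x, σ.P x * (W x * W x).trace.re ≤ ∑ x, σ.P x * (ν * C) :=
      Finset.sum_le_sum fun x _ => mul_le_mul_of_nonneg_left (hWW x) (h0 x)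
    rw [← Finset.sum_mul, h1, one_mul] at h3
    linarith [re_trace_mul_self_nonneg hWbh]
  let g : X → ℝ := fun x => 2 * √(1 - (T x * σ.st x).trace.re)
  let Hc : (I → X) → Matrix d d ℂ := fun c => ∑ i, (W (c i) - Wb)
  have hHch c : (Hc c).IsHermitian := isHermitian_sum _ fun i _ => (hWh _).sub hWbh
  have hHc c : (Hc c * Hc c).trace.re = ∑ i, ∑ j, F (c i) (c j) := by
    simp only [Hc, F, Finset.sum_mul, Finset.mul_sum, Matrix.trace_sum, Complex.re_sum]
    exact Finset.sum_comm
  -- For one codebook the deviation has three parts: the truncation error of the codewords, the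
  -- fluctuation of the truncated average, and the truncation error of the mean state. Averaged over
  -- codebooks, the first and third each give `2√(…)`.
  have hbound (c : I → X) :
      traceNorm (((1 / N : ℝ) : ℂ) • ∑ i, σ.st (c i) - τ) ≤
        (1 / N) * ∑ i, g (c i) + (1 / N) * √(∑ i, ∑ j, F (c i) (c j)) + ∑ x, σ.P x * g x := by
    have hZh : (((1 / N : ℝ) : ℂ) • ∑ i, σ.st (c i) - τ).IsHermitian :=
      (isHermitian_ofReal_smul (isHermitian_sum _ fun i _ => (h2 _).1.isHermitian) _).sub
        hτ.1.isHermitian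
    obtain ⟨S, hS, hSS, hSeq⟩ := exists_traceNorm_eq hZh
    rw [hSeq]
    have hqWb : q * Wb * q = ∑ x, (σ.P x : ℂ) • ρ' x := by
      rw [hWb, Finset.mul_sum, Finset.sum_mul]
      refine Finset.sum_congr rfl fun x _ => ?_
      rw [Matrix.mul_smul, Matrix.smul_mul, hqWq]
    have hqHq : q * Hc c * q = ∑ i, (ρ' (c i) - ∑ x, (σ.P x : ℂ) • ρ' x) := by
      simp only [Hc, Finset.mul_sum, Finset.sum_mul]
      refine Finset.sum_congr rfl fun i _ => ?_
      rw [Matrix.mul_sub, Matrix.sub_mul, hqWb, hqWq]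
    have hdec : ((1 / N : ℝ) : ℂ) • ∑ i, σ.st (c i) - τ
        = ((1 / N : ℝ) : ℂ) • ∑ i, (σ.st (c i) - ρ' (c i)) + ((1 / N : ℝ) : ℂ) • (q * Hc c * q)
          - ∑ x, (σ.P x : ℂ) • (σ.st x - ρ' x) := by
      have hNN : ((1 / N : ℝ) : ℂ) • ∑ _i : I, ∑ x, (σ.P x : ℂ) • ρ' x
          = ∑ x, (σ.P x : ℂ) • ρ' x := by
        rw [Finset.sum_const, Finset.card_univ, ← Nat.cast_smul_eq_nsmul ℂ, smul_smul]
        have : ((1 / N : ℝ) : ℂ) * (Fintype.card I : ℂ) = 1 := by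
          rw [show (Fintype.card I : ℂ) = ((N : ℝ) : ℂ) by simp [hN], ← Complex.ofReal_mul,
            one_div_mul_cancel hN0.ne', Complex.ofReal_one]
        rw [this, one_smul]
      rw [hqHq]
      simp only [Finset.sum_sub_distrib, smul_sub]
      rw [hNN, hτdef, CQ.margQ]
      abel
    have hH1 : (1 - S * S).PosSemidef := by rw [hSS, sub_self]; exact PosSemidef.zero
    have hg x : |(S * (σ.st x - ρ' x)).trace.re| ≤ g x := by
      have := norm_trace_mul_sub_conj_le (h2 x) hS hH1 (hTp x) (hT1 x)
      rw [hTT] at this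
      exact (Complex.abs_re_le_norm _).trans this
    have hsand := re_trace_involution_sandwich_le hτ hS hSS (hHch c)
    rw [hHc] at hsand
    have hN1 : 0 ≤ 1 / N := by positivity
    rw [hdec, Matrix.mul_sub, Matrix.mul_add, Matrix.trace_sub, Matrix.trace_add, Complex.sub_re,
      Complex.add_re, Matrix.mul_smul, Matrix.mul_smul, re_trace_ofReal_smul,
      re_trace_ofReal_smul]
    have b1 : (S * ∑ i, (σ.st (c i) - ρ' (c i))).trace.re ≤ ∑ i, g (c i) := by
      rw [Finset.mul_sum, Matrix.trace_sum, Complex.re_sum]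
      exact Finset.sum_le_sum fun i _ => (le_abs_self _).trans (hg _)
    have b2 : -(S * ∑ x, (σ.P x : ℂ) • (σ.st x - ρ' x)).trace.re ≤ ∑ x, σ.P x * g x := by
      rw [Finset.mul_sum, Matrix.trace_sum, Complex.re_sum, ← Finset.sum_neg_distrib]
      refine Finset.sum_le_sum fun x _ => ?_
      rw [Matrix.mul_smul, re_trace_ofReal_smul, ← mul_neg]
      exact mul_le_mul_of_nonneg_left ((neg_le_abs _).trans (hg _)) (h0 x)
    have b3 := mul_le_mul_of_nonneg_left b1 hN1
    have b4 := mul_le_mul_of_nonneg_left hsand hN1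
    linarith
  have hbp c : 0 ≤ bookProb σ.P c := bookProb_nonneg (I := I) h0 c
  have hPg : ∑ x, σ.P x * g x ≤ 2 * √(C ^ (-s) *
      ∑ x, σ.P x * (mpow (σ.st x) (1 + s) * mpow τ (-s)).trace.re) := by
    have e : ∑ x, σ.P x * g x = 2 * ∑ x, σ.P x * √(1 - (T x * σ.st x).trace.re) := by
      rw [Finset.mul_sum]; exact Finset.sum_congr rfl fun x _ => by simp only [g]; ring
    rw [e]
    refine mul_le_mul_of_nonneg_left ?_ (by norm_num)
    refine (sum_mul_sqrt_le h0 h1 fun x => by linarith [hTle x]).trans (Real.sqrt_le_sqrt ?_)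
    rw [Finset.mul_sum]
    exact Finset.sum_le_sum fun x _ => hmass x
  have hE1 : ∑ c : I → X, bookProb σ.P c * ((1 / N) * ∑ i, g (c i)) = ∑ x, σ.P x * g x := by
    have e (c : I → X) : bookProb σ.P c * ((1 / N) * ∑ i, g (c i))
        = (1 / N) * ∑ i, bookProb σ.P c * g (c i) := by
      rw [Finset.mul_sum, Finset.mul_sum, Finset.mul_sum]
      exact Finset.sum_congr rfl fun i _ => by ring
    simp only [e]
    rw [← Finset.mul_sum, Finset.sum_comm]
    simp only [sum_bookProb_mul h1]
    rw [Finset.sum_const, Finset.card_univ, nsmul_eq_mul, ← mul_assoc,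
      one_div_mul_cancel hN0.ne', one_mul]
  have hE2 : ∑ c : I → X, bookProb σ.P c * ((1 / N) * √(∑ i, ∑ j, F (c i) (c j)))
      ≤ √(ν * C / N) := by
    have e (c : I → X) : bookProb σ.P c * ((1 / N) * √(∑ i, ∑ j, F (c i) (c j)))
        = (1 / N) * (bookProb σ.P c * √(∑ i, ∑ j, F (c i) (c j))) := by ring
    simp only [e]
    rw [← Finset.mul_sum]
    have hj := sum_mul_sqrt_le hbp (sum_bookProb h1)
      (f := fun c : I → X => ∑ i, ∑ j, F (c i) (c j))
      (fun c => by rw [← hHc]; exact re_trace_mul_self_nonneg (hHch c))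
    rw [sum_bookProb_quadratic h1 F hF0] at hj
    have h3 : √(N * ∑ x, σ.P x * F x x) ≤ √(N * (ν * C)) :=
      Real.sqrt_le_sqrt (mul_le_mul_of_nonneg_left hFd hN0.le)
    calc _ ≤ (1 / N) * √(N * (ν * C)) :=
          mul_le_mul_of_nonneg_left (hj.trans h3) (by positivity)
      _ = √(ν * C / N) := by
        rw [show (1 / N) = √((1 / N) ^ 2) from (Real.sqrt_sq (by positivity)).symm,
          ← Real.sqrt_mul (sq_nonneg _)]
        congr 1
        field_simp
  calc _ ≤ ∑ c : I → X, bookProb σ.P c * ((1 / N) * ∑ i, g (c i)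
        + (1 / N) * √(∑ i, ∑ j, F (c i) (c j)) + ∑ x, σ.P x * g x) :=
        Finset.sum_le_sum fun c _ => mul_le_mul_of_nonneg_left (hbound c) (hbp c)
    _ = ∑ c : I → X, bookProb σ.P c * ((1 / N) * ∑ i, g (c i))
        + ∑ c : I → X, bookProb σ.P c * ((1 / N) * √(∑ i, ∑ j, F (c i) (c j)))
        + ∑ x, σ.P x * g x := by
        simp only [mul_add, Finset.sum_add_distrib, ← Finset.sum_mul, sum_bookProb h1, one_mul]
    _ ≤ _ := by
        rw [hE1]
        linarith

lemma numEigenvalues_pos {τ : Matrix d d ℂ} (hτ : IsDensity τ) : 0 < numEigenvalues τ := by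
  obtain ⟨U, l, hU, hU', hl⟩ := exists_diagonalization hτ.1.isHermitian
  have : Nonempty d := by
    by_contra hd
    rw [not_nonempty_iff] at hd
    have := hτ.2
    simp [Matrix.trace] at this
  rw [hl, numEigenvalues_conj_diagonal hU hU', Finset.card_pos]
  exact Finset.univ_nonempty.image _

/-- Resolvability in terms of the rate. -/
lemma CQ.IsState.resolvability_of_rate_le {σ : CQ X d} (h : σ.IsState) {ξ : ℝ} (hξ : 0 < ξ)
    {I : Type*} [Fintype I] [DecidableEq I] [Nonempty I]
    (hle : resolvabilityRate ξ σ ≤ ((Real.logb 2 (Fintype.card I : ℝ) : ℝ) : EReal)) :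
    ∑ c : I → X, bookProb σ.P c *
        traceNorm (((1 / (Fintype.card I : ℝ) : ℝ) : ℂ) • ∑ i, σ.st (c i) - σ.margQ) ≤
      ξ / 2 := by
  set N : ℝ := (Fintype.card I : ℝ) with hN
  have hN0 : 0 < N := by rw [hN]; exact_mod_cast Fintype.card_pos
  have hlt : resolvabilityRate ξ σ < ((Real.logb 2 N + 1 : ℝ) : EReal) :=
    lt_of_le_of_lt hle (by exact_mod_cast (by linarith))
  rw [resolvabilityRate] at hlt
  simp only [iInf_lt_iff] at hlt
  obtain ⟨a, ha, hlt⟩ := hlt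
  rw [EReal.coe_lt_coe_iff] at hlt
  have ha : a < 0 := ha
  obtain ⟨s, rfl⟩ : ∃ s, a = -s := ⟨-a, by ring⟩
  have hs : 0 < s := by linarith
  have hν : (0 : ℝ) < (numEigenvalues σ.margQ : ℝ) := by
    exact_mod_cast numEigenvalues_pos h.margQ_density
  rw [mutualInfoR] at hlt
  have hη : 0 < ξ / 12 := by positivity
  -- With `η = ξ/12`, this `C` makes `νC/N = 2η²`, and its factor 2 cancels the bit given up in
  -- `hlt`, so that `C^{-s} R ≤ η²`. The total is at most `4η + 2η = ξ/2`.
  have hmain := h.resolvability (I := I) hs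
    (C := 2 * (ξ / 12) ^ 2 * N / (numEigenvalues σ.margQ : ℝ)) (by positivity)
  set ν : ℝ := (numEigenvalues σ.margQ : ℝ) with hνdef
  set C := 2 * (ξ / 12) ^ 2 * N / ν with hC
  have hC0 : 0 < C := by positivity
  rw [show (1 : ℝ) - -s = 1 + s by ring] at hlt
  set R := ∑ x, σ.P x * (mpow (σ.st x) (1 + s) * mpow σ.margQ (-s)).trace.re with hR
  have hCR : C ^ (-s) * R ≤ (ξ / 12) ^ 2 := by
    rcases le_or_gt R 0 with hR0 | hR0
    · exact (mul_nonpos_of_nonneg_of_nonpos (Real.rpow_nonneg hC0.le _) hR0).trans (sq_nonneg _)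
    rw [← Real.logb_le_logb (b := 2) (by norm_num) (by positivity) (by positivity),
      Real.logb_mul (by positivity) hR0.ne', Real.logb_rpow_eq_mul_logb_of_pos hC0, Real.logb_pow]
    have hlC : Real.logb 2 C = 1 + 2 * Real.logb 2 (ξ / 12) + Real.logb 2 N - Real.logb 2 ν := by
      rw [hC, Real.logb_div (by positivity) hν.ne', Real.logb_mul (by positivity) hN0.ne',
        Real.logb_mul (by norm_num) (by positivity), Real.logb_pow,
        Real.logb_self_eq_one (by norm_num)]
      push_cast
      ring
    have h12 : Real.logb 2 (12 / ξ) = - Real.logb 2 (ξ / 12) := by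
      rw [← Real.logb_inv, inv_div]
    rw [h12] at hlt
    have hm := mul_lt_mul_of_pos_left hlt hs
    have e : s * (-(1 / -s) * Real.logb 2 R + Real.logb 2 ν + (2 - 2 / -s) * -Real.logb 2 (ξ / 12))
        = Real.logb 2 R + s * Real.logb 2 ν - (2 * s + 2) * Real.logb 2 (ξ / 12) := by
      field_simp
      ring
    rw [e] at hm
    rw [hlC]
    push_cast
    nlinarith
  have h1 : √(C ^ (-s) * R) ≤ ξ / 12 := by
    rw [Real.sqrt_le_left hη.le]; exact hCR
  have h2 : √(ν * C / N) ≤ 2 * (ξ / 12) := by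
    rw [Real.sqrt_le_left (by positivity)]
    have : ν * C / N = 2 * (ξ / 12) ^ 2 := by rw [hC]; field_simp
    rw [this]
    nlinarith [sq_nonneg (ξ / 12)]
  linarith

end

/-! ### Random coding -/

section

variable {d X : Type*} [Fintype d] [DecidableEq d] [Fintype X] [DecidableEq X]

/-- Random coding: a codebook that is good for decoding and for resolvability simultaneously. -/
lemma CQ.IsState.exists_codebook {σ : CQ X d} (h : σ.IsState) {ζ ξ : ℝ} (hζ : 0 < ζ)
    (hζ1 : ζ ≤ 1) (hξ : 0 < ξ) {κ J : Type} [Fintype κ] [DecidableEq κ] [Nonempty κ]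
    [Fintype J] [DecidableEq J] [Nonempty J]
    (hJ : ((Real.logb 2 (Fintype.card J : ℝ) : ℝ) : EReal) ≤ noisyRate ζ σ)
    (hκJ : resolvabilityRate ξ σ ≤ ((Real.logb 2 (Fintype.card (κ × J) : ℝ) : ℝ) : EReal)) :
    ∃ (c : κ × J → X) (D : κ → J → Matrix d d ℂ), (∀ k, IsPOVM (D k)) ∧
      (1 / (Fintype.card (κ × J) : ℝ)) *
        ∑ p : κ × J, (1 - (D p.1 p.2 * σ.st (c p)).trace.re) ≤ ζ ∧
      traceNorm (((1 / (Fintype.card (κ × J) : ℝ) : ℝ) : ℂ) • ∑ p, σ.st (c p) - σ.margQ) ≤ ξ := by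
  have hJ0 : (0 : ℝ) < (Fintype.card J : ℝ) := by exact_mod_cast Fintype.card_pos
  obtain ⟨T, hT, hTT, hTsum⟩ := h.exists_tests_of_le_noisyRate hζ hJ0 hJ
  have hres := h.resolvability_of_rate_le hξ hκJ
  have hτ := h.margQ_density
  obtain ⟨h0, h1, h2⟩ := h
  choose D hD hDerr using fun (c : κ × J → X) (k : κ) =>
    exists_sequential_povm (T := fun j => T (c (k, j))) (fun j => hT _) (fun j => hTT _)
  set n : ℝ := (Fintype.card (κ × J) : ℝ) with hn
  have hn0 : 0 < n := by rw [hn]; exact_mod_cast Fintype.card_pos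
  let t : (κ × J → X) → ℝ := fun c => traceNorm (((1 / n : ℝ) : ℂ) • ∑ p, σ.st (c p) - σ.margQ)
  let f : X → ℝ := fun x => ((1 - T x) * σ.st x).trace.re
  let F : X → X → ℝ := fun y x => (T y * σ.st x).trace.re
  -- This upper bound on the decoding error replaces the error itself because it involves at most
  -- two codewords at a time. Only codewords with the same key compete.
  let e : (κ × J → X) → ℝ := fun c => (1 / n) * ∑ p : κ × J,
    4 * (f (c p) + ∑ j ∈ Finset.univ.erase p.2, F (c (p.1, j)) (c p))
  have hTp x : (T x).PosSemidef := posSemidef_of_projection (hT x) (hTT x)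
  have hF0 y x : 0 ≤ F y x := re_trace_mul_nonneg (hTp y) (h2 x).1
  have hf0 x : 0 ≤ f x := re_trace_mul_nonneg (posSemidef_of_projection
    (isHermitian_one_sub (hT x)) (one_sub_mul_one_sub (hTT x))) (h2 x).1
  have he0 c : 0 ≤ e c := mul_nonneg (by positivity) <| Finset.sum_nonneg fun p _ =>
    mul_nonneg (by norm_num) (add_nonneg (hf0 _) (Finset.sum_nonneg fun j _ => hF0 _ _))
  have hbp c : 0 ≤ bookProb σ.P c := bookProb_nonneg (I := κ × J) h0 c
  have hFsum : ∑ y, ∑ x, σ.P y * σ.P x * F y x = ∑ y, σ.P y * (T y * σ.margQ).trace.re := by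
    refine Finset.sum_congr rfl fun y _ => ?_
    rw [CQ.margQ, Finset.mul_sum, Matrix.trace_sum, Complex.re_sum, Finset.mul_sum]
    refine Finset.sum_congr rfl fun x _ => ?_
    rw [Matrix.mul_smul, re_trace_ofReal_smul]
    ring
  have hTm : 0 ≤ ∑ y, σ.P y * (T y * σ.margQ).trace.re :=
    Finset.sum_nonneg fun y _ => mul_nonneg (h0 y) (re_trace_mul_nonneg (hTp y) hτ.1)
  have hEp (p : κ × J) : ∑ c : κ × J → X, bookProb σ.P c *
      (4 * (f (c p) + ∑ j ∈ Finset.univ.erase p.2, F (c (p.1, j)) (c p))) ≤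
      4 * (2 * (ζ / 12) ^ 2) := by
    have e1 (c : κ × J → X) : bookProb σ.P c *
        (4 * (f (c p) + ∑ j ∈ Finset.univ.erase p.2, F (c (p.1, j)) (c p)))
        = 4 * (bookProb σ.P c * f (c p) +
            ∑ j ∈ Finset.univ.erase p.2, bookProb σ.P c * F (c (p.1, j)) (c p)) := by
      rw [← Finset.mul_sum]; ring
    simp only [e1]
    rw [← Finset.mul_sum, Finset.sum_add_distrib, sum_bookProb_mul h1, Finset.sum_comm]
    have e2 : ∑ j ∈ Finset.univ.erase p.2, ∑ c : κ × J → X,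
        bookProb σ.P c * F (c (p.1, j)) (c p)
        = ∑ j ∈ Finset.univ.erase p.2, ∑ y, σ.P y * (T y * σ.margQ).trace.re := by
      refine Finset.sum_congr rfl fun j hj => ?_
      have hne : ((p.1, j) : κ × J) ≠ p := fun hp => (Finset.mem_erase.1 hj).1 (by rw [← hp])
      rw [sum_bookProb_pair h1 hne F, hFsum]
    rw [e2, Finset.sum_const, nsmul_eq_mul]
    have hcard : (((Finset.univ.erase p.2).card : ℕ) : ℝ) ≤ (Fintype.card J : ℝ) := by
      exact_mod_cast (Finset.card_le_univ _)
    have e3 : ∑ x, σ.P x * (((1 - T x) * σ.st x).trace.re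
        + (Fintype.card J : ℝ) * (T x * σ.margQ).trace.re)
        = ∑ x, σ.P x * f x + (Fintype.card J : ℝ) * ∑ y, σ.P y * (T y * σ.margQ).trace.re := by
      rw [Finset.mul_sum, ← Finset.sum_add_distrib]
      exact Finset.sum_congr rfl fun x _ => by simp only [f]; ring
    rw [e3] at hTsum
    have := mul_le_mul_of_nonneg_right hcard hTm
    linarith
  have hEe : ∑ c : κ × J → X, bookProb σ.P c * e c ≤ 8 * (ζ / 12) ^ 2 := by
    have e1 (c : κ × J → X) : bookProb σ.P c * e c = (1 / n) * ∑ p : κ × J, bookProb σ.P c *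
        (4 * (f (c p) + ∑ j ∈ Finset.univ.erase p.2, F (c (p.1, j)) (c p))) := by
      rw [← Finset.mul_sum]; simp only [e]; ring
    simp only [e1]
    rw [← Finset.mul_sum, Finset.sum_comm]
    have := Finset.sum_le_sum fun p (_ : p ∈ (Finset.univ : Finset (κ × J))) => hEp p
    rw [Finset.sum_const, Finset.card_univ, nsmul_eq_mul] at this
    have h3 := mul_le_mul_of_nonneg_left this (by positivity : 0 ≤ 1 / n)
    refine h3.trans_eq ?_
    rw [← hn]
    field_simp
    ring
  -- The mean of this sum is at most `8 (ζ/12)² / ζ + 1/2 ≤ 1/18 + 1/2 < 1`. Both terms are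
  -- nonnegative, so a codebook below 1 meets both targets.
  have hex : ∃ c : κ × J → X, e c / ζ + t c / ξ < 1 := by
    by_contra hcon
    push Not at hcon
    have h3 : ∑ c : κ × J → X, bookProb σ.P c * 1
        ≤ ∑ c : κ × J → X, bookProb σ.P c * (e c / ζ + t c / ξ) :=
      Finset.sum_le_sum fun c _ => mul_le_mul_of_nonneg_left (hcon c) (hbp c)
    have h4 : ∑ c : κ × J → X, bookProb σ.P c * (e c / ζ + t c / ξ)
        = (∑ c : κ × J → X, bookProb σ.P c * e c) / ζ
          + (∑ c : κ × J → X, bookProb σ.P c * t c) / ξ := by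
      rw [Finset.sum_div, Finset.sum_div, ← Finset.sum_add_distrib]
      exact Finset.sum_congr rfl fun c _ => by ring
    rw [h4] at h3
    simp only [mul_one, sum_bookProb h1] at h3
    have h5 : (∑ c : κ × J → X, bookProb σ.P c * e c) / ζ ≤ 1 / 18 := by
      rw [div_le_iff₀ hζ]; nlinarith
    have h6 : (∑ c : κ × J → X, bookProb σ.P c * t c) / ξ ≤ 1 / 2 := by
      rw [div_le_iff₀ hξ]; linarith
    linarith
  obtain ⟨c, hc⟩ := hex
  have ht0 : 0 ≤ t c := by
    have hZ : (((1 / n : ℝ) : ℂ) • ∑ p, σ.st (c p) - σ.margQ).IsHermitian :=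
      (isHermitian_ofReal_smul (isHermitian_sum _ fun i _ => (h2 _).1.isHermitian) _).sub
        hτ.1.isHermitian
    have := re_trace_mul_le_traceNorm hZ (S := 0) (by simpa using PosSemidef.one)
      (by simpa using PosSemidef.one)
    rwa [Matrix.zero_mul, Matrix.trace_zero, Complex.zero_re] at this
  refine ⟨c, D c, hD c, ?_, ?_⟩
  · have h3 : e c / ζ < 1 := by linarith [div_nonneg ht0 hξ.le]
    rw [div_lt_one hζ] at h3
    refine le_trans ?_ h3.le
    refine mul_le_mul_of_nonneg_left (Finset.sum_le_sum fun p _ => ?_) (by positivity)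
    exact hDerr c p.1 _ (h2 _) p.2
  · have h3 : t c / ξ < 1 := by linarith [div_nonneg (he0 c) hζ.le]
    rw [div_lt_one hξ] at h3
    exact h3.le

end

/-! ### Composition of codes -/

section

variable {a b : Type*} [Fintype a] [DecidableEq a] [Fintype b] [DecidableEq b]

lemma IsPOVM.one_sub_posSemidef {ι : Type*} [Fintype ι] [DecidableEq ι] {Λ : ι → Matrix b b ℂ}
    (h : IsPOVM Λ) (i : ι) : (1 - Λ i).PosSemidef := by
  rw [← h.2, ← Finset.add_sum_erase _ _ (Finset.mem_univ i), add_sub_cancel_left]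
  exact posSemidef_sum _ fun j _ => h.1 j

/-- Sequential decoding: first `Λ`, then `D w`. -/
lemma isPOVM_compose {M N : Type*} [Fintype M] [Fintype N] {Λ : M → Matrix b b ℂ}
    (hΛ : IsPOVM Λ) {D : M → N → Matrix b b ℂ} (hD : ∀ w, IsPOVM (D w)) :
    IsPOVM fun p : M × N => mpow (Λ p.1) (1 / 2) * D p.1 p.2 * mpow (Λ p.1) (1 / 2) := by
  refine ⟨fun p => ?_, ?_⟩
  · have := ((hD p.1).1 p.2).mul_mul_conjTranspose_same (mpow (Λ p.1) (1 / 2))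
    rwa [(mpow_posSemidef (hΛ.1 p.1) _).isHermitian.eq] at this
  · rw [Fintype.sum_prod_type, ← hΛ.2]
    refine Finset.sum_congr rfl fun w _ => ?_
    simp only [← Finset.sum_mul, ← Finset.mul_sum, (hD w).2, Matrix.mul_one]
    exact mpow_half_mul_self (hΛ.1 w)

/-- Gentle measurement with `K = Λ^{1/2}`, tested against `H = D`. -/
lemma compose_success_ge {Λ D ρ : Matrix b b ℂ} (hΛ : Λ.PosSemidef) (hΛ1 : (1 - Λ).PosSemidef)
    (hD : D.PosSemidef) (hD1 : (1 - D).PosSemidef) (hρ : IsDensity ρ) :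
    (D * ρ).trace.re - 2 * √(1 - (Λ * ρ).trace.re) ≤
      (mpow Λ (1 / 2) * D * mpow Λ (1 / 2) * ρ).trace.re := by
  have h := norm_trace_mul_sub_conj_le hρ hD.isHermitian (one_sub_mul_self_posSemidef hD hD1)
    (mpow_posSemidef hΛ (1 / 2)) (one_sub_mpow_half_posSemidef hΛ hΛ1)
  rw [mpow_half_mul_self hΛ, Matrix.mul_sub, Matrix.trace_sub] at h
  have h2 := (Complex.re_le_norm _).trans h
  rw [Complex.sub_re] at h2
  have e : (mpow Λ (1 / 2) * D * mpow Λ (1 / 2) * ρ).trace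
      = (D * (mpow Λ (1 / 2) * ρ * mpow Λ (1 / 2))).trace := by
    have := Matrix.trace_mul_comm (mpow Λ (1 / 2)) (D * mpow Λ (1 / 2) * ρ)
    simpa only [Matrix.mul_assoc] using this
  rw [e]
  linarith

/-- Joint code from an outer measurement `Λ` and inner keyed decoders `D`. -/
lemma exists_keyed_code {K M N : ℕ} (hK : 0 < K) (hM : 0 < M) (hN : 0 < N)
    (Φ : Matrix a a ℂ →ₗ[ℂ] Matrix b b ℂ) {Λ : Fin M → Matrix b b ℂ} (hΛ : IsPOVM Λ)
    {inp : Fin K → Fin M → Fin N → Matrix a a ℂ} (hinp : ∀ k w m, IsDensity (inp k w m))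
    (hout : ∀ k w m, IsDensity (Φ (inp k w m))) {D : Fin K → Fin M → Fin N → Matrix b b ℂ}
    (hD : ∀ k w, IsPOVM (D k w)) {ζ ε : ℝ}
    (hin : ∀ w, 1 - ζ ≤ (1 / ((K : ℝ) * N)) *
      ∑ k, ∑ m, (D k w m * Φ (inp k w m)).trace.re)
    (hcov : 1 - ε ≤ (1 / (M : ℝ)) * ∑ w, (1 / ((K : ℝ) * N)) *
      ∑ k, ∑ m, (Λ w * Φ (inp k w m)).trace.re) :
    ∃ stego : Fin K → CCCode (M * N) a b, IsKeyedCC stego Φ (ζ + 2 * √ε) ∧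
      keyedOutput stego Φ = ((1 / (M : ℝ) : ℝ) : ℂ) • ∑ w,
        ((1 / ((K : ℝ) * N) : ℝ) : ℂ) • ∑ k, ∑ m, Φ (inp k w m) := by
  have hK0 : (0 : ℝ) < K := by exact_mod_cast hK
  have hM0 : (0 : ℝ) < M := by exact_mod_cast hM
  have hN0 : (0 : ℝ) < N := by exact_mod_cast hN
  let φ : Fin M × Fin N ≃ Fin (M * N) := finProdFinEquiv
  let E : Fin K → Fin M × Fin N → Matrix b b ℂ := fun k p =>
    mpow (Λ p.1) (1 / 2) * D k p.1 p.2 * mpow (Λ p.1) (1 / 2)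
  have hE k : IsPOVM (E k) := isPOVM_compose hΛ fun w => hD k w
  refine ⟨fun k =>
    { enc := fun i => inp k (φ.symm i).1 (φ.symm i).2
      enc_density := fun i => hinp _ _ _
      dec := fun i => E k (φ.symm i)
      dec_povm := ⟨fun i => (hE k).1 _, by rw [Equiv.sum_comp φ.symm (E k)]; exact (hE k).2⟩ },
    ?_, ?_⟩
  · have hs k : ∑ i, (E k (φ.symm i) * Φ (inp k (φ.symm i).1 (φ.symm i).2)).trace.re
        = ∑ w, ∑ m, (E k (w, m) * Φ (inp k w m)).trace.re := by
      rw [Equiv.sum_comp φ.symm fun p => (E k p * Φ (inp k p.1 p.2)).trace.re,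
        Fintype.sum_prod_type]
    simp only [IsKeyedCC, CCCode.success, hs]
    have hlow k w m : (D k w m * Φ (inp k w m)).trace.re
        - 2 * √(1 - (Λ w * Φ (inp k w m)).trace.re) ≤ (E k (w, m) * Φ (inp k w m)).trace.re :=
      compose_success_ge (hΛ.1 w) (hΛ.one_sub_posSemidef w) ((hD k w).1 m)
        ((hD k w).one_sub_posSemidef m) (hout k w m)
    -- Uniform weight on triples (key, cover message, inner message). Jensen over all triples at
    -- once places the average error of `Λ` under a single root.
    let c : ℝ := 1 / (K * M * N)
    have hc0 : 0 ≤ c := by positivity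
    let g : Fin K × Fin M × Fin N → ℝ := fun p => 1 - (Λ p.2.1 * Φ (inp p.1 p.2.1 p.2.2)).trace.re
    have hg0 p : 0 ≤ g p := by
      have := re_trace_le_of_contraction (hΛ.one_sub_posSemidef p.2.1) (hout p.1 p.2.1 p.2.2).1
      rw [(hout _ _ _).trace_re] at this
      simp only [g]; linarith
    have hc1 : ∑ _p : Fin K × Fin M × Fin N, c = 1 := by
      simp only [c, Finset.sum_const, Finset.card_univ, Fintype.card_prod, Fintype.card_fin,
        nsmul_eq_mul]
      push_cast
      field_simp
    have hjen := sum_mul_sqrt_le (w := fun _ : Fin K × Fin M × Fin N => c) (fun _ => hc0) hc1 hg0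
    have hcg : ∑ p, c * g p ≤ ε := by
      have e1 : ∑ p, c * g p = ∑ _p : Fin K × Fin M × Fin N, c
          - c * ∑ w, ∑ k, ∑ m, (Λ w * Φ (inp k w m)).trace.re := by
        simp only [g, mul_sub, mul_one, Finset.sum_sub_distrib]
        congr 1
        rw [← Finset.mul_sum, Fintype.sum_prod_type]
        simp only [Fintype.sum_prod_type]
        rw [Finset.sum_comm]
      have e2 : (1 / (M : ℝ)) * ∑ w, (1 / ((K : ℝ) * N)) *
          ∑ k, ∑ m, (Λ w * Φ (inp k w m)).trace.re
          = c * ∑ w, ∑ k, ∑ m, (Λ w * Φ (inp k w m)).trace.re := by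
        rw [← Finset.mul_sum, ← mul_assoc]; congr 1; simp only [c]; field_simp
      rw [e1, hc1]
      linarith
    have hD1 : 1 - ζ ≤ c * ∑ k, ∑ w, ∑ m, (D k w m * Φ (inp k w m)).trace.re := by
      have h3 := Finset.sum_le_sum fun w (_ : w ∈ (Finset.univ : Finset (Fin M))) => hin w
      rw [← Finset.mul_sum, Finset.sum_comm] at h3
      simp only [Finset.sum_const, Finset.card_univ, Fintype.card_fin, nsmul_eq_mul] at h3
      have h4 := mul_le_mul_of_nonneg_left h3 (by positivity : 0 ≤ 1 / (M : ℝ))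
      rw [← mul_assoc, one_div_mul_cancel hM0.ne', one_mul, ← mul_assoc] at h4
      refine h4.trans_eq ?_
      congr 1
      simp only [c]; field_simp
    have e3 : (1 / (K : ℝ)) * ∑ k, 1 / ((M * N : ℕ) : ℝ) *
        ∑ w, ∑ m, (E k (w, m) * Φ (inp k w m)).trace.re
        = c * ∑ k, ∑ w, ∑ m, (E k (w, m) * Φ (inp k w m)).trace.re := by
      rw [← Finset.mul_sum, ← mul_assoc]
      congr 1
      simp only [c]
      push_cast
      field_simp
    rw [e3]
    have h5 : ∑ k, ∑ w, ∑ m, ((D k w m * Φ (inp k w m)).trace.re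
        - 2 * √(1 - (Λ w * Φ (inp k w m)).trace.re))
        ≤ ∑ k, ∑ w, ∑ m, (E k (w, m) * Φ (inp k w m)).trace.re :=
      Finset.sum_le_sum fun k _ => Finset.sum_le_sum fun w _ => Finset.sum_le_sum fun m _ =>
        hlow k w m
    have h6 := mul_le_mul_of_nonneg_left h5 hc0
    have e4 : c * ∑ k, ∑ w, ∑ m, ((D k w m * Φ (inp k w m)).trace.re
        - 2 * √(1 - (Λ w * Φ (inp k w m)).trace.re))
        = c * ∑ k, ∑ w, ∑ m, (D k w m * Φ (inp k w m)).trace.re - 2 * ∑ p, c * √(g p) := by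
      rw [← Finset.mul_sum, Fintype.sum_prod_type]
      simp only [Fintype.sum_prod_type, Finset.sum_sub_distrib, ← Finset.mul_sum, g]
      ring
    rw [e4] at h6
    have h7 := Real.sqrt_le_sqrt hcg
    linarith
  · have hs k : ∑ i, Φ (inp k (φ.symm i).1 (φ.symm i).2) = ∑ w, ∑ m, Φ (inp k w m) := by
      rw [Equiv.sum_comp φ.symm fun p => Φ (inp k p.1 p.2), Fintype.sum_prod_type]
    simp only [keyedOutput, CCCode.output, hs]
    rw [← Finset.smul_sum, ← Finset.smul_sum, smul_smul, smul_smul, Finset.sum_comm]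
    congr 1
    push_cast
    field_simp

/-- Convexity of the norm: the involution `S` that is optimal for the average is admissible for each
term. -/
lemma traceNorm_average_le {M : ℕ} (hM : 0 < M) {Z : Fin M → Matrix b b ℂ}
    (hZ : ∀ w, (Z w).IsHermitian) {ξ : ℝ} (h : ∀ w, traceNorm (Z w) ≤ ξ) :
    traceNorm (((1 / (M : ℝ) : ℝ) : ℂ) • ∑ w, Z w) ≤ ξ := by
  obtain ⟨S, hS, hSS, hSeq⟩ :=
    exists_traceNorm_eq (isHermitian_ofReal_smul (isHermitian_sum Finset.univ fun w _ => hZ w)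
      (1 / (M : ℝ)))
  rw [hSeq, Matrix.mul_smul, re_trace_ofReal_smul, Finset.mul_sum, Matrix.trace_sum,
    Complex.re_sum]
  have h1 : ∑ w, (S * Z w).trace.re ≤ ∑ _w : Fin M, ξ :=
    Finset.sum_le_sum fun w _ => (re_trace_involution_le_traceNorm (hZ w) hS hSS).trans (h w)
  have hM0 : (0 : ℝ) < M := by exact_mod_cast hM
  rw [Finset.sum_const, Finset.card_univ, Fintype.card_fin, nsmul_eq_mul] at h1
  rw [one_div, inv_mul_le_iff₀ hM0]
  exact h1

end

/-! ### Tensor powers of channels, and quantization of distributions -/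

section

section tensor

variable {a b : Type*} [Fintype a] [DecidableEq a] [Fintype b] [DecidableEq b]

lemma prod_single_apply {n : ℕ} (k l i j : Fin n → a) :
    ∏ m, Matrix.single (k m) (l m) (1 : ℂ) (i m) (j m) = if k = i ∧ l = j then 1 else 0 := by
  split_ifs with h
  · obtain ⟨rfl, rfl⟩ := h
    simp
  · have : ∃ m, ¬ (k m = i m ∧ l m = j m) := by
      by_contra hcon
      push Not at hcon
      exact h ⟨funext fun m => (hcon m).1, funext fun m => (hcon m).2⟩
    obtain ⟨m, hm⟩ := this
    exact Finset.prod_eq_zero (Finset.mem_univ m) (by rw [Matrix.single_apply, if_neg hm])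

lemma tensorPow_id (n : ℕ) :
    tensorPow n (LinearMap.id : Matrix a a ℂ →ₗ[ℂ] Matrix a a ℂ) = LinearMap.id := by
  ext1 X
  ext i j
  simp only [tensorPow, LinearMap.coe_mk, AddHom.coe_mk, Matrix.of_apply, LinearMap.id_coe, id_eq,
    prod_single_apply]
  rw [Finset.sum_eq_single i (by intro k _ hk; simp [hk]) (by simp),
    Finset.sum_eq_single j (by intro l _ hl; simp [hl]) (by simp)]
  simp

/-- Choi decomposition of a completely positive map. -/
lemma exists_choi {Φ : Matrix a a ℂ →ₗ[ℂ] Matrix b b ℂ} (hΦ : IsChannel Φ) :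
    ∃ w : a → b → (Fin (Fintype.card a) × b) → ℂ, ∀ k l i j,
      Φ (Matrix.single k l 1) i j = ∑ r, w k i r * star (w l j r) := by
  let e := Fintype.equivFin a
  -- The unnormalized maximally entangled vector; the blocks of its projector are the matrix units,
  -- so the amplified map yields the Choi matrix.
  let ψ : Fin (Fintype.card a) × a → ℂ := fun x => if x.1 = e x.2 then 1 else 0
  have hC := hΦ.1 _ _ (Matrix.posSemidef_vecMulVec_self_star ψ)
  obtain ⟨V, hV⟩ := exists_eq_mul_conjTranspose hC
  refine ⟨fun k i r => V (e k, i) r, fun k l i j => ?_⟩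
  have h1 := congrFun (congrFun hV (e k, i)) (e l, j)
  rw [Matrix.mul_apply] at h1
  simp only [conjTranspose_apply] at h1
  rw [← h1]
  have h2 : Matrix.single k l (1 : ℂ)
      = Matrix.of fun p q => Matrix.vecMulVec ψ (star ψ) (e k, p) (e l, q) := by
    ext p q
    by_cases hk : k = p <;> by_cases hl : l = q <;>
      simp [Matrix.vecMulVec_apply, ψ, hk, hl]
  rw [h2]
  rfl

/-- Products of the Choi vectors of `Φ` over the tensor factors are Kraus operators `A r` for the
tensor power. -/
lemma IsChannel.tensorPow_posSemidef {Φ : Matrix a a ℂ →ₗ[ℂ] Matrix b b ℂ} (hΦ : IsChannel Φ)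
    (n : ℕ) {X : Matrix (Fin n → a) (Fin n → a) ℂ} (hX : X.PosSemidef) :
    (tensorPow n Φ X).PosSemidef := by
  obtain ⟨w, hw⟩ := exists_choi hΦ
  let A : (Fin n → Fin (Fintype.card a) × b) → Matrix (Fin n → b) (Fin n → a) ℂ :=
    fun r => Matrix.of fun i k => ∏ m, w (k m) (i m) (r m)
  have h : tensorPow n Φ X = ∑ r, A r * X * (A r)ᴴ := by
    ext i j
    simp only [tensorPow, LinearMap.coe_mk, AddHom.coe_mk, Matrix.of_apply, hw,
      Finset.prod_univ_sum, Fintype.piFinset_univ, Matrix.sum_apply, Matrix.mul_apply,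
      conjTranspose_apply, A, Finset.prod_mul_distrib, Finset.mul_sum, Finset.sum_mul]
    have e (k : Fin n → a) : ∑ l : Fin n → a, ∑ r : Fin n → Fin (Fintype.card a) × b,
        X k l * ((∏ m, w (k m) (i m) (r m)) * ∏ m, star (w (l m) (j m) (r m)))
        = ∑ r : Fin n → Fin (Fintype.card a) × b, ∑ l : Fin n → a,
        X k l * ((∏ m, w (k m) (i m) (r m)) * ∏ m, star (w (l m) (j m) (r m))) :=
      Finset.sum_comm
    simp only [e]
    rw [Finset.sum_comm]
    refine Finset.sum_congr rfl fun r _ => ?_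
    rw [Finset.sum_comm]
    refine Finset.sum_congr rfl fun l _ => Finset.sum_congr rfl fun k _ => ?_
    rw [star_prod]
    ring
  rw [h]
  exact posSemidef_sum _ fun r _ => hX.mul_mul_conjTranspose_same (A r)

lemma IsChannel.trace_tensorPow {Φ : Matrix a a ℂ →ₗ[ℂ] Matrix b b ℂ} (hΦ : IsChannel Φ)
    (n : ℕ) (X : Matrix (Fin n → a) (Fin n → a) ℂ) : (tensorPow n Φ X).trace = X.trace := by
  simp only [tensorPow, LinearMap.coe_mk, AddHom.coe_mk, Matrix.trace, Matrix.diag_apply,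
    Matrix.of_apply]
  have e (k l : Fin n → a) :
      ∑ i : Fin n → b, X k l * ∏ m, Φ (Matrix.single (k m) (l m) 1) (i m) (i m)
        = if k = l then X k l else 0 := by
    rw [← Finset.mul_sum]
    have h1 := Finset.prod_univ_sum (fun _ : Fin n => (Finset.univ : Finset b))
      (fun m i => Φ (Matrix.single (k m) (l m) 1) i i)
    rw [Fintype.piFinset_univ] at h1
    rw [← h1]
    have h2 (m : Fin n) : ∑ i, Φ (Matrix.single (k m) (l m) 1) i i
        = if k m = l m then 1 else 0 := by
      have h3 := hΦ.2 (Matrix.single (k m) (l m) 1)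
      rw [Matrix.trace] at h3
      simp only [Matrix.diag_apply] at h3
      rw [h3]
      split_ifs with hm
      · rw [hm]; simp
      · exact Matrix.trace_single_eq_of_ne _ _ _ hm
    simp only [h2]
    split_ifs with hkl
    · subst hkl; simp
    · obtain ⟨m, hm⟩ := Function.ne_iff.1 hkl
      rw [Finset.prod_eq_zero (Finset.mem_univ m) (if_neg hm), mul_zero]
  rw [Finset.sum_comm]
  refine Finset.sum_congr rfl fun k _ => ?_
  rw [Finset.sum_comm]
  simp only [e]
  simp

lemma IsChannel.tensorPow_density {Φ : Matrix a a ℂ →ₗ[ℂ] Matrix b b ℂ} (hΦ : IsChannel Φ)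
    (n : ℕ) {X : Matrix (Fin n → a) (Fin n → a) ℂ} (hX : IsDensity X) :
    IsDensity (tensorPow n Φ X) :=
  ⟨hΦ.tensorPow_posSemidef n hX.1, by rw [hΦ.trace_tensorPow, hX.2]⟩

end tensor

/-- Overlap of the intervals `[m, m+1]` and `[C i, C (i+1)]`. -/
def overlap (C : ℕ → ℝ) (m i : ℕ) : ℝ :=
  (min ((m : ℝ) + 1) (C (i + 1)) - min (m : ℝ) (C (i + 1)))
    - (min ((m : ℝ) + 1) (C i) - min (m : ℝ) (C i))

lemma overlap_nonneg {C : ℕ → ℝ} (hC : Monotone C) (m i : ℕ) : 0 ≤ overlap C m i := by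
  have h := hC (Nat.le_succ i)
  simp only [Nat.succ_eq_add_one] at h
  unfold overlap
  rcases le_total ((m : ℝ) + 1) (C (i + 1)) with h1 | h1 <;>
  rcases le_total (m : ℝ) (C (i + 1)) with h2 | h2 <;>
  rcases le_total ((m : ℝ) + 1) (C i) with h3 | h3 <;>
  rcases le_total (m : ℝ) (C i) with h4 | h4 <;>
  simp only [h1, h2, h3, h4, min_eq_left, min_eq_right] <;> linarith

/-- Cutting a distribution into `N` pieces of equal mass, and assigning every point to a piece
that carries most of it. -/
lemma exists_equal_mass_pieces {D N : ℕ} (hN : 0 < N) {C : ℕ → ℝ} (hC : Monotone C)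
    (hC0 : C 0 = 0) (hCD : C D = N) :
    (∀ m < N, ∑ i ∈ Finset.range D, overlap C m i = 1) ∧
    (∀ i < D, ∑ m ∈ Finset.range N, overlap C m i = C (i + 1) - C i) ∧
    ∃ g : ℕ → ℕ, (∀ i, g i < N) ∧ ∀ τ : ℝ, 0 ≤ τ →
      ∑ i ∈ Finset.range D, (C (i + 1) - C i - overlap C (g i) i) ≤
        ∑ i ∈ Finset.range D, (if τ < C (i + 1) - C i then C (i + 1) - C i else 0) + N * τ := by
  have hCnn i : 0 ≤ C i := hC0 ▸ hC (Nat.zero_le i)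
  refine ⟨fun m hm => ?_, fun i hi => ?_, ?_⟩
  · unfold overlap
    rw [Finset.sum_range_sub fun i => min ((m : ℝ) + 1) (C i) - min (m : ℝ) (C i), hC0, hCD]
    have h1 : (m : ℝ) + 1 ≤ N := by exact_mod_cast hm
    rw [min_eq_left h1, min_eq_left (by linarith), min_eq_right (by positivity),
      min_eq_right (by positivity)]
    ring
  · unfold overlap
    have hle (j : ℕ) (hj : j ≤ D) : ∑ m ∈ Finset.range N,
        (min ((m : ℝ) + 1) (C j) - min (m : ℝ) (C j)) = C j := by
      have := Finset.sum_range_sub (fun m : ℕ => min (m : ℝ) (C j)) N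
      push_cast at this
      rw [this, min_eq_right (hCD ▸ hC hj), min_eq_left (hCnn j), sub_zero]
    rw [Finset.sum_sub_distrib, hle _ hi, hle _ hi.le]
  · let g : ℕ → ℕ := fun i => min ⌊C i⌋₊ (N - 1)
    have hg i : g i < N := by simp only [g]; omega
    have hgC i : (g i : ℝ) ≤ C i :=
      (Nat.cast_le.2 (min_le_left _ _)).trans (Nat.floor_le (hCnn i))
    refine ⟨g, hg, fun τ hτ => ?_⟩
    -- The points reaching beyond their own interval. Every later point starts past the cut that is
    -- crossed, so `g` is injective on `B` and `|B| ≤ N`. A point of `B` of length at most `τ` loses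
    -- at most `τ`; longer points are charged in full.
    let B := (Finset.range D).filter fun i => (g i : ℝ) + 1 < C (i + 1)
    have hinj : Set.InjOn g B := by
      have key : ∀ i ∈ B, ∀ j ∈ B, i < j → g i ≠ g j := by
        intro i hi j hj hij heq
        simp only [B, Finset.mem_filter, Finset.mem_range] at hi hj
        have h1 : C (i + 1) ≤ C j := hC hij
        have h2 : (((g i + 1 : ℕ)) : ℝ) ≤ C j := by push_cast; linarith [hi.2]
        have h3 : g i + 1 ≤ ⌊C j⌋₊ := Nat.le_floor h2
        have h4 : g j = min ⌊C j⌋₊ (N - 1) := rfl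
        have h5 : g i + 1 = N := by omega
        have h6 : C (i + 1) ≤ N := hCD ▸ hC hi.1
        have h7 := hi.2
        rw [← h5] at h6
        push_cast at h6
        linarith
      intro i hi j hj heq
      rcases lt_trichotomy i j with h | h | h
      · exact absurd heq (key i hi j hj h)
      · exact h
      · exact absurd heq.symm (key j hj i hi h)
    have hB : B.card ≤ N := by
      rw [← Finset.card_image_of_injOn hinj]
      refine (Finset.card_le_card (t := Finset.range N) ?_).trans_eq (Finset.card_range N)
      intro k hk
      obtain ⟨i, _, rfl⟩ := Finset.mem_image.1 hk
      exact Finset.mem_range.2 (hg i)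
    have hterm : ∀ i ∈ Finset.range D, C (i + 1) - C i - overlap C (g i) i ≤
        (if τ < C (i + 1) - C i then C (i + 1) - C i else 0) +
          (if (g i : ℝ) + 1 < C (i + 1) then τ else 0) := by
      intro i _
      have h := hC (Nat.le_succ i)
      simp only [Nat.succ_eq_add_one] at h
      have hov := overlap_nonneg hC (g i) i
      split_ifs with h1 h2 h2
      · linarith
      · linarith
      · linarith
      · have : overlap C (g i) i = C (i + 1) - C i := by
          have h3 := hgC i
          have h4 := not_lt.1 h2
          unfold overlap
          rw [min_eq_right h4, min_eq_left (h3.trans h), min_eq_right (h.trans h4),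
            min_eq_left h3]
          ring
        linarith
    refine (Finset.sum_le_sum hterm).trans ?_
    rw [Finset.sum_add_distrib, ← Finset.sum_filter _ (fun _ => τ), Finset.sum_const,
      nsmul_eq_mul]
    have : (B.card : ℝ) * τ ≤ N * τ :=
      mul_le_mul_of_nonneg_right (by exact_mod_cast hB) hτ
    linarith

/-- Lays the masses `N p i` end to end in the order of an enumeration, so that `C` is their partial
sum, and transports the interval picture to `d`. -/
lemma exists_quantization {d : Type*} [Fintype d] {p : d → ℝ} (hp : ∀ i, 0 ≤ p i)
    (hp1 : ∑ i, p i = 1) {N : ℕ} (hN : 0 < N) :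
    ∃ (q : Fin N → d → ℝ) (g : d → Fin N), (∀ m i, 0 ≤ q m i) ∧ (∀ m, ∑ i, q m i = 1) ∧
      (∀ i, ∑ m, q m i = N * p i) ∧ ∀ τ : ℝ, 0 ≤ τ →
        ∑ i, (N * p i - q (g i) i) ≤ ∑ i, (if τ < N * p i then N * p i else 0) + N * τ := by
  let e := Fintype.equivFin d
  let D := Fintype.card d
  let w : ℕ → ℝ := fun k => if h : k < D then N * p (e.symm ⟨k, h⟩) else 0
  have hw k : 0 ≤ w k := by
    simp only [w]; split_ifs
    · exact mul_nonneg (Nat.cast_nonneg _) (hp _)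
    · exact le_rfl
  have hwe i : w (e i) = N * p i := by simp [w, D, (e i).2]
  let C : ℕ → ℝ := fun k => ∑ j ∈ Finset.range k, w j
  have hCs k : C (k + 1) - C k = w k := by simp [C, Finset.sum_range_succ]
  have hC : Monotone C := monotone_nat_of_le_succ fun k => by linarith [hCs k, hw k]
  have hsum (f : ℕ → ℝ) : ∑ k ∈ Finset.range D, f k = ∑ i, f (e i) := by
    rw [← Fin.sum_univ_eq_sum_range f, ← Equiv.sum_comp e]
  have hCD : C D = N := by
    change ∑ j ∈ Finset.range D, w j = N
    rw [hsum]
    simp only [hwe]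
    rw [← Finset.mul_sum, hp1, mul_one]
  obtain ⟨h1, h2, g, hg, h3⟩ := exists_equal_mass_pieces hN hC (by simp [C]) hCD
  refine ⟨fun m i => overlap C m (e i), fun i => ⟨g (e i), hg _⟩,
    fun m i => overlap_nonneg hC _ _, fun m => ?_, fun i => ?_, fun τ hτ => ?_⟩
  · rw [← hsum fun k => overlap C m k]
    exact h1 m m.2
  · rw [Fin.sum_univ_eq_sum_range (fun m => overlap C m (e i)), h2 _ (e i).2, hCs, hwe]
  · have := h3 τ hτ
    rw [hsum, hsum] at this
    simpa only [hCs, hwe] using this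

end

/-! ### Noiseless codes and merging of codewords -/

section

section noiseless

variable {d : Type*} [Fintype d] [DecidableEq d]

/-- Splitting a state into nearly perfectly distinguishable states of equal weight. -/
lemma exists_distinguishable_decomposition {ρ : Matrix d d ℂ} (hρ : IsDensity ρ) {N : ℕ}
    (hN : 0 < N) {ζ : ℝ} (hζ : 0 < ζ)
    (hle : ((Real.logb 2 (N : ℝ) : ℝ) : EReal) ≤ noiselessRate ζ ρ) :
    ∃ τ D : Fin N → Matrix d d ℂ, (∀ m, IsDensity (τ m)) ∧ IsPOVM D ∧
      ∑ m, τ m = (N : ℂ) • ρ ∧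
      1 - ζ ≤ (1 / (N : ℝ)) * ∑ m, (D m * τ m).trace.re := by
  have hN0 : (0 : ℝ) < N := by exact_mod_cast hN
  obtain ⟨U, p, hU, hU', hp⟩ := exists_diagonalization hρ.1.isHermitian
  have hp0 : ∀ i, 0 ≤ p i := conj_diagonal_nonneg hU (hp ▸ hρ.1)
  have hp1 : ∑ i, p i = 1 := by
    have := hρ.trace_re
    rw [hp, trace_conj_diagonal hU] at this
    simpa using this
  obtain ⟨q, g, hq0, hq1, hqp, hqτ⟩ := exists_quantization hp0 hp1 hN
  let τ : Fin N → Matrix d d ℂ := fun m => U * diagonal (fun i => (q m i : ℂ)) * Uᴴ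
  let D : Fin N → Matrix d d ℂ := fun m =>
    U * diagonal (fun i => ((if g i = m then 1 else 0 : ℝ) : ℂ)) * Uᴴ
  have hτ m : IsDensity (τ m) := by
    refine ⟨posSemidef_conj_diagonal U (hq0 m), ?_⟩
    simp only [τ]
    rw [trace_conj_diagonal hU, ← Complex.ofReal_sum, hq1, Complex.ofReal_one]
  have hsum (f : Fin N → d → ℂ) : ∑ m, U * diagonal (f m) * Uᴴ
      = U * diagonal (fun i => ∑ m, f m i) * Uᴴ := by
    rw [← Finset.sum_mul, ← Finset.mul_sum]
    congr 2
    ext i j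
    rw [Matrix.sum_apply]
    by_cases hij : i = j
    · subst hij; simp
    · simp [hij]
  have hDp m : (D m).PosSemidef := posSemidef_conj_diagonal U fun i => by split_ifs <;> norm_num
  have htr m : (D m * τ m).trace.re = ∑ i, if g i = m then q m i else 0 := by
    simp only [D, τ]
    rw [conj_diagonal_mul hU, trace_conj_diagonal hU, Complex.re_sum]
    refine Finset.sum_congr rfl fun i _ => ?_
    rw [← Complex.ofReal_mul, Complex.ofReal_re]
    split_ifs <;> simp
  refine ⟨τ, D, hτ, ⟨hDp, ?_⟩, ?_, ?_⟩
  · simp only [D]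
    rw [hsum, one_eq_conj_diagonal hU']
    congr 3
    ext i
    rw [← Complex.ofReal_sum]
    simp
  · simp only [τ]
    rw [hsum, hp, ← Matrix.smul_mul, ← Matrix.mul_smul, ← Matrix.diagonal_smul]
    congr 3
    ext i
    rw [← Complex.ofReal_sum, hqp]
    simp
  · rcases le_or_gt 1 ζ with hζ1 | hζ1
    · refine le_trans (by linarith : 1 - ζ ≤ 0) (mul_nonneg (by positivity) ?_)
      exact Finset.sum_nonneg fun m _ => re_trace_mul_nonneg (hDp m) (hτ m).1
    · have hlt : ((Real.logb 2 (N : ℝ) - 1 : ℝ) : EReal) < noiselessRate ζ ρ :=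
        lt_of_lt_of_le (by exact_mod_cast (by linarith)) hle
      rw [noiselessRate] at hlt
      simp only [lt_iSup_iff] at hlt
      obtain ⟨a, ⟨ha0, ha1⟩, hlt⟩ := hlt
      rw [EReal.coe_lt_coe_iff, renyiEntropy, hp, mpow_conj_diagonal hU hU',
        trace_conj_diagonal hU, ← Complex.ofReal_sum, Complex.ofReal_re] at hlt
      set S := ∑ i, p i ^ (a + 1) with hS
      have hδ : 0 < ζ / 2 := by positivity
      have hSN : (N : ℝ) ^ a * S ≤ 2 * (ζ / 2) ^ 4 := by
        rcases le_or_gt S 0 with hS0 | hS0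
        · exact (mul_nonpos_of_nonneg_of_nonpos (Real.rpow_nonneg hN0.le _) hS0).trans
            (by positivity)
        rw [← Real.logb_le_logb (b := 2) (by norm_num) (by positivity) (by positivity),
          Real.logb_mul (by positivity) hS0.ne', Real.logb_rpow_eq_mul_logb_of_pos hN0,
          Real.logb_mul (by norm_num) (by positivity), Real.logb_pow,
          Real.logb_self_eq_one (by norm_num)]
        have h2 : Real.logb 2 (2 / ζ) = - Real.logb 2 (ζ / 2) := by
          rw [← Real.logb_inv, inv_div]
        rw [h2] at hlt
        have hm := mul_lt_mul_of_pos_left hlt ha0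
        have e : a * (-(1 / a) * Real.logb 2 S - 4 / a * -Real.logb 2 (ζ / 2))
            = - Real.logb 2 S + 4 * Real.logb 2 (ζ / 2) := by
          field_simp
          ring
        rw [e] at hm
        push_cast
        linarith
      -- Markov's inequality: on these indices `1 ≤ (N p_i / (ζ/2))^a`, so the sum is at most `N
      -- (ζ/2)^{-a} N^a tr ρ^{1+a}`.
      have hbig : ∑ i, (if ζ / 2 < N * p i then N * p i else 0) ≤ N * (ζ / 2) := by
        have h3 : ∑ i, (if ζ / 2 < N * p i then N * p i else 0)
            ≤ N * ((ζ / 2) ^ (-a) * (N ^ a * S)) := by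
          rw [hS, Finset.mul_sum, Finset.mul_sum, Finset.mul_sum]
          refine Finset.sum_le_sum fun i _ => ?_
          split_ifs with hi
          · have hNp : 0 < N * p i := hδ.trans hi
            have hpi : 0 < p i := pos_of_mul_pos_right hNp hN0.le
            refine mul_le_mul_of_nonneg_left ?_ hN0.le
            have h4 : 1 ≤ (ζ / 2) ^ (-a) * (N * p i) ^ a := by
              rw [Real.rpow_neg hδ.le, ← div_eq_inv_mul, one_le_div (Real.rpow_pos_of_pos hδ _)]
              exact Real.rpow_le_rpow hδ.le hi.le ha0.le
            calc p i ≤ p i * ((ζ / 2) ^ (-a) * (N * p i) ^ a) := le_mul_of_one_le_right hpi.le h4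
              _ = _ := by
                rw [Real.mul_rpow hN0.le hpi.le, Real.rpow_add hpi, Real.rpow_one]; ring
          · have := hp0 i
            positivity
        have h5 : (ζ / 2) ^ (-a) * (N ^ a * S) ≤ ζ / 2 := by
          have h6 : (ζ / 2) ^ (-a) ≤ (ζ / 2)⁻¹ := by
            rw [← Real.rpow_neg_one]
            exact Real.rpow_le_rpow_of_exponent_ge hδ (by linarith) (by linarith)
          calc _ ≤ (ζ / 2) ^ (-a) * (2 * (ζ / 2) ^ 4) :=
                mul_le_mul_of_nonneg_left hSN (Real.rpow_nonneg hδ.le _)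
            _ ≤ (ζ / 2)⁻¹ * (2 * (ζ / 2) ^ 4) := mul_le_mul_of_nonneg_right h6 (by positivity)
            _ = 2 * (ζ / 2) ^ 2 * (ζ / 2) := by field_simp
            _ ≤ 1 * (ζ / 2) := mul_le_mul_of_nonneg_right (by nlinarith) hδ.le
            _ = ζ / 2 := one_mul _
        exact h3.trans (mul_le_mul_of_nonneg_left h5 hN0.le)
      -- At threshold `ζ/2` the large points and the at most `N` small straddling ones each cost `N
      -- ζ/2`, so the average error is at most `ζ`.
      have h7 := hqτ (ζ / 2) hδ.le
      rw [Finset.sum_sub_distrib, ← Finset.mul_sum, hp1, mul_one] at h7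
      have h8 : ∑ m, (D m * τ m).trace.re = ∑ i, q (g i) i := by
        simp only [htr]
        rw [Finset.sum_comm]
        simp
      rw [h8, one_div, ← div_eq_inv_mul, le_div_iff₀ hN0]
      linarith

end noiseless

/-- Number of codewords merged into one message. -/
lemma exists_multiplicity {N R : EReal} (hR : R < ⊤) {Mbar K : ℕ} (hM : 0 < Mbar) (hK : 0 < K)
    (h1 : ((Real.logb 2 (Mbar : ℝ) : ℝ) : EReal) ≤ N)
    (h2 : R - N + 1 ≤ ((Real.logb 2 (K : ℝ) : ℝ) : EReal)) :
    ∃ L : ℕ, 0 < L ∧ ((Real.logb 2 ((Mbar * L : ℕ) : ℝ) : ℝ) : EReal) ≤ N ∧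
      R ≤ ((Real.logb 2 ((K * (Mbar * L) : ℕ) : ℝ) : ℝ) : EReal) := by
  have hM0 : (0 : ℝ) < Mbar := by exact_mod_cast hM
  have hK0 : (0 : ℝ) < K := by exact_mod_cast hK
  induction N with
  | bot => exact absurd h1 (by simp)
  | top =>
    -- An infinite coding bound imposes no ceiling on `L`, so `L` alone is taken large enough for
    -- resolvability.
    obtain ⟨r, hr, -⟩ := EReal.lt_iff_exists_real_btwn.1 hR
    obtain ⟨L, hL⟩ := exists_nat_gt ((2 : ℝ) ^ r)
    have hL0 : (0 : ℝ) < L := (Real.rpow_pos_of_pos two_pos r).trans hL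
    refine ⟨L, by exact_mod_cast hL0, le_top, hr.le.trans ?_⟩
    rw [EReal.coe_le_coe_iff, Real.le_logb_iff_rpow_le (by norm_num) (by
      exact_mod_cast Nat.mul_pos hK (Nat.mul_pos hM (by exact_mod_cast hL0)))]
    have hle : L ≤ K * (Mbar * L) := by nlinarith [Nat.mul_pos hK hM, Nat.zero_le L]
    exact hL.le.trans (by exact_mod_cast hle)
  | coe x =>
    rw [EReal.coe_le_coe_iff, Real.logb_le_iff_le_rpow (by norm_num) hM0] at h1
    -- The largest multiplicity allowed by the coding bound. As the quotient is at least 1, rounding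
    -- down loses at most a factor 2, which the `+ 1` in `h2` pays for.
    let L := ⌊(2 : ℝ) ^ x / Mbar⌋₊
    have hx1 : 1 ≤ (2 : ℝ) ^ x / Mbar := by rwa [one_le_div hM0]
    have hL : 0 < L := Nat.floor_pos.2 hx1
    have hL0 : (0 : ℝ) < L := by exact_mod_cast hL
    have hLle : (L : ℝ) ≤ (2 : ℝ) ^ x / Mbar := Nat.floor_le (by positivity)
    have hLge : (2 : ℝ) ^ x / Mbar ≤ 2 * L := by
      have h3 : (2 : ℝ) ^ x / Mbar < L + 1 := Nat.lt_floor_add_one _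
      have h4 : (1 : ℝ) ≤ L := by exact_mod_cast hL
      linarith
    rw [le_div_iff₀ hM0] at hLle
    rw [div_le_iff₀ hM0] at hLge
    refine ⟨L, hL, ?_, ?_⟩
    · rw [EReal.coe_le_coe_iff, Real.logb_le_iff_le_rpow (by norm_num)
        (by exact_mod_cast Nat.mul_pos hM hL)]
      push_cast
      linarith
    · induction R with
      | bot => exact bot_le
      | top => exact absurd hR (lt_irrefl _)
      | coe y =>
        have h5 : y - x + 1 ≤ Real.logb 2 (K : ℝ) := by exact_mod_cast h2
        rw [EReal.coe_le_coe_iff]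
        push_cast
        rw [Real.logb_mul (by positivity) (by positivity)]
        have h6 : x - 1 ≤ Real.logb 2 ((Mbar : ℝ) * L) := by
          rw [Real.le_logb_iff_rpow_le (by norm_num) (by positivity),
            Real.rpow_sub two_pos, Real.rpow_one]
          linarith
        linarith

/-- Any single exponent, here `a = -1`, gives a finite value; `exists_multiplicity` needs this to
choose a finite `L`. -/
lemma resolvabilityRate_lt_top {X d : Type*} [Fintype X] [Fintype d] [DecidableEq d]
    (ξ : ℝ) (σ : CQ X d) : resolvabilityRate ξ σ < ⊤ :=
  lt_of_le_of_lt (iInf₂_le (-1 : ℝ) (by simp)) (EReal.coe_lt_top _)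

end

/-! ### Stego codes -/

section

variable {a b : Type*} [Fintype a] [DecidableEq a] [Fintype b] [DecidableEq b]

/-- Stego code over a noiseless channel. -/
lemma exists_noiseless_stego_code {M N : ℕ} (hM : 0 < M) (hN : 0 < N) {Λ : Fin M → Matrix a a ℂ}
    (hΛ : IsPOVM Λ) {ρ : Fin M → Matrix a a ℂ} (hρ : ∀ w, IsDensity (ρ w)) {ε ζ : ℝ}
    (hcov : 1 - ε ≤ (1 / (M : ℝ)) * ∑ w, (Λ w * ρ w).trace.re) (hζ : 0 < ζ)
    (hrate : ∀ w, ((Real.logb 2 (N : ℝ) : ℝ) : EReal) ≤ noiselessRate ζ (ρ w)) :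
    ∃ stego : CCCode (M * N) a a, stego.IsCC LinearMap.id (ζ + 2 * √ε) ∧
      stego.output LinearMap.id = ((1 / (M : ℝ) : ℝ) : ℂ) • ∑ w, ρ w := by
  have hN0 : (0 : ℝ) < N := by exact_mod_cast hN
  choose τ D hτ hD hτsum hsucc using fun w =>
    exists_distinguishable_decomposition (hρ w) hN hζ (hrate w)
  have hid w m : (LinearMap.id : Matrix a a ℂ →ₗ[ℂ] Matrix a a ℂ) (τ w m) = τ w m := rfl
  have hΛsum w : (1 / ((1 : ℕ) * (N : ℝ))) * ∑ _k : Fin 1, ∑ m, (Λ w * τ w m).trace.re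
      = (Λ w * ρ w).trace.re := by
    have h1 : ∑ m, (Λ w * τ w m).trace.re = N * (Λ w * ρ w).trace.re := by
      rw [← Complex.re_sum, ← Matrix.trace_sum, ← Finset.mul_sum, hτsum, Matrix.mul_smul,
        ← Complex.ofReal_natCast, re_trace_ofReal_smul]
    simp only [Finset.univ_unique, Finset.sum_const, Finset.card_singleton, one_smul, h1]
    push_cast
    field_simp
  obtain ⟨stego, hcc, hout⟩ := exists_keyed_code (K := 1) one_pos hM hN
    (LinearMap.id : Matrix a a ℂ →ₗ[ℂ] Matrix a a ℂ) hΛ (inp := fun _ w m => τ w m)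
    (fun _ w m => hτ w m) (fun _ w m => hτ w m) (D := fun _ w m => D w m) (fun _ w => hD w)
    (ζ := ζ) (ε := ε) (fun w => by simpa using hsucc w)
    (by simpa only [hid, hΛsum] using hcov)
  refine ⟨stego 0, ?_, ?_⟩
  · simpa [IsKeyedCC, CCCode.IsCC] using hcc
  · have h1 : keyedOutput stego LinearMap.id = (stego 0).output LinearMap.id := by
      simp [keyedOutput]
    rw [← h1, hout]
    congr 1
    refine Finset.sum_congr rfl fun w _ => ?_
    simp only [hid, Finset.univ_unique, Finset.sum_const, Finset.card_singleton, one_smul, hτsum]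
    rw [smul_smul]
    have : ((1 / (((1 : ℕ) : ℝ) * (N : ℝ)) : ℝ) : ℂ) * (N : ℂ) = 1 := by
      rw [← Complex.ofReal_natCast, ← Complex.ofReal_mul]
      rw [show 1 / (((1 : ℕ) : ℝ) * (N : ℝ)) * N = 1 by push_cast; field_simp, Complex.ofReal_one]
    rw [this, one_smul]

/-- Inner code at the output of a noisy channel: keyed inputs whose average output imitates `ρ_B`
and whose messages can be decoded. -/
lemma exists_inner_code {X : Type*} [Fintype X] [DecidableEq X] {N K L : ℕ} (hN : 0 < N)
    (hK : 0 < K) (hL : 0 < L) {Φ : Matrix a a ℂ →ₗ[ℂ] Matrix b b ℂ}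
    (hΦ : ∀ ρ, IsDensity ρ → IsDensity (Φ ρ)) {σ : CQ X a} (hσ : σ.IsState) {ζ ξ : ℝ}
    (hζ : 0 < ζ) (hζ1 : ζ ≤ 1) (hξ : 0 < ξ)
    (h1 : ((Real.logb 2 ((N * L : ℕ) : ℝ) : ℝ) : EReal) ≤ noisyRate ζ (σ.map Φ))
    (h2 : resolvabilityRate ξ (σ.map Φ) ≤
      ((Real.logb 2 ((K * (N * L) : ℕ) : ℝ) : ℝ) : EReal)) :
    ∃ (inp : Fin K → Fin N → Matrix a a ℂ) (D : Fin K → Fin N → Matrix b b ℂ),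
      (∀ k m, IsDensity (inp k m)) ∧ (∀ k, IsPOVM (D k)) ∧
      1 - ζ ≤ (1 / ((K : ℝ) * N)) * ∑ k, ∑ m, (D k m * Φ (inp k m)).trace.re ∧
      traceNorm (((1 / ((K : ℝ) * N) : ℝ) : ℂ) • ∑ k, ∑ m, Φ (inp k m) - (σ.map Φ).margQ) ≤ ξ := by
  have hN0 : (0 : ℝ) < N := by exact_mod_cast hN
  have hK0 : (0 : ℝ) < K := by exact_mod_cast hK
  have hL0 : (0 : ℝ) < L := by exact_mod_cast hL
  have hσ' : (σ.map Φ).IsState := ⟨hσ.1, hσ.2.1, fun x => hΦ _ (hσ.2.2 x)⟩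
  have : Nonempty (Fin K) := ⟨⟨0, hK⟩⟩
  have : Nonempty (Fin N) := ⟨⟨0, hN⟩⟩
  have : Nonempty (Fin L) := ⟨⟨0, hL⟩⟩
  obtain ⟨c, D, hD, herr, hres⟩ := hσ'.exists_codebook hζ hζ1 hξ (κ := Fin K)
    (J := Fin N × Fin L) (by simpa using h1) (by simpa using h2)
  have hcard : (Fintype.card (Fin K × Fin N × Fin L) : ℝ) = K * N * L := by
    simp [mul_assoc]
  rw [hcard] at herr hres
  -- The filler index is averaged out by the encoder, and the decoder adds up the corresponding
  -- effects.
  let inp : Fin K → Fin N → Matrix a a ℂ := fun k m =>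
    ((1 / (L : ℝ) : ℝ) : ℂ) • ∑ l, σ.st (c (k, (m, l)))
  have hΦinp k m : Φ (inp k m) = ((1 / (L : ℝ) : ℝ) : ℂ) • ∑ l, (σ.map Φ).st (c (k, (m, l))) := by
    simp only [inp, map_smul, map_sum]; rfl
  refine ⟨inp, fun k m => ∑ l, D k (m, l), fun k m => ?_, fun k => ⟨fun m => ?_, ?_⟩, ?_, ?_⟩
  · refine ⟨posSemidef_ofReal_smul (posSemidef_sum _ fun l _ => (hσ.2.2 _).1) (by positivity), ?_⟩
    simp only [inp, Matrix.trace_smul, Matrix.trace_sum, (hσ.2.2 _).2, Finset.sum_const,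
      Finset.card_univ, Fintype.card_fin, nsmul_eq_mul, mul_one, smul_eq_mul]
    rw [← Complex.ofReal_natCast, ← Complex.ofReal_mul, one_div_mul_cancel hL0.ne',
      Complex.ofReal_one]
  · exact posSemidef_sum _ fun l _ => (hD k).1 _
  · rw [← (hD k).2, Fintype.sum_prod_type]
  -- Confusing two fillers of the same message is harmless: those cross terms are nonnegative and
  -- are dropped.
  · have hlow k m : (1 / (L : ℝ)) * ∑ l, (D k (m, l) * (σ.map Φ).st (c (k, (m, l)))).trace.re
        ≤ ((∑ l, D k (m, l)) * Φ (inp k m)).trace.re := by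
      rw [hΦinp, Matrix.mul_smul, re_trace_ofReal_smul, Finset.mul_sum Finset.univ _
        (∑ l, D k (m, l)), Matrix.trace_sum, Complex.re_sum]
      refine mul_le_mul_of_nonneg_left (Finset.sum_le_sum fun l _ => ?_) (by positivity)
      rw [Finset.sum_mul, Matrix.trace_sum, Complex.re_sum]
      exact Finset.single_le_sum
        (f := fun l' => (D k (m, l') * (σ.map Φ).st (c (k, (m, l)))).trace.re)
        (fun l' _ => re_trace_mul_nonneg ((hD k).1 _) (hσ'.2.2 _).1) (Finset.mem_univ l)
    have h3 : (1 / ((K : ℝ) * N)) * ∑ k, ∑ m, (1 / (L : ℝ)) *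
        ∑ l, (D k (m, l) * (σ.map Φ).st (c (k, (m, l)))).trace.re ≤
        (1 / ((K : ℝ) * N)) * ∑ k, ∑ m, ((∑ l, D k (m, l)) * Φ (inp k m)).trace.re :=
      mul_le_mul_of_nonneg_left (Finset.sum_le_sum fun k _ => Finset.sum_le_sum fun m _ =>
        hlow k m) (by positivity)
    refine le_trans ?_ h3
    simp only [← Finset.mul_sum, Finset.sum_sub_distrib, Fintype.sum_prod_type] at herr ⊢
    simp only [Finset.sum_const, Finset.card_univ, Fintype.card_fin, nsmul_eq_mul, mul_one] at herr
    have e1 : 1 / ((K : ℝ) * N * L) * (K * (N * L)) = 1 := by field_simp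
    rw [mul_sub, e1] at herr
    rw [← mul_assoc, one_div_mul_one_div]
    linarith
  · have e1 : ((1 / ((K : ℝ) * N) : ℝ) : ℂ) • ∑ k, ∑ m, Φ (inp k m)
        = ((1 / ((K : ℝ) * N * L) : ℝ) : ℂ) • ∑ p, (σ.map Φ).st (c p) := by
      simp only [hΦinp, ← Finset.smul_sum, Fintype.sum_prod_type]
      rw [smul_smul, ← Complex.ofReal_mul, one_div_mul_one_div]
    rw [e1]
    exact hres

/-- Stego code with a shared key over a noisy channel. -/
lemma exists_noisy_stego_code {X : Type*} [Fintype X] [DecidableEq X] {M N K : ℕ} (hM : 0 < M)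
    (hN : 0 < N) (hK : 0 < K) {Φ : Matrix a a ℂ →ₗ[ℂ] Matrix b b ℂ}
    (hΦ : ∀ ρ, IsDensity ρ → IsDensity (Φ ρ)) {Λ : Fin M → Matrix b b ℂ} (hΛ : IsPOVM Λ)
    {σ : Fin M → CQ X a} (hσ : ∀ w, (σ w).IsState) {ε ζ ξ : ℝ}
    (hcov : 1 - ε ≤ (1 / (M : ℝ)) * ∑ w, (Λ w * ((σ w).map Φ).margQ).trace.re)
    (hζ : 0 < ζ) (hζ1 : ζ ≤ 1) (hξ : 0 < ξ)
    (hrate : ∀ w, ((Real.logb 2 (N : ℝ) : ℝ) : EReal) ≤ noisyRate ζ ((σ w).map Φ))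
    (hkey : ∀ w, resolvabilityRate ξ ((σ w).map Φ) - noisyRate ζ ((σ w).map Φ) + 1 ≤
      ((Real.logb 2 (K : ℝ) : ℝ) : EReal)) :
    ∃ stego : Fin K → CCCode (M * N) a b, IsKeyedCC stego Φ (ζ + 2 * √(ξ + ε)) ∧
      traceNorm (keyedOutput stego Φ
        - ((1 / (M : ℝ) : ℝ) : ℂ) • ∑ w, ((σ w).map Φ).margQ) ≤ ξ := by
  have hM0 : (0 : ℝ) < M := by exact_mod_cast hM
  choose L hL hL1 hL2 using fun w =>
    exists_multiplicity (resolvabilityRate_lt_top ξ ((σ w).map Φ)) hN hK (hrate w) (hkey w)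
  choose inp D hinp hD hsucc hres using fun w =>
    exists_inner_code hN hK (hL w) hΦ (hσ w) hζ hζ1 hξ (hL1 w) (hL2 w)
  have hmarg w : IsDensity ((σ w).map Φ).margQ :=
    CQ.IsState.margQ_density ⟨(hσ w).1, (hσ w).2.1, fun x => hΦ _ ((hσ w).2.2 x)⟩
  let Z : Fin M → Matrix b b ℂ := fun w =>
    ((1 / ((K : ℝ) * N) : ℝ) : ℂ) • ∑ k, ∑ m, Φ (inp w k m) - ((σ w).map Φ).margQ
  have hZ w : (Z w).IsHermitian :=
    (isHermitian_ofReal_smul (isHermitian_sum _ fun k _ => isHermitian_sum _ fun m _ =>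
      (hΦ _ (hinp w k m)).1.isHermitian) _).sub (hmarg w).1.isHermitian
  have hΛZ w : (Λ w * ((σ w).map Φ).margQ).trace.re - ξ ≤
      (1 / ((K : ℝ) * N)) * ∑ k, ∑ m, (Λ w * Φ (inp w k m)).trace.re := by
    -- Since `-1 ≤ -Λ ≤ 1`, replacing `ρ^w` by its imitation lowers the acceptance probability by at
    -- most `ξ`.
    have h1 := re_trace_mul_le_traceNorm (hZ w) (S := -Λ w)
      (by simpa using PosSemidef.one.add (hΛ.1 w))
      (by simpa [sub_eq_add_neg] using hΛ.one_sub_posSemidef w)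
    have h2 : (Λ w * Z w).trace.re = (1 / ((K : ℝ) * N)) *
        ∑ k, ∑ m, (Λ w * Φ (inp w k m)).trace.re - (Λ w * ((σ w).map Φ).margQ).trace.re := by
      simp only [Z, Matrix.mul_sub, Matrix.mul_smul, Matrix.trace_sub, Complex.sub_re,
        re_trace_ofReal_smul, Finset.mul_sum, Matrix.trace_sum, Complex.re_sum]
    rw [Matrix.neg_mul, Matrix.trace_neg, Complex.neg_re, h2] at h1
    linarith [hres w]
  obtain ⟨stego, hcc, hout⟩ := exists_keyed_code hK hM hN Φ hΛ
    (inp := fun k w m => inp w k m) (fun k w m => hinp w k m) (fun k w m => hΦ _ (hinp w k m))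
    (D := fun k w m => D w k m) (fun k w => hD w k) (ζ := ζ) (ε := ξ + ε) hsucc (by
      have h1 := Finset.sum_le_sum fun w (_ : w ∈ (Finset.univ : Finset (Fin M))) => hΛZ w
      rw [Finset.sum_sub_distrib, Finset.sum_const, Finset.card_univ, Fintype.card_fin,
        nsmul_eq_mul] at h1
      have h2 := mul_le_mul_of_nonneg_left h1 (by positivity : 0 ≤ 1 / (M : ℝ))
      rw [mul_sub, ← mul_assoc (1 / (M : ℝ)) (M : ℝ), one_div_mul_cancel hM0.ne', one_mul] at h2
      linarith)
  refine ⟨stego, hcc, ?_⟩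
  rw [hout, ← smul_sub, ← Finset.sum_sub_distrib]
  exact traceNorm_average_le hM hZ hres

lemma traceNorm_zero : traceNorm (0 : Matrix b b ℂ) = 0 := by
  obtain ⟨S, -, -, h⟩ := exists_traceNorm_eq (Matrix.isHermitian_zero (n := b) (α := ℂ))
  simpa using h

end

end QStego

theorem theorem1 {A B X : Type*} [Fintype A] [DecidableEq A] [Fintype B] [DecidableEq B]
    [Fintype X] [DecidableEq X] (n M : ℕ) (hM : 0 < M) (ε : ℝ)
    (𝓜 : Matrix A A ℂ →ₗ[ℂ] Matrix A A ℂ) (h𝓜 : IsChannel 𝓜) :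
    -- noiseless true channel
    (∀ cover : CCCode M (Fin n → A) (Fin n → A),
      cover.IsCC (tensorPow n LinearMap.id ∘ₗ tensorPow n 𝓜) ε →
      ∀ ζ : ℝ, 0 < ζ → ∀ Mbar : ℕ, 0 < Mbar →
      ((Real.logb 2 (Mbar : ℝ) : ℝ) : EReal) ≤
        ⨅ w, noiselessRate ζ ((tensorPow n LinearMap.id ∘ₗ tensorPow n 𝓜) (cover.enc w)) →
      ∃ stego : CCCode (M * Mbar) (Fin n → A) (Fin n → A),
        stego.IsCC (tensorPow n LinearMap.id) (ζ + 2 * √(ζ + ε)) ∧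
        traceNorm (stego.output (tensorPow n LinearMap.id)
          - cover.output (tensorPow n LinearMap.id ∘ₗ tensorPow n 𝓜)) ≤ ζ) ∧
    -- noisy true channel
    (∀ 𝓝 : Matrix A A ℂ →ₗ[ℂ] Matrix B B ℂ, IsChannel 𝓝 →
      ∀ cover : CCCode M (Fin n → A) (Fin n → B),
      cover.IsCC (tensorPow n 𝓝 ∘ₗ tensorPow n 𝓜) ε →
      ∀ σ : Fin M → CQ X (Fin n → A), (∀ w, (σ w).IsState) →
      (∀ w, ((σ w).map (tensorPow n 𝓝)).margQ =
        (tensorPow n 𝓝 ∘ₗ tensorPow n 𝓜) (cover.enc w)) →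
      ∀ ζ ξ : ℝ, ζ ∈ Set.Ioo (0 : ℝ) 1 → ξ ∈ Set.Ioo (0 : ℝ) 1 →
      ∀ Mbar K : ℕ, 0 < Mbar → 0 < K →
      ((Real.logb 2 (Mbar : ℝ) : ℝ) : EReal) ≤
        ⨅ w, noisyRate ζ ((σ w).map (tensorPow n 𝓝)) →
      (⨆ w, (resolvabilityRate ξ ((σ w).map (tensorPow n 𝓝))
          - noisyRate ζ ((σ w).map (tensorPow n 𝓝)) + 1)) ≤
        ((Real.logb 2 (K : ℝ) : ℝ) : EReal) →
      ∃ stego : Fin K → CCCode (M * Mbar) (Fin n → A) (Fin n → B),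
        IsKeyedCC stego (tensorPow n 𝓝) (ζ + 2 * √(ξ + ε)) ∧
        traceNorm (keyedOutput stego (tensorPow n 𝓝)
          - cover.output (tensorPow n 𝓝 ∘ₗ tensorPow n 𝓜)) ≤ ξ) := by
  refine ⟨fun cover hcov ζ hζ Mbar hMbar hrate => ?_, fun 𝓝 h𝓝 cover hcov σ hσ hmarg ζ ξ hζ hξ
    Mbar K hMbar hK hrate hkey => ?_⟩
  · rw [tensorPow_id, LinearMap.id_comp] at *
    obtain ⟨stego, hcc, hout⟩ := exists_noiseless_stego_code hM hMbar cover.dec_povm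
      (ρ := fun w => tensorPow n 𝓜 (cover.enc w))
      (fun w => h𝓜.tensorPow_density n (cover.enc_density w)) (ε := ε) (ζ := ζ) hcov hζ
      (fun w => hrate.trans (iInf_le _ w))
    refine ⟨stego, ?_, ?_⟩
    -- The exact decomposition gives the stronger error `ζ + 2√ε`.
    · have h1 : √ε ≤ √(ζ + ε) := Real.sqrt_le_sqrt (by linarith)
      unfold CCCode.IsCC at hcc ⊢
      linarith
    -- The two output states coincide, so the distance is zero.
    · rw [hout, CCCode.output]
      push_cast
      rw [sub_self, traceNorm_zero]
      exact hζ.le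
  · obtain ⟨stego, hcc, hout⟩ := exists_noisy_stego_code hM hMbar hK
      (fun ρ hρ => h𝓝.tensorPow_density n hρ) cover.dec_povm hσ (ε := ε) (ζ := ζ) (ξ := ξ)
      (by simp only [hmarg]; exact hcov) hζ.1 hζ.2.le hξ.1
      (fun w => hrate.trans (iInf_le _ w)) (fun w => (le_iSup _ w).trans hkey)
    refine ⟨stego, hcc, ?_⟩
    simp only [hmarg] at hout
    rw [CCCode.output]
    push_cast at hout
    exact hout
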